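/- **Setting.** Let $m\ge 1$ tasks be given, with $F(x)=\frac1m\sum_{i=1}^m f_i(x,y_i^*(x))$, $x\in\mathbb R^d$, $y_i^*(x)=\arg\min_{y\in\mathbb R^{d_i}} g_i(x,y)$, $f_i(x,y)=\mathbb E_{\xi\sim\mathcal P_i}f_i(x,y;\xi)$, $g_i(x,y)=\mathbb E_{\zeta\sim\mathcal Q_i}g_i(x,y;\zeta)$, where $f_i(\cdot,\cdot;\xi)$ is $C^1$ and $g_i(\cdot,\cdot;\zeta)$ is $C^2$. Norms of vectors are Euclidean and norms of matrices in the assumptions are spectral. Let $\mathcal X\subseteq\mathbb R^d$ be convex (for example $\mathcal X=\mathbb R^d$) and $\mathcal Y_i=\{y:\|y\|\le R_i\}$. Assume * $\lambda I\preceq\nabla^2_{yy}g_i(x,y)\preceq L_gI$ for all $x,y$, with $\lambda>0$; * $\nabla_xf_i(\cdot;\xi),\nabla_yf_i(\cdot;\xi),\nabla_yg_i(\cdot;\zeta),\nabla^2_{xy}g_i(\cdot;\zeta),\nabla^2_{yy}g_i(\cdot;\zeta)$ are Lipschitz in $(x,y)$ with constants $L_{fx,i},L_{fy,i},L_{gy,i},L_{gxy,i},L_{gyy,i}$;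 * for $x\in\mathcal X$, $y\in\mathcal Y_i$, the second moments of the norms of these five stochastic derivatives are at most $C_{fx,i}^2,C_{fy,i}^2,C_{gy,i}^2,C_{gxy,i}^2,C_{gyy,i}^2$, and $y_i^*(x)\in\mathcal Y_i$ for $x\in\mathcal X$; * $F$ has a minimizer $x_*$, and $\mu(F(x)-F(x_*))\le\|\nabla F(x)\|^2$ for $x\in\mathcal X$, where $\mu>0$. Tasks are sampled with probabilities $p_i>0$, $\sum_ip_i=1$. Put $C(\mathbf p)=\sum_i(C_{fx,i}^2+C_{fy,i}^2+C_{gy,i}^2+C_{gxy,i}^2+C_{gyy,i}^2)/p_i$ and $L(\mathbf p)=\sum_i(L_{fx,i}^2+L_{fy,i}^2+L_{gy,i}^2+L_{gxy,i}^2+L_{gyy,i}^2)/p_i$. **RSVRB.** A state consists of $x$, $y_i$ and estimators $u_i,v_i,V_i,H_i,w_i$ $(i\le m)$ and $d$ of $\nabla_xf_i,\nabla_yf_i,\nabla^2_{xy}g_i,\nabla^2_{yy}g_i,\nabla_yg_i$ and $\nabla F$; put $z_i=u_i-V_iH_i^{-1}v_i$. A run of length $T$ from a given state performs $T$ iterations;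 before the first one, the previous point is set equal to the current one. Each iteration draws $i$ from $\mathbf p$, $j$ uniformly from $\{1,\dots,m\}$, $\xi\sim\mathcal P_i$ and $\zeta\sim\mathcal Q_i$, independently of the past. For each of the five estimators, with its own parameter $\beta$, and with $h$ its stochastic derivative for the sample drawn, the entry of task $i$ becomes $\Pi\big[(1-\beta)\big(a-\tfrac{h(x_{t-1},y_{i,t-1})}{p_i}\big)+\tfrac{h(x_t,y_{i,t})}{p_i}\big]$, $a$ being the old entry, and the entries of the other tasks are multiplied by $1-\beta$. Here $\Pi$ is the Euclidean (Frobenius) projection onto the ball of radius $C_{fx,i}$ for $u_i$, the ball of radius $C_{fy,i}$ for $v_i$, the spectral ball of radius $C_{gxy,i}$ for $V_i$, and $\{A\succeq\lambda I\}$ for $H_i$ (for $H$ the entries of the other tasks are projected too); there is no projection for $w_i$. Then $$d_{t+1}=(1-\beta_d)(d_t-z_{j,t})+z_{j,t+1},\quad x_{t+1}=x_t-\eta\gamma d_{t+1},\quad y_{k,t+1}=(1-\eta)y_{k,t}+\eta\,\Pi_{\mathcal Y_k}[y_{k,t}-\tau w_{k,t+1}]\ \ (k\le m).$$ The run returns the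 state at a uniformly random time in $\{0,\dots,T\}$. RE-RSVRB runs RSVRB in stages $k=1,2,\dots$ with parameters $\eta_k,T_k$, each stage starting from the output of the previous one; $x_k$ is the $x$-part of the output of stage $k$. The initial state may be random, with $y_i,u_i,v_i,V_i,H_i$ in the sets just named (the values on which the algorithm projects), with $\mathbb E[F(x_0)-F(x_*)]\le\Delta$, and with the expected initial squared error $\mathbb E\big[\frac1m\sum_i\delta_i+\|d-\frac1m\sum_iz_i\|^2\big]\le E_0$, where $\delta_i$ is the sum of $\|y_i-y_i^*(x)\|^2$ and of the squared (Frobenius) errors of $u_i,v_i,V_i,H_i,w_i$ at $(x,y_i)$. **Theorem.** Let $\lambda_0>0$, $B$, $\kappa$, $\Delta$, $E_0$ and $D$ be given. There are positive constants $c_\gamma,c_\tau,\eta_0,c_\varepsilon,c_T,b_{fx},b_{fy},b_{gxy},b_{gyy},b_{gy},b_d,A$, depending only on these numbers, such that the following holds for every problem as above with $\lambda\ge\lambda_0$; with $L_g$, $\mu$ and all $C_{*,i},L_{*,i}$ at most $B$; with $d_i\le D$; and with $m/p_i\le\kappa C(\mathbf p)$ for all $i$. Put $$\gamma=\frac{c_\gamma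 m}{C(\mathbf p)},\quad \tau=\frac{c_\tau m}{C(\mathbf p)},\quad \epsilon_1=\frac{c_\varepsilon\eta_0^2\gamma C(\mathbf p)}{m\mu},\quad \epsilon_k=\frac{\epsilon_1}{2^{k-1}},\quad \eta_k=\sqrt{\frac{m\mu\epsilon_k}{c_\varepsilon\gamma C(\mathbf p)}}\ \ (\text{so }\eta_1=\eta_0),\quad \beta_{*}=b_*\gamma\eta_k^2,$$ $$T_1=\Big\lceil c_T\max\Big\{\frac1{\mu\eta_1\gamma},\frac1{\mu\eta_1^2\gamma}\Big\}\Big\rceil,\qquad T_k=\Big\lceil c_T\max\Big\{\frac1{\mu\eta_k\gamma},\frac1{\eta_k^2\gamma}\Big\}\Big\rceil\quad(k\ge2).$$ Then $\tau\le\frac1{3L_g}$, $\gamma\le\frac m{24L(\mathbf p)}$, $\eta_0\le1$, $\beta_*\le1$, and $2\eta_0\gamma\|\nabla F(x)-\nabla F(x')\|\le\|x-x'\|$ on $\mathcal X$. For every $\epsilon>0$, with $K=1+\lceil\log_2(\epsilon_1/\epsilon)\rceil$ stages ($K=1$ if $\epsilon\ge\epsilon_1$), if the iterates $x_t$ of these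 stages stay in $\mathcal X$ almost surely (no condition if $\mathcal X=\mathbb R^d$), then $$\mathbb E[F(x_K)-F(x_*)]\le\epsilon,$$ and, if $\epsilon\le\epsilon_1$, the total sample complexity satisfies $$\sum_{k=1}^KT_k\le A\Big(\frac{C(\mathbf p)}{\mu^{3/2}m\,\epsilon^{1/2}}+\frac{C(\mathbf p)}{\mu m\,\epsilon}\Big).$$ -/

import Mathlib

open MeasureTheory

namespace Bilevel

/-- Vectors in `ℝⁿ` with the Euclidean norm. -/
abbrev Vec (n : ℕ) := EuclideanSpace ℝ (Fin n)

/-- `a × b` real matrices stored as vectors of entries: the norm of `Mat a b` is the Frobenius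
norm. -/
abbrev Mat (a b : ℕ) := EuclideanSpace ℝ (Fin a × Fin b)

/-- The matrix with the given vector of entries. -/
def toMatrix {a b : ℕ} (A : Mat a b) : Matrix (Fin a) (Fin b) ℝ := Matrix.of fun r c => A (r, c)

open scoped Matrix.Norms.L2Operator in
/-- The spectral norm of a matrix. -/
noncomputable def specNorm {a b : ℕ} (A : Mat a b) : ℝ := ‖toMatrix A‖

/-- Matrix times vector. -/
noncomputable def matVec {a b : ℕ} (A : Matrix (Fin a) (Fin b) ℝ) (v : Vec b) : Vec a :=
  WithLp.toLp 2 (A.mulVec (WithLp.ofLp v))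

/-- Euclidean (for matrices: Frobenius) projection onto a nonempty closed convex set `K`: the point
of `K` nearest to `x`. -/
noncomputable def proj {E : Type*} [NormedAddCommGroup E] (K : Set E) (x : E) : E :=
  Classical.epsilon fun y => y ∈ K ∧ ∀ y' ∈ K, ‖x - y‖ ≤ ‖x - y'‖

/-- `{A : ‖A‖ ≤ C}` for the spectral norm. -/
def specBall (a b : ℕ) (C : ℝ) : Set (Mat a b) := {A | specNorm A ≤ C}

/-- `{A : A ⪰ c I}` (symmetric matrices). -/
def psdAbove (b : ℕ) (c : ℝ) : Set (Mat b b) := {A | (toMatrix A - c • 1).PosSemidef}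

section Derivatives

variable {a b : ℕ}

/-- `∇ₓ h(x, y)`. -/
noncomputable def gradX (h : Vec a → Vec b → ℝ) (x : Vec a) (y : Vec b) : Vec a :=
  gradient (fun x' => h x' y) x

/-- `∇_y h(x, y)`. -/
noncomputable def gradY (h : Vec a → Vec b → ℝ) (x : Vec a) (y : Vec b) : Vec b :=
  gradient (fun y' => h x y') y

/-- `∇²_{xy} h(x, y)`, the `a × b` matrix with entries `∂_{x_r} ∂_{y_c} h`. -/
noncomputable def hessXY (h : Vec a → Vec b → ℝ) (x : Vec a) (y : Vec b) : Mat a b :=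
  WithLp.toLp 2 fun rc =>
    (fderiv ℝ (fun x' => gradY h x' y) x (EuclideanSpace.single rc.1 (1 : ℝ))) rc.2

/-- `∇²_{yy} h(x, y)`, the `b × b` matrix with entries `∂_{y_r} ∂_{y_c} h`. -/
noncomputable def hessYY (h : Vec a → Vec b → ℝ) (x : Vec a) (y : Vec b) : Mat b b :=
  WithLp.toLp 2 fun rc =>
    (fderiv ℝ (fun y' => gradY h x y') y (EuclideanSpace.single rc.1 (1 : ℝ))) rc.2

end Derivatives

/-- Data of a multi-task stochastic bilevel problem with `m` tasks, upper variable in `ℝᵈ`, lower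
variables in `ℝ^(e i)`, together with its constants and the task sampling probabilities `p`. -/
structure Problem (m d : ℕ) (e : Fin m → ℕ) (Ξ Z : Type*)
    [MeasurableSpace Ξ] [MeasurableSpace Z] where
  /-- stochastic upper objectives `f_i(x, y; ξ)` -/
  f : (i : Fin m) → Vec d → Vec (e i) → Ξ → ℝ
  /-- stochastic lower objectives `g_i(x, y; ζ)` -/
  g : (i : Fin m) → Vec d → Vec (e i) → Z → ℝ
  /-- law of `ξ` for task `i` -/
  P : Fin m → Measure Ξ
  /-- law of `ζ` for task `i` -/
  Q : Fin m → Measure Z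
  /-- probabilities with which the tasks are sampled -/
  p : Fin m → ℝ
  /-- strong convexity and smoothness constants of the lower problems -/
  lam : ℝ
  Lg : ℝ
  /-- moment bounds -/
  Cfx : Fin m → ℝ
  Cfy : Fin m → ℝ
  Cgy : Fin m → ℝ
  Cgxy : Fin m → ℝ
  Cgyy : Fin m → ℝ
  /-- Lipschitz constants -/
  Lfx : Fin m → ℝ
  Lfy : Fin m → ℝ
  Lgy : Fin m → ℝ
  Lgxy : Fin m → ℝ
  Lgyy : Fin m → ℝ
  /-- radii of the balls containing the lower solutions -/
  R : Fin m → ℝ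

namespace Problem

variable {m d : ℕ} {e : Fin m → ℕ} {Ξ Z : Type*} [MeasurableSpace Ξ] [MeasurableSpace Z]
  (pb : Problem m d e Ξ Z)

/-- `f_i(x, y) = E f_i(x, y; ξ)`. -/
noncomputable def fbar (i : Fin m) (x : Vec d) (y : Vec (e i)) : ℝ := ∫ ξ, pb.f i x y ξ ∂(pb.P i)

/-- `g_i(x, y) = E g_i(x, y; ζ)`. -/
noncomputable def gbar (i : Fin m) (x : Vec d) (y : Vec (e i)) : ℝ := ∫ ζ, pb.g i x y ζ ∂(pb.Q i)

/-- `y_i^*(x)`, the minimizer of `g_i(x, ·)`. -/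
noncomputable def ystar (i : Fin m) (x : Vec d) : Vec (e i) :=
  Classical.epsilon fun y => ∀ y', pb.gbar i x y ≤ pb.gbar i x y'

/-- `F(x) = (1/m) ∑ f_i(x, y_i^*(x))`. -/
noncomputable def F (x : Vec d) : ℝ := (1 / (m : ℝ)) * ∑ i, pb.fbar i x (pb.ystar i x)

/-- `C(p)`. -/
noncomputable def Cp : ℝ :=
  ∑ i, (pb.Cfx i ^ 2 + pb.Cfy i ^ 2 + pb.Cgy i ^ 2 + pb.Cgxy i ^ 2 + pb.Cgyy i ^ 2) / pb.p i

/-- `L(p)`. -/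
noncomputable def Lp : ℝ :=
  ∑ i, (pb.Lfx i ^ 2 + pb.Lfy i ^ 2 + pb.Lgy i ^ 2 + pb.Lgxy i ^ 2 + pb.Lgyy i ^ 2) / pb.p i

end Problem

/-- `E N(ω)² ≤ C²`, the left side being finite. -/
def SecondMomentLE {Ω : Type*} [MeasurableSpace Ω] (P : Measure Ω) (N : Ω → ℝ) (C : ℝ) : Prop :=
  Integrable (fun ω => N ω ^ 2) P ∧ ∫ ω, N ω ^ 2 ∂P ≤ C ^ 2

/-- `h` is `L`-Lipschitz in `(x, y)` (Euclidean norm of the pair), differences being measured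
by `N`. -/
def JointLipschitz {a b : ℕ} {E : Type*} [Sub E] (N : E → ℝ) (h : Vec a → Vec b → E) (L : ℝ) :
    Prop :=
  ∀ x x' y y', N (h x y - h x' y') ≤ L * Real.sqrt (‖x - x'‖ ^ 2 + ‖y - y'‖ ^ 2)

/-- The assumptions on the problem. The moment bounds, and the bounds on the lower solutions, are
required for `x ∈ X` and `‖y_i‖ ≤ R_i`; the case `X = Set.univ` is the global assumption. -/
structure Assumptions {m d : ℕ} {e : Fin m → ℕ} {Ξ Z : Type*} [MeasurableSpace Ξ]
    [MeasurableSpace Z] (pb : Problem m d e Ξ Z) (X : Set (Vec d)) : Prop where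
  convex_X : Convex ℝ X
  prob_P : ∀ i, IsProbabilityMeasure (pb.P i)
  prob_Q : ∀ i, IsProbabilityMeasure (pb.Q i)
  p_pos : ∀ i, 0 < pb.p i
  p_sum : ∑ i, pb.p i = 1
  const_nonneg : ∀ i, 0 ≤ pb.Cfx i ∧ 0 ≤ pb.Cfy i ∧ 0 ≤ pb.Cgy i ∧ 0 ≤ pb.Cgxy i ∧
    0 ≤ pb.Cgyy i ∧ 0 ≤ pb.Lfx i ∧ 0 ≤ pb.Lfy i ∧ 0 ≤ pb.Lgy i ∧ 0 ≤ pb.Lgxy i ∧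
    0 ≤ pb.Lgyy i ∧ 0 ≤ pb.R i
  -- measurability, integrability and differentiability of the stochastic objectives
  f_meas : ∀ i x y, Measurable (pb.f i x y)
  g_meas : ∀ i x y, Measurable (pb.g i x y)
  f_int : ∀ i x y, Integrable (pb.f i x y) (pb.P i)
  g_int : ∀ i x y, Integrable (pb.g i x y) (pb.Q i)
  f_diff : ∀ i ξ, ContDiff ℝ 1 fun q : Vec d × Vec (e i) => pb.f i q.1 q.2 ξ
  g_diff : ∀ i ζ, ContDiff ℝ 2 fun q : Vec d × Vec (e i) => pb.g i q.1 q.2 ζ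
  -- `λ I ⪯ ∇²_{yy} g_i ⪯ L_g I`
  lam_pos : 0 < pb.lam
  strong : ∀ i x y, (toMatrix (hessYY (pb.gbar i) x y) - pb.lam • 1).PosSemidef
  smooth : ∀ i x y, (pb.Lg • 1 - toMatrix (hessYY (pb.gbar i) x y)).PosSemidef
  -- Lipschitz continuity of the stochastic derivatives
  lip_fx : ∀ i ξ, JointLipschitz norm (gradX fun x y => pb.f i x y ξ) (pb.Lfx i)
  lip_fy : ∀ i ξ, JointLipschitz norm (gradY fun x y => pb.f i x y ξ) (pb.Lfy i)
  lip_gy : ∀ i ζ, JointLipschitz norm (gradY fun x y => pb.g i x y ζ) (pb.Lgy i)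
  lip_gxy : ∀ i ζ, JointLipschitz specNorm (hessXY fun x y => pb.g i x y ζ) (pb.Lgxy i)
  lip_gyy : ∀ i ζ, JointLipschitz specNorm (hessYY fun x y => pb.g i x y ζ) (pb.Lgyy i)
  -- second moments of the stochastic derivatives
  mom_fx : ∀ i, ∀ x ∈ X, ∀ y, ‖y‖ ≤ pb.R i →
    SecondMomentLE (pb.P i) (fun ξ => ‖gradX (fun x y => pb.f i x y ξ) x y‖) (pb.Cfx i)
  mom_fy : ∀ i, ∀ x ∈ X, ∀ y, ‖y‖ ≤ pb.R i →
    SecondMomentLE (pb.P i) (fun ξ => ‖gradY (fun x y => pb.f i x y ξ) x y‖) (pb.Cfy i)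
  mom_gy : ∀ i, ∀ x ∈ X, ∀ y, ‖y‖ ≤ pb.R i →
    SecondMomentLE (pb.Q i) (fun ζ => ‖gradY (fun x y => pb.g i x y ζ) x y‖) (pb.Cgy i)
  mom_gxy : ∀ i, ∀ x ∈ X, ∀ y, ‖y‖ ≤ pb.R i →
    SecondMomentLE (pb.Q i) (fun ζ => specNorm (hessXY (fun x y => pb.g i x y ζ) x y)) (pb.Cgxy i)
  mom_gyy : ∀ i, ∀ x ∈ X, ∀ y, ‖y‖ ≤ pb.R i →
    SecondMomentLE (pb.Q i) (fun ζ => specNorm (hessYY (fun x y => pb.g i x y ζ) x y)) (pb.Cgyy i)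
  -- the lower solutions exist and are bounded
  exists_min : ∀ i x, ∃ y, ∀ y', pb.gbar i x y ≤ pb.gbar i x y'
  ystar_le : ∀ i, ∀ x ∈ X, ‖pb.ystar i x‖ ≤ pb.R i

/-- State of the algorithm: previous and current `(x, y)`, and the estimators
`u, v, V, H, w, d`. -/
structure State (m d : ℕ) (e : Fin m → ℕ) where
  xprev : Vec d
  yprev : (i : Fin m) → Vec (e i)
  x : Vec d
  y : (i : Fin m) → Vec (e i)
  u : Fin m → Vec d
  v : (i : Fin m) → Vec (e i)
  V : (i : Fin m) → Mat d (e i)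
  H : (i : Fin m) → Mat (e i) (e i)
  w : (i : Fin m) → Vec (e i)
  d : Vec d

namespace State

variable {m d : ℕ} {e : Fin m → ℕ}

/-- The state as a tuple. -/
def toProd (s : State m d e) :=
  (s.xprev, s.yprev, s.x, s.y, s.u, s.v, s.V, s.H, s.w, s.d)

/-- The product σ-algebra. -/
instance : MeasurableSpace (State m d e) := MeasurableSpace.comap toProd inferInstance

/-- `z_i = u_i - V_i H_i⁻¹ v_i`. -/
noncomputable def z (s : State m d e) (i : Fin m) : Vec d :=
  s.u i - matVec (toMatrix (s.V i)) (matVec (toMatrix (s.H i))⁻¹ (s.v i))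

/-- The previous point is set to the current one (start of a stage). -/
def restart (s : State m d e) : State m d e := { s with xprev := s.x, yprev := s.y }

end State

/-- Parameters of one run of RSVRB: the step size `η` (which is both `η_t` and `τ_t`), `γ`, `τ`
and the momentum parameters. -/
structure Params where
  η : ℝ
  γ : ℝ
  τ : ℝ
  βfx : ℝ
  βfy : ℝ
  βgxy : ℝ
  βgyy : ℝ
  βgy : ℝ
  βd : ℝ

section Algorithm

variable {m d : ℕ} {e : Fin m → ℕ} {Ξ Z : Type*} [MeasurableSpace Ξ] [MeasurableSpace Z]

/-- `(1 - β)(a - h₀ / p) + h₁ / p`. -/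
noncomputable def storm {E : Type*} [AddCommGroup E] [Module ℝ E] (β p : ℝ) (a h₀ h₁ : E) : E :=
  (1 - β) • (a - (1 / p) • h₀) + (1 / p) • h₁

/-- One iteration of RSVRB, when the tasks `i` (for the estimators) and `j` (for `d`) and the data
`ξ`, `ζ` of task `i` have been sampled. -/
noncomputable def step (pb : Problem m d e Ξ Z) (θ : Params) (s : State m d e) (i j : Fin m)
    (ξ : Ξ) (ζ : Z) : State m d e :=
  let fξ : (k : Fin m) → Vec d → Vec (e k) → ℝ := fun k x y => pb.f k x y ξ
  let gζ : (k : Fin m) → Vec d → Vec (e k) → ℝ := fun k x y => pb.g k x y ζ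
  let u' : Fin m → Vec d := fun k =>
    if k = i then proj (Metric.closedBall 0 (pb.Cfx k))
      (storm θ.βfx (pb.p k) (s.u k) (gradX (fξ k) s.xprev (s.yprev k)) (gradX (fξ k) s.x (s.y k)))
    else (1 - θ.βfx) • s.u k
  let v' : (k : Fin m) → Vec (e k) := fun k =>
    if k = i then proj (Metric.closedBall 0 (pb.Cfy k))
      (storm θ.βfy (pb.p k) (s.v k) (gradY (fξ k) s.xprev (s.yprev k)) (gradY (fξ k) s.x (s.y k)))
    else (1 - θ.βfy) • s.v k
  let V' : (k : Fin m) → Mat d (e k) := fun k =>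
    if k = i then proj (specBall d (e k) (pb.Cgxy k))
      (storm θ.βgxy (pb.p k) (s.V k) (hessXY (gζ k) s.xprev (s.yprev k))
        (hessXY (gζ k) s.x (s.y k)))
    else (1 - θ.βgxy) • s.V k
  let H' : (k : Fin m) → Mat (e k) (e k) := fun k =>
    if k = i then proj (psdAbove (e k) pb.lam)
      (storm θ.βgyy (pb.p k) (s.H k) (hessYY (gζ k) s.xprev (s.yprev k))
        (hessYY (gζ k) s.x (s.y k)))
    else proj (psdAbove (e k) pb.lam) ((1 - θ.βgyy) • s.H k)
  let w' : (k : Fin m) → Vec (e k) := fun k =>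
    if k = i then
      storm θ.βgy (pb.p k) (s.w k) (gradY (gζ k) s.xprev (s.yprev k)) (gradY (gζ k) s.x (s.y k))
    else (1 - θ.βgy) • s.w k
  let t : State m d e :=
    { xprev := s.x, yprev := s.y, x := s.x, y := s.y,
      u := u', v := v', V := V', H := H', w := w', d := s.d }
  let d' : Vec d := (1 - θ.βd) • (s.d - s.z j) + t.z j
  { t with
    d := d'
    x := s.x - (θ.η * θ.γ) • d'
    y := fun k => (1 - θ.η) • s.y k +
      θ.η • proj (Metric.closedBall 0 (pb.R k)) (s.y k - θ.τ • w' k) }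

/-- Law of the state after one iteration from a state with law `ν`: independently of the past, `i`
is drawn from `p`, `j` uniformly, `ξ` from `P_i` and `ζ` from `Q_i`. -/
noncomputable def stepLaw (pb : Problem m d e Ξ Z) (θ : Params) (ν : Measure (State m d e)) :
    Measure (State m d e) :=
  ∑ i, ∑ j, ENNReal.ofReal (pb.p i / m) •
    (ν.prod ((pb.P i).prod (pb.Q i))).map fun q => step pb θ q.1 i j q.2.1 q.2.2

/-- Law of the state after `t` iterations of a run started from the law `ν`. -/
noncomputable def iterLaw (pb : Problem m d e Ξ Z) (θ : Params) (ν : Measure (State m d e)) :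
    ℕ → Measure (State m d e)
  | 0 => ν.map State.restart
  | t + 1 => stepLaw pb θ (iterLaw pb θ ν t)

/-- Law of the output of RSVRB with `T` iterations: the state at a uniformly random time
in `{0, …, T}`. -/
noncomputable def rsvrbLaw (pb : Problem m d e Ξ Z) (θ : Params) (T : ℕ)
    (ν : Measure (State m d e)) : Measure (State m d e) :=
  ((T : ENNReal) + 1)⁻¹ • ∑ t ∈ Finset.range (T + 1), iterLaw pb θ ν t

/-- Law of the output of stage `k` of RE-RSVRB, where stage `k ≥ 1` is a run of RSVRB with
parameters `θ k` and length `T k` from the output of stage `k - 1`. -/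
noncomputable def reRsvrbLaw (pb : Problem m d e Ξ Z) (θ : ℕ → Params) (T : ℕ → ℕ)
    (ν : Measure (State m d e)) : ℕ → Measure (State m d e)
  | 0 => ν
  | k + 1 => rsvrbLaw pb (θ (k + 1)) (T (k + 1)) (reRsvrbLaw pb θ T ν k)

/-- Feasible states: the values are in the sets on which the algorithm projects. -/
def Feasible (pb : Problem m d e Ξ Z) (s : State m d e) : Prop :=
  ∀ i, ‖s.y i‖ ≤ pb.R i ∧ ‖s.u i‖ ≤ pb.Cfx i ∧ ‖s.v i‖ ≤ pb.Cfy i ∧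
    s.V i ∈ specBall d (e i) (pb.Cgxy i) ∧ s.H i ∈ psdAbove (e i) pb.lam

/-- Total squared error of the lower variables and of the estimators of a state. -/
noncomputable def stateError (pb : Problem m d e Ξ Z) (s : State m d e) : ℝ :=
  (1 / (m : ℝ)) * ∑ i, (‖s.y i - pb.ystar i s.x‖ ^ 2
    + ‖s.u i - gradX (pb.fbar i) s.x (s.y i)‖ ^ 2
    + ‖s.v i - gradY (pb.fbar i) s.x (s.y i)‖ ^ 2
    + ‖s.V i - hessXY (pb.gbar i) s.x (s.y i)‖ ^ 2
    + ‖s.H i - hessYY (pb.gbar i) s.x (s.y i)‖ ^ 2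
    + ‖s.w i - gradY (pb.gbar i) s.x (s.y i)‖ ^ 2)
  + ‖s.d - (1 / (m : ℝ)) • ∑ i, s.z i‖ ^ 2

end Algorithm

/-- The numerical constants in the parameter choices. -/
structure Constants where
  cγ : ℝ
  cτ : ℝ
  η₀ : ℝ
  cε : ℝ
  cT : ℝ
  bfx : ℝ
  bfy : ℝ
  bgxy : ℝ
  bgyy : ℝ
  bgy : ℝ
  bd : ℝ

/-- All constants are positive. -/
def Constants.Pos (c : Constants) : Prop :=
  0 < c.cγ ∧ 0 < c.cτ ∧ 0 < c.η₀ ∧ 0 < c.cε ∧ 0 < c.cT ∧ 0 < c.bfx ∧ 0 < c.bfy ∧ 0 < c.bgxy ∧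
    0 < c.bgyy ∧ 0 < c.bgy ∧ 0 < c.bd

section Schedule

variable {m d : ℕ} {e : Fin m → ℕ} {Ξ Z : Type*} [MeasurableSpace Ξ] [MeasurableSpace Z]

/-- `γ = c_γ m / C(p)`. -/
noncomputable def gam (c : Constants) (pb : Problem m d e Ξ Z) : ℝ := c.cγ * (m / pb.Cp)

/-- `τ = c_τ m / C(p)`. -/
noncomputable def tau (c : Constants) (pb : Problem m d e Ξ Z) : ℝ := c.cτ * (m / pb.Cp)

/-- `ε₁ = c_ε η₀² γ C(p) / (m μ)`. -/
noncomputable def epsOne (c : Constants) (pb : Problem m d e Ξ Z) (μ : ℝ) : ℝ :=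
  c.cε * c.η₀ ^ 2 * gam c pb * pb.Cp / (m * μ)

/-- `ε_k = ε₁ / 2^(k-1)`, for `k ≥ 1`. -/
noncomputable def epsStage (c : Constants) (pb : Problem m d e Ξ Z) (μ : ℝ) (k : ℕ) : ℝ :=
  epsOne c pb μ / 2 ^ (k - 1)

/-- `η_k = √(m μ ε_k / (c_ε γ C(p)))`; in particular `η₁ = η₀`. -/
noncomputable def etaStage (c : Constants) (pb : Problem m d e Ξ Z) (μ : ℝ) (k : ℕ) : ℝ :=
  Real.sqrt (m * μ * epsStage c pb μ k / (c.cε * gam c pb * pb.Cp))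

/-- Parameters of stage `k`; the momentum parameters are proportional to `γ η_k²`. -/
noncomputable def paramsStage (c : Constants) (pb : Problem m d e Ξ Z) (μ : ℝ) (k : ℕ) : Params :=
  let η := etaStage c pb μ k
  let γ := gam c pb
  { η := η, γ := γ, τ := tau c pb
    βfx := c.bfx * γ * η ^ 2
    βfy := c.bfy * γ * η ^ 2
    βgxy := c.bgxy * γ * η ^ 2
    βgyy := c.bgyy * γ * η ^ 2
    βgy := c.bgy * γ * η ^ 2
    βd := c.bd * γ * η ^ 2 }

/-- Stage lengths: `T₁ = ⌈c_T max{1/(μ η₁ γ), 1/(μ η₁² γ)}⌉` and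
`T_k = ⌈c_T max{1/(μ η_k γ), 1/(η_k² γ)}⌉` for `k ≥ 2`. -/
noncomputable def lengthStage (c : Constants) (pb : Problem m d e Ξ Z) (μ : ℝ) (k : ℕ) : ℕ :=
  let η := etaStage c pb μ k
  let γ := gam c pb
  if k ≤ 1 then ⌈c.cT * max (1 / (μ * η * γ)) (1 / (μ * η ^ 2 * γ))⌉₊
  else ⌈c.cT * max (1 / (μ * η * γ)) (1 / (η ^ 2 * γ))⌉₊

/-- The parameters are in the admissible range: `τ ≤ 1/(3 L_g)`, `γ ≤ m/(24 L(p))`, `η₀ ≤ 1`,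
`2 η₀ γ` times the Lipschitz constant of `∇F` on `X` is at most one, and all momentum parameters
(which are largest in the first stage) are at most one. -/
def Admissible (c : Constants) (pb : Problem m d e Ξ Z) (X : Set (Vec d)) : Prop :=
  3 * pb.Lg * tau c pb ≤ 1 ∧ 24 * pb.Lp * gam c pb ≤ m ∧ c.η₀ ≤ 1 ∧
  (∀ x ∈ X, ∀ x' ∈ X,
    2 * c.η₀ * gam c pb * ‖gradient pb.F x - gradient pb.F x'‖ ≤ ‖x - x'‖) ∧
  ∀ b ∈ [c.bfx, c.bfy, c.bgxy, c.bgyy, c.bgy, c.bd], b * gam c pb * c.η₀ ^ 2 ≤ 1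

end Schedule

/-- Bounds on which the hidden constants may depend: `B` bounds `L_g` and all moment and Lipschitz
constants of the tasks, `D` the dimensions of the lower variables, and `m / p_i ≤ κ C(p)`. -/
structure UniformBounds {m d : ℕ} {e : Fin m → ℕ} {Ξ Z : Type*} [MeasurableSpace Ξ]
    [MeasurableSpace Z] (pb : Problem m d e Ξ Z) (lam B κ : ℝ) (D : ℕ) : Prop where
  lam_le : lam ≤ pb.lam
  Lg_le : pb.Lg ≤ B
  const_le : ∀ i, pb.Cfx i ≤ B ∧ pb.Cfy i ≤ B ∧ pb.Cgy i ≤ B ∧ pb.Cgxy i ≤ B ∧ pb.Cgyy i ≤ B ∧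
    pb.Lfx i ≤ B ∧ pb.Lfy i ≤ B ∧ pb.Lgy i ≤ B ∧ pb.Lgxy i ≤ B ∧ pb.Lgyy i ≤ B
  dim_le : ∀ i, e i ≤ D
  balanced : ∀ i, m / pb.p i ≤ κ * pb.Cp

end Bilevel

/-! The proof is a Lyapunov argument for one stage, followed by an induction over the restarts.

Hypergradient. Strong convexity makes `ystar` Lipschitz, and implicit differentiation shows that
∇F(x) is the mean over tasks of u − V H⁻¹ v evaluated at the true derivatives and y = y*(x). On the
sets onto which the algorithm projects (u, v, V bounded, H ⪰ λI) this expression is Lipschitz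
(`norm_zmap_sub_le`), so the error of the estimated hypergradient is controlled by the errors of the
estimators and by ‖y − y*‖.

Estimators. A correction made with probability p_k and weighted by 1/p_k has the right mean. Hence
the squared error of each estimator contracts by 1 − β up to (1/p_k)·(drift + β²·second moment), the
drift being the squared length of the last move (`Oracle.avgLE_error`). Projections do no harm,
since they are nonexpansive and the true derivatives lie in the sets. Averaging over tasks replaces
1/p_k by a multiple of S = C(p)/m. The estimator d obeys a similar recursion for the uniform index
j, driven by the movement of the z_k, which is bounded in turn by `Oracle.avgLE_movement`.

Lyapunov function. Three further inequalities hold pathwise: the lower error contracts by 1 − ητλ/2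
(`step_errY_le`), the new drift is O(η²) times ‖d‖² and errors (`step_drift_le`), and F decreases by
ηγ(‖∇F‖²/2 + ‖d‖²/4) up to errors (`step_F_le`). With β = bγη², a suitable combination of F − F*,
the lower error, and 1/η times (estimator error + 3C₀S·drift) decreases in mean by ηγ times all
these quantities, up to noise ηγ·N·η² (`step_potential`). Here N is a numerical constant because γS
is. The gradient condition turns ‖∇F‖² into μ(F − F*). Summing over the T + 1 possible output times
bounds μ·gap/2 plus all errors at the output by Φ₀/(ηγ(T+1)) + Nη² (`Controlled.rsvrbLaw`).

Restarts. If a stage ends with this quantity at most 2Nη², the gap is at most 4Nη²/μ and the state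
error is O(η²). Restarting with η² halved, the initial potential is O(η²/μ) + O(1/η)·O(η²). Dividing
by ηγT shows that T of order max{1/(μηγ), 1/(η²γ)} re-establishes the bound for the new η. The first
stage has to absorb arbitrary initial errors and is handled through `T_first`. The stage lengths
grow geometrically, so their sum is governed by the last stage; the exceptional term of the first
stage is absorbed because ε ≤ ε₁. -/

namespace Bilevel

/-! ### Projections onto closed convex sets. -/

section Projection

variable {E : Type*} [NormedAddCommGroup E] [InnerProductSpace ℝ E] [CompleteSpace E]

theorem proj_spec {K : Set E} (hne : K.Nonempty) (hcl : IsClosed K) (hcv : Convex ℝ K) (x : E) :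
    proj K x ∈ K ∧ ∀ y' ∈ K, ‖x - proj K x‖ ≤ ‖x - y'‖ := by
  have h : ∃ y, y ∈ K ∧ ∀ y' ∈ K, ‖x - y‖ ≤ ‖x - y'‖ := by
    obtain ⟨v, hv, hmin⟩ := exists_norm_eq_iInf_of_complete_convex hne hcl.isComplete hcv x
    refine ⟨v, hv, fun y' hy' => ?_⟩
    rw [hmin]
    exact ciInf_le (f := fun w : K => ‖x - w‖) ⟨0, by rintro _ ⟨w, rfl⟩; exact norm_nonneg _⟩ ⟨y', hy'⟩
  exact Classical.epsilon_spec h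

theorem proj_mem {K : Set E} (hne : K.Nonempty) (hcl : IsClosed K) (hcv : Convex ℝ K) (x : E) :
    proj K x ∈ K := (proj_spec hne hcl hcv x).1

theorem inner_proj_nonpos {K : Set E} (hne : K.Nonempty) (hcl : IsClosed K) (hcv : Convex ℝ K)
    (x : E) {c : E} (hc : c ∈ K) : inner ℝ (x - proj K x) (c - proj K x) ≤ 0 := by
  obtain ⟨hm, hmin⟩ := proj_spec hne hcl hcv x
  refine (norm_eq_iInf_iff_real_inner_le_zero hcv hm).1 ?_ c hc
  have : Nonempty K := ⟨⟨_, hm⟩⟩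
  apply le_antisymm
  · exact le_ciInf fun w => hmin w w.2
  · exact ciInf_le (f := fun w : K => ‖x - w‖) ⟨0, by rintro _ ⟨w, rfl⟩; exact norm_nonneg _⟩
      ⟨_, hm⟩

/-- Adding the variational inequalities at the two projections gives ‖a − b‖² ≤ ⟨x − y, a − b⟩, and
Cauchy–Schwarz finishes. -/
theorem norm_proj_sub_proj_le {K : Set E} (hne : K.Nonempty) (hcl : IsClosed K) (hcv : Convex ℝ K)
    (x y : E) : ‖proj K x - proj K y‖ ≤ ‖x - y‖ := by
  have h1 := inner_proj_nonpos hne hcl hcv x (proj_mem hne hcl hcv y)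
  have h2 := inner_proj_nonpos hne hcl hcv y (proj_mem hne hcl hcv x)
  set a := proj K x
  set b := proj K y
  have h3 : ‖a - b‖ ^ 2 ≤ inner ℝ (x - y) (a - b) := by
    rw [← real_inner_self_eq_norm_sq]
    have e1 : inner ℝ (x - a) (b - a) = - inner ℝ (x - a) (a - b) := by
      rw [← inner_neg_right, neg_sub]
    have e2 : inner ℝ (x - y) (a - b) =
      inner ℝ (x - a) (a - b) + inner ℝ (a - b) (a - b) - inner ℝ (y - b) (a - b) := by
      simp only [inner_sub_left, inner_sub_right]; ring
    linarith
  have h4 := real_inner_le_norm (x - y) (a - b)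
  by_contra! hlt
  have : 0 < ‖a - b‖ := lt_of_le_of_lt (norm_nonneg _) hlt
  nlinarith

theorem proj_eq_self {K : Set E} (hcl : IsClosed K) (hcv : Convex ℝ K) {c : E} (hc : c ∈ K) :
    proj K c = c := by
  have h := (proj_spec ⟨c, hc⟩ hcl hcv c).2 c hc
  simp only [sub_self, norm_zero, norm_le_zero_iff] at h
  exact (sub_eq_zero.1 h).symm

/-- The form in which nonexpansiveness enters the estimator analysis: c is either the true
derivative or the old estimator value, both of which lie in the set. -/
theorem norm_proj_sub_le {K : Set E} (hcl : IsClosed K) (hcv : Convex ℝ K)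
    (x : E) {c : E} (hc : c ∈ K) : ‖proj K x - c‖ ≤ ‖x - c‖ := by
  simpa [proj_eq_self hcl hcv hc] using norm_proj_sub_proj_le ⟨c, hc⟩ hcl hcv x c

theorem continuous_proj {K : Set E} (hne : K.Nonempty) (hcl : IsClosed K) (hcv : Convex ℝ K) :
    Continuous (proj K) := by
  refine (LipschitzWith.of_dist_le_mul (K := 1) fun x y => ?_).continuous
  simpa [dist_eq_norm] using norm_proj_sub_proj_le hne hcl hcv x y

end Projection

/-! ### Matrices: Frobenius and spectral norms, and the set of A ⪰ cI. -/

section Matrices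

variable {a b : ℕ}

theorem matVec_apply (A : Matrix (Fin a) (Fin b) ℝ) (v : Vec b) (i : Fin a) :
    matVec A v i = ∑ j, A i j * v j := rfl

theorem matVec_add (A : Matrix (Fin a) (Fin b) ℝ) (v w : Vec b) :
    matVec A (v + w) = matVec A v + matVec A w := by
  ext i; simp [matVec, Matrix.mulVec_add]

theorem matVec_sub (A : Matrix (Fin a) (Fin b) ℝ) (v w : Vec b) :
    matVec A (v - w) = matVec A v - matVec A w := by
  ext i; simp [matVec, Matrix.mulVec_sub]

theorem sub_matVec (A A' : Matrix (Fin a) (Fin b) ℝ) (v : Vec b) :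
    matVec (A - A') v = matVec A v - matVec A' v := by
  ext i; simp [matVec, Matrix.sub_mulVec]

theorem matVec_mul {c : ℕ} (A : Matrix (Fin a) (Fin b) ℝ) (A' : Matrix (Fin b) (Fin c) ℝ)
    (v : Vec c) : matVec (A * A') v = matVec A (matVec A' v) := by
  ext i; simp [matVec]

theorem matVec_one (v : Vec b) : matVec (1 : Matrix (Fin b) (Fin b) ℝ) v = v := by
  ext i; simp [matVec]

theorem toMatrix_add (A A' : Mat a b) : toMatrix (A + A') = toMatrix A + toMatrix A' := by
  ext i j; simp [toMatrix]

theorem toMatrix_sub (A A' : Mat a b) : toMatrix (A - A') = toMatrix A - toMatrix A' := by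
  ext i j; simp [toMatrix]

theorem toMatrix_smul (c : ℝ) (A : Mat a b) : toMatrix (c • A) = c • toMatrix A := by
  ext i j; simp [toMatrix]

theorem inner_matVec_left (A : Matrix (Fin a) (Fin b) ℝ) (v : Vec b) (w : Vec a) :
    inner ℝ (matVec A v) w = inner ℝ v (matVec A.transpose w) := by
  simp only [PiLp.inner_apply, matVec_apply, RCLike.inner_apply, conj_trivial,
    Matrix.transpose_apply, Finset.mul_sum, Finset.sum_mul]
  rw [Finset.sum_comm]
  refine Finset.sum_congr rfl fun i _ => Finset.sum_congr rfl fun j _ => by ring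

theorem matSq_eq (A : Mat a b) : ‖A‖ ^ 2 = ∑ i, ∑ j, A (i, j) ^ 2 := by
  rw [EuclideanSpace.norm_sq_eq, ← Finset.univ_product_univ, Finset.sum_product]
  simp

theorem norm_matVec_le (A : Mat a b) (v : Vec b) : ‖matVec (toMatrix A) v‖ ≤ ‖A‖ * ‖v‖ := by
  apply le_of_sq_le_sq _ (by positivity)
  rw [mul_pow, matSq_eq, EuclideanSpace.norm_sq_eq, Finset.sum_mul]
  refine Finset.sum_le_sum fun i _ => ?_
  rw [matVec_apply, EuclideanSpace.norm_sq_eq]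
  simpa [toMatrix] using Finset.sum_mul_sq_le_sq_mul_sq Finset.univ (fun j => A (i, j)) (fun j => v j)

theorem norm_transpose_matVec_le (A : Mat a b) (v : Vec a) :
    ‖matVec (toMatrix A).transpose v‖ ≤ ‖A‖ * ‖v‖ := by
  apply le_of_sq_le_sq _ (by positivity)
  rw [mul_pow, matSq_eq, EuclideanSpace.norm_sq_eq, Finset.sum_comm, Finset.sum_mul]
  refine Finset.sum_le_sum fun i _ => ?_
  rw [matVec_apply, EuclideanSpace.norm_sq_eq]
  simpa [toMatrix] using Finset.sum_mul_sq_le_sq_mul_sq Finset.univ (fun j => A (j, i)) (fun j => v j)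

open scoped Matrix.Norms.L2Operator in
theorem norm_matVec_le_spec (A : Mat a b) (v : Vec b) :
    ‖matVec (toMatrix A) v‖ ≤ specNorm A * ‖v‖ := by
  simpa [matVec, specNorm] using Matrix.l2_opNorm_mulVec (toMatrix A) v

open scoped Matrix.Norms.L2Operator in
theorem specNorm_nonneg (A : Mat a b) : 0 ≤ specNorm A := by
  unfold specNorm; exact norm_nonneg _

open scoped Matrix.Norms.L2Operator in
theorem specNorm_le_of_forall {A : Mat a b} {C : ℝ} (hC : 0 ≤ C)
    (h : ∀ v : Vec b, ‖matVec (toMatrix A) v‖ ≤ C * ‖v‖) : specNorm A ≤ C := by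
  unfold specNorm
  rw [Matrix.l2_opNorm_def]
  exact ContinuousLinearMap.opNorm_le_bound _ hC h

theorem specNorm_le_norm (A : Mat a b) : specNorm A ≤ ‖A‖ :=
  specNorm_le_of_forall (norm_nonneg _) (norm_matVec_le A)

theorem specNorm_add_le (A A' : Mat a b) : specNorm (A + A') ≤ specNorm A + specNorm A' :=
  specNorm_le_of_forall (add_nonneg (specNorm_nonneg _) (specNorm_nonneg _)) fun v => by
    have : matVec (toMatrix (A + A')) v = matVec (toMatrix A) v + matVec (toMatrix A') v := by
      ext i; simp [matVec, toMatrix_add, Matrix.add_mulVec]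
    rw [this, add_mul]
    exact (norm_add_le _ _).trans
      (add_le_add (norm_matVec_le_spec A v) (norm_matVec_le_spec A' v))

theorem specNorm_smul_le (c : ℝ) (A : Mat a b) : specNorm (c • A) ≤ |c| * specNorm A :=
  specNorm_le_of_forall (mul_nonneg (abs_nonneg _) (specNorm_nonneg _)) fun v => by
    have : matVec (toMatrix (c • A)) v = c • matVec (toMatrix A) v := by
      ext i; simp [matVec, toMatrix_smul, Matrix.smul_mulVec]
    rw [this, norm_smul, mul_assoc]
    exact mul_le_mul_of_nonneg_left (norm_matVec_le_spec A v) (abs_nonneg _)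

/-- The j-th column is the image of the j-th basis vector, so each of the b columns has length at
most the spectral norm. -/
theorem norm_sq_le_spec (A : Mat a b) : ‖A‖ ^ 2 ≤ b * specNorm A ^ 2 := by
  have h : ∀ j, ∑ i, A (i, j) ^ 2 ≤ specNorm A ^ 2 := fun j => by
    have h1 := norm_matVec_le_spec A (EuclideanSpace.single j (1 : ℝ))
    have h2 : ‖matVec (toMatrix A) (EuclideanSpace.single j (1 : ℝ))‖ ^ 2 = ∑ i, A (i, j) ^ 2 := by
      rw [EuclideanSpace.norm_sq_eq]
      refine Finset.sum_congr rfl fun i _ => ?_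
      rw [matVec_apply]
      simp [toMatrix]
    rw [← h2]
    refine pow_le_pow_left₀ (norm_nonneg _) ?_ 2
    simpa using h1
  rw [matSq_eq, Finset.sum_comm]
  calc ∑ j, ∑ i, A (i, j) ^ 2 ≤ ∑ _j : Fin b, specNorm A ^ 2 := Finset.sum_le_sum fun j _ => h j
    _ = b * specNorm A ^ 2 := by simp

theorem norm_le_spec {D : ℕ} (hb : b ≤ D) (A : Mat a b) : ‖A‖ ≤ (D + 1) * specNorm A := by
  apply le_of_sq_le_sq _ (mul_nonneg (by positivity) (specNorm_nonneg _))
  refine (norm_sq_le_spec A).trans ?_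
  rw [mul_pow]
  have : (b : ℝ) ≤ (D + 1) ^ 2 := by
    have : (b : ℝ) ≤ D := by exact_mod_cast hb
    nlinarith [(Nat.cast_nonneg D : (0 : ℝ) ≤ D)]
  gcongr

theorem abs_specNorm_sub_le (A A' : Mat a b) : |specNorm A - specNorm A'| ≤ ‖A - A'‖ := by
  have h := specNorm_add_le (A - A') A'
  have h' := specNorm_add_le (A' - A) A
  simp only [sub_add_cancel] at h h'
  have h1 := specNorm_le_norm (A - A')
  have h2 := specNorm_le_norm (A' - A)
  rw [norm_sub_rev] at h2
  rw [abs_le]; constructor <;> linarith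

theorem continuous_specNorm : Continuous (specNorm : Mat a b → ℝ) := by
  refine (LipschitzWith.of_dist_le_mul (K := 1) fun x y => ?_).continuous
  simpa [dist_eq_norm] using abs_specNorm_sub_le x y

theorem isClosed_specBall (C : ℝ) : IsClosed (specBall a b C) :=
  isClosed_le continuous_specNorm continuous_const

theorem convex_specBall (C : ℝ) : Convex ℝ (specBall a b C) := by
  intro A hA A' hA' s t hs ht hst
  simp only [specBall, Set.mem_ofPred_eq] at *
  calc specNorm (s • A + t • A') ≤ |s| * specNorm A + |t| * specNorm A' :=
        (specNorm_add_le _ _).trans (add_le_add (specNorm_smul_le _ _) (specNorm_smul_le _ _))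
    _ ≤ s * C + t * C := by rw [abs_of_nonneg hs, abs_of_nonneg ht]; gcongr
    _ = C := by rw [← add_mul, hst, one_mul]

theorem zero_mem_specBall {C : ℝ} (hC : 0 ≤ C) : (0 : Mat a b) ∈ specBall a b C := by
  simp only [specBall, Set.mem_ofPred_eq]
  exact (specNorm_le_norm _).trans (by simpa using hC)

/-- Symmetry and each inequality for a fixed v are closed convex conditions on A, so closedness and
convexity of the set can be read off from this form. -/
theorem mem_psdAbove_iff {c : ℝ} {A : Mat b b} :
    A ∈ psdAbove b c ↔ (∀ i j, A (i, j) = A (j, i)) ∧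
      ∀ v : Vec b, c * ‖v‖ ^ 2 ≤ inner ℝ v (matVec (toMatrix A) v) := by
  simp only [psdAbove, Set.mem_ofPred_eq]
  rw [Matrix.posSemidef_iff_dotProduct_mulVec]
  constructor
  · rintro ⟨h1, h2⟩
    constructor
    · intro i j
      have := congrFun (congrFun h1 i) j
      by_cases hij : i = j
      · rw [hij]
      · have hji : ¬ j = i := fun h => hij h.symm
        simpa [toMatrix, Matrix.conjTranspose_apply, Matrix.one_apply, hij, hji] using this.symm
    · intro v
      have := h2 (WithLp.ofLp v)
      simp only [Matrix.sub_mulVec, dotProduct_sub, Matrix.smul_mulVec, Matrix.one_mulVec,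
        dotProduct_smul, star_trivial] at this
      have e1 : ‖v‖ ^ 2 = (WithLp.ofLp v) ⬝ᵥ (WithLp.ofLp v) := by
        rw [EuclideanSpace.norm_sq_eq]; simp [dotProduct, pow_two]
      have e2 : inner ℝ v (matVec (toMatrix A) v)
          = (WithLp.ofLp v) ⬝ᵥ (toMatrix A).mulVec (WithLp.ofLp v) := by
        simp [PiLp.inner_apply, dotProduct, matVec, mul_comm]
      rw [e1, e2]; simpa using this
  · rintro ⟨h1, h2⟩
    constructor
    · ext i j
      by_cases hij : i = j
      · rw [hij]; simp
      · have hji : ¬ j = i := fun h => hij h.symm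
        simpa [toMatrix, Matrix.conjTranspose_apply, Matrix.one_apply, hij, hji] using (h1 i j).symm
    · intro x
      have := h2 (WithLp.toLp 2 x)
      have e1 : ‖WithLp.toLp 2 x‖ ^ 2 = x ⬝ᵥ x := by
        rw [EuclideanSpace.norm_sq_eq]; simp [dotProduct, pow_two]
      have e2 : inner ℝ (WithLp.toLp 2 x) (matVec (toMatrix A) (WithLp.toLp 2 x))
          = x ⬝ᵥ (toMatrix A).mulVec x := by
        simp [PiLp.inner_apply, dotProduct, matVec, mul_comm]
      rw [e1, e2] at this
      simp only [Matrix.sub_mulVec, dotProduct_sub, Matrix.smul_mulVec, Matrix.one_mulVec,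
        dotProduct_smul, star_trivial]
      simpa using this

theorem continuous_matVec_left (v : Vec b) :
    Continuous fun A : Mat a b => matVec (toMatrix A) v := by
  unfold matVec toMatrix
  refine (PiLp.continuous_toLp 2 _).comp ?_
  refine continuous_pi fun i => ?_
  simp only [Matrix.mulVec, dotProduct, Matrix.of_apply]
  fun_prop

theorem isClosed_psdAbove (c : ℝ) : IsClosed (psdAbove b c) := by
  have : psdAbove b c = (⋂ i, ⋂ j, {A : Mat b b | A (i, j) = A (j, i)}) ∩
      ⋂ v : Vec b, {A : Mat b b | c * ‖v‖ ^ 2 ≤ inner ℝ v (matVec (toMatrix A) v)} := by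
    ext A; rw [mem_psdAbove_iff]; simp
  rw [this]
  refine IsClosed.inter (isClosed_iInter fun i => isClosed_iInter fun j =>
    isClosed_eq (by fun_prop) (by fun_prop)) (isClosed_iInter fun v =>
    isClosed_le continuous_const (continuous_const.inner (continuous_matVec_left v)))

theorem convex_psdAbove (c : ℝ) : Convex ℝ (psdAbove b c) := by
  intro A hA A' hA' s t hs ht hst
  rw [mem_psdAbove_iff] at *
  refine ⟨fun i j => by simp [hA.1 i j, hA'.1 i j], fun v => ?_⟩
  have e : matVec (toMatrix (s • A + t • A')) v
      = s • matVec (toMatrix A) v + t • matVec (toMatrix A') v := by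
    ext i
    simp [matVec, toMatrix_smul, toMatrix_add, Matrix.add_mulVec, Matrix.smul_mulVec]
  rw [e, inner_add_right, inner_smul_right, inner_smul_right]
  have h1 := mul_le_mul_of_nonneg_left (hA.2 v) hs
  have h2 := mul_le_mul_of_nonneg_left (hA'.2 v) ht
  calc c * ‖v‖ ^ 2 = s * (c * ‖v‖ ^ 2) + t * (c * ‖v‖ ^ 2) := by rw [← add_mul, hst, one_mul]
    _ ≤ _ := add_le_add h1 h2

theorem nonempty_psdAbove (c : ℝ) : (psdAbove b c).Nonempty := by
  refine ⟨WithLp.toLp 2 fun rc => c * (if rc.1 = rc.2 then 1 else 0), ?_⟩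
  rw [mem_psdAbove_iff]
  refine ⟨fun i j => by simp [eq_comm], fun v => le_of_eq ?_⟩
  have : matVec (toMatrix (WithLp.toLp 2 fun rc : Fin b × Fin b => c * (if rc.1 = rc.2 then 1 else 0))) v
      = c • v := by
    ext i; rw [matVec_apply]; simp [toMatrix]
  rw [this, inner_smul_right, real_inner_self_eq_norm_sq]

theorem psdAbove_mono {c c' : ℝ} (h : c' ≤ c) : psdAbove b c ⊆ psdAbove b c' := by
  intro A hA
  rw [mem_psdAbove_iff] at *
  exact ⟨hA.1, fun v => (mul_le_mul_of_nonneg_right h (by positivity)).trans (hA.2 v)⟩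

theorem transpose_of_mem_psdAbove {c : ℝ} {A : Mat b b} (hA : A ∈ psdAbove b c) :
    (toMatrix A).transpose = toMatrix A := by
  ext i j; exact (mem_psdAbove_iff.1 hA).1 j i

theorem norm_le_matVec_of_mem {c : ℝ} {A : Mat b b} (hA : A ∈ psdAbove b c)
    (v : Vec b) : c * ‖v‖ ≤ ‖matVec (toMatrix A) v‖ := by
  have h := (mem_psdAbove_iff.1 hA).2 v
  have h' := real_inner_le_norm v (matVec (toMatrix A) v)
  rcases (norm_nonneg v).eq_or_lt with h0 | h0
  · rw [← h0]; simp
  · have : ‖v‖ * (c * ‖v‖) ≤ ‖v‖ * ‖matVec (toMatrix A) v‖ := by nlinarith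
    exact le_of_mul_le_mul_left this h0

theorem isUnit_det_of_mem {c : ℝ} (hc : 0 < c) {A : Mat b b} (hA : A ∈ psdAbove b c) :
    IsUnit (toMatrix A).det := by
  rw [isUnit_iff_ne_zero]
  intro h0
  obtain ⟨v, hv, hv0⟩ := Matrix.exists_mulVec_eq_zero_iff.2 h0
  have h := norm_le_matVec_of_mem hA (WithLp.toLp 2 v)
  have : matVec (toMatrix A) (WithLp.toLp 2 v) = 0 := by
    ext i; simpa [matVec] using congrFun hv0 i
  rw [this, norm_zero] at h
  have : ‖WithLp.toLp 2 v‖ = 0 := le_antisymm (by nlinarith [norm_nonneg (WithLp.toLp 2 v)]) (norm_nonneg _)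
  rw [norm_eq_zero] at this
  exact hv (by simpa using congrArg WithLp.ofLp this)

theorem matVec_inv_matVec {c : ℝ} (hc : 0 < c) {A : Mat b b} (hA : A ∈ psdAbove b c) (v : Vec b) :
    matVec (toMatrix A) (matVec (toMatrix A)⁻¹ v) = v := by
  rw [← matVec_mul, Matrix.mul_nonsing_inv _ (isUnit_det_of_mem hc hA), matVec_one]

theorem inv_matVec_matVec {c : ℝ} (hc : 0 < c) {A : Mat b b} (hA : A ∈ psdAbove b c) (v : Vec b) :
    matVec (toMatrix A)⁻¹ (matVec (toMatrix A) v) = v := by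
  rw [← matVec_mul, Matrix.nonsing_inv_mul _ (isUnit_det_of_mem hc hA), matVec_one]

theorem norm_inv_matVec_le {c : ℝ} (hc : 0 < c) {A : Mat b b} (hA : A ∈ psdAbove b c) (v : Vec b) :
    ‖matVec (toMatrix A)⁻¹ v‖ ≤ ‖v‖ / c := by
  rw [le_div_iff₀ hc, mul_comm]
  simpa [matVec_inv_matVec hc hA] using norm_le_matVec_of_mem hA (matVec (toMatrix A)⁻¹ v)

/-- The resolvent identity A⁻¹ − A'⁻¹ = A⁻¹(A' − A)A'⁻¹. -/
theorem norm_inv_matVec_sub_le {c : ℝ} (hc : 0 < c) {A A' : Mat b b} (hA : A ∈ psdAbove b c)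
    (hA' : A' ∈ psdAbove b c) (v : Vec b) :
    ‖matVec (toMatrix A)⁻¹ v - matVec (toMatrix A')⁻¹ v‖ ≤ ‖A - A'‖ * ‖v‖ / c ^ 2 := by
  have e : matVec (toMatrix A)⁻¹ v - matVec (toMatrix A')⁻¹ v
      = matVec (toMatrix A)⁻¹ (matVec (toMatrix (A' - A)) (matVec (toMatrix A')⁻¹ v)) := by
    rw [toMatrix_sub, sub_matVec, matVec_inv_matVec hc hA', matVec_sub, inv_matVec_matVec hc hA]
  rw [e]
  calc _ ≤ ‖matVec (toMatrix (A' - A)) (matVec (toMatrix A')⁻¹ v)‖ / c := norm_inv_matVec_le hc hA _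
    _ ≤ (‖A' - A‖ * (‖v‖ / c)) / c := by
        gcongr
        exact (norm_matVec_le _ _).trans
          (mul_le_mul_of_nonneg_left (norm_inv_matVec_le hc hA' v) (norm_nonneg _))
    _ = _ := by rw [norm_sub_rev]; field_simp

end Matrices

/-! ### Lipschitz continuity of u − V H⁻¹ v on bounded arguments. -/

section HyperGradient

variable {a b : ℕ}

/-- The hypergradient expression `u - V H⁻¹ v`. -/
noncomputable def zmap (u : Vec a) (v : Vec b) (V : Mat a b) (H : Mat b b) : Vec a :=
  u - matVec (toMatrix V) (matVec (toMatrix H)⁻¹ v)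

/-- The arguments of `zmap` are bounded, and `H ⪰ c I`. -/
structure ZBounds (B c : ℝ) (u : Vec a) (v : Vec b) (V : Mat a b) (H : Mat b b) : Prop where
  u_le : ‖u‖ ≤ B
  v_le : ‖v‖ ≤ B
  V_le : specNorm V ≤ B
  H_mem : H ∈ psdAbove b c

/-- Lipschitz factor of `zmap` on bounded arguments. -/
noncomputable def zLip (B c : ℝ) : ℝ := B / c + B ^ 2 / c ^ 2 + 1

theorem zLip_ge_one {B c : ℝ} (hB : 0 ≤ B) (hc : 0 < c) : 1 ≤ zLip B c := by
  unfold zLip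
  have : 0 ≤ B / c := by positivity
  have : 0 ≤ B ^ 2 / c ^ 2 := by positivity
  linarith

theorem norm_zmap_le {B c : ℝ} (hB : 0 ≤ B) (hc : 0 < c) {u : Vec a} {v : Vec b} {V : Mat a b}
    {H : Mat b b} (h : ZBounds B c u v V H) : ‖zmap u v V H‖ ≤ B * zLip B c := by
  have h1 : ‖matVec (toMatrix V) (matVec (toMatrix H)⁻¹ v)‖ ≤ B * (B / c) := by
    refine (norm_matVec_le_spec _ _).trans ?_
    refine mul_le_mul h.V_le ?_ (norm_nonneg _) hB
    exact (norm_inv_matVec_le hc h.H_mem v).trans (by gcongr; exact h.v_le)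
  have h2 : 0 ≤ B * (B ^ 2 / c ^ 2) := by positivity
  calc ‖zmap u v V H‖ ≤ ‖u‖ + ‖matVec (toMatrix V) (matVec (toMatrix H)⁻¹ v)‖ := norm_sub_le _ _
    _ ≤ B + B * (B / c) := add_le_add h.u_le h1
    _ ≤ B * zLip B c := by unfold zLip; linarith

/-- The arguments u, v, H, V are exchanged one at a time. No upper bound on H is needed, only H ⪰
cI, which matters because the algorithm does not bound H from above. -/
theorem norm_zmap_sub_le {B c : ℝ} (hB : 0 ≤ B) (hc : 0 < c) {u u' : Vec a} {v v' : Vec b}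
    {V V' : Mat a b} {H H' : Mat b b} (h : ZBounds B c u v V H) (h' : ZBounds B c u' v' V' H') :
    ‖zmap u v V H - zmap u' v' V' H'‖
      ≤ zLip B c * (‖u - u'‖ + ‖v - v'‖ + ‖V - V'‖ + ‖H - H'‖) := by
  have e : zmap u v V H - zmap u' v' V' H' = (u - u')
      - matVec (toMatrix V) (matVec (toMatrix H)⁻¹ (v - v'))
      - matVec (toMatrix V) (matVec (toMatrix H)⁻¹ v' - matVec (toMatrix H')⁻¹ v')
      - matVec (toMatrix (V - V')) (matVec (toMatrix H')⁻¹ v') := by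
    simp only [zmap, toMatrix_sub, sub_matVec, matVec_sub]
    abel
  have h1 : ‖matVec (toMatrix V) (matVec (toMatrix H)⁻¹ (v - v'))‖ ≤ B / c * ‖v - v'‖ := by
    refine (norm_matVec_le_spec _ _).trans ?_
    refine (mul_le_mul h.V_le (norm_inv_matVec_le hc h.H_mem _) (norm_nonneg _) hB).trans_eq ?_
    ring
  have h2 : ‖matVec (toMatrix V) (matVec (toMatrix H)⁻¹ v' - matVec (toMatrix H')⁻¹ v')‖
      ≤ B ^ 2 / c ^ 2 * ‖H - H'‖ := by
    refine (norm_matVec_le_spec _ _).trans ?_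
    refine (mul_le_mul h.V_le (norm_inv_matVec_sub_le hc h.H_mem h'.H_mem _) (norm_nonneg _)
      hB).trans ?_
    calc B * (‖H - H'‖ * ‖v'‖ / c ^ 2) ≤ B * (‖H - H'‖ * B / c ^ 2) := by
          gcongr; exact h'.v_le
      _ = _ := by ring
  have h3 : ‖matVec (toMatrix (V - V')) (matVec (toMatrix H')⁻¹ v')‖ ≤ B / c * ‖V - V'‖ := by
    refine (norm_matVec_le _ _).trans ?_
    calc ‖V - V'‖ * ‖matVec (toMatrix H')⁻¹ v'‖ ≤ ‖V - V'‖ * (B / c) := by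
          gcongr
          exact (norm_inv_matVec_le hc h'.H_mem v').trans (by gcongr; exact h'.v_le)
      _ = _ := by ring
  have k1 : 0 ≤ B / c := by positivity
  have k2 : 0 ≤ B ^ 2 / c ^ 2 := by positivity
  have n1 := norm_nonneg (u - u')
  have n2 := norm_nonneg (v - v')
  have n3 := norm_nonneg (V - V')
  have n4 := norm_nonneg (H - H')
  rw [e]
  refine (norm_sub_le _ _).trans ?_
  refine (add_le_add_left (norm_sub_le _ _) _).trans ?_
  refine (add_le_add_left (add_le_add_left (norm_sub_le _ _) _) _).trans ?_
  unfold zLip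
  generalize B / c = p at *
  generalize B ^ 2 / c ^ 2 = q at *
  nlinarith [mul_nonneg k1 n1, mul_nonneg k1 n4, mul_nonneg k2 n1, mul_nonneg k2 n2,
    mul_nonneg k2 n3]

theorem norm_zmap_sub_sq_le {B c : ℝ} (hB : 0 ≤ B) (hc : 0 < c) {u u' : Vec a} {v v' : Vec b}
    {V V' : Mat a b} {H H' : Mat b b} (h : ZBounds B c u v V H) (h' : ZBounds B c u' v' V' H') :
    ‖zmap u v V H - zmap u' v' V' H'‖ ^ 2
      ≤ 4 * zLip B c ^ 2 * (‖u - u'‖ ^ 2 + ‖v - v'‖ ^ 2 + ‖V - V'‖ ^ 2 + ‖H - H'‖ ^ 2) := by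
  refine (pow_le_pow_left₀ (norm_nonneg _) (norm_zmap_sub_le hB hc h h') 2).trans ?_
  rw [mul_pow, mul_comm 4, mul_assoc]
  refine mul_le_mul_of_nonneg_left ?_ (by positivity)
  generalize ‖u - u'‖ = p
  generalize ‖v - v'‖ = q
  generalize ‖V - V'‖ = r
  generalize ‖H - H'‖ = t
  nlinarith [sq_nonneg (p - q), sq_nonneg (p - r), sq_nonneg (p - t), sq_nonneg (q - r),
    sq_nonneg (q - t), sq_nonneg (r - t)]

end HyperGradient

end Bilevel

namespace Bilevel

/-! ### Quadratic Taylor remainders. -/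

section Taylor

variable {V W E : Type*} [NormedAddCommGroup V] [NormedSpace ℝ V] [NormedAddCommGroup W]
  [NormedSpace ℝ W] [NormedAddCommGroup E] [NormedSpace ℝ E]

/-- On the ball of radius ‖x' − x‖ the derivative stays within L‖x' − x‖ of φ' x, so the mean value
inequality applies. The lost factor 1/2 is immaterial. -/
theorem norm_taylor_le {φ : V → E} {φ' : V → V →L[ℝ] E} (h : ∀ x, HasFDerivAt φ (φ' x) x) {L : ℝ}
    (hL0 : 0 ≤ L) (hL : ∀ x x', ‖φ' x - φ' x'‖ ≤ L * ‖x - x'‖) (x x' : V) :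
    ‖φ x' - φ x - φ' x (x' - x)‖ ≤ L * ‖x' - x‖ ^ 2 := by
  have := (convex_closedBall x ‖x' - x‖).norm_image_sub_le_of_norm_hasFDerivWithin_le'
    (f := φ) (f' := φ') (φ := φ' x) (C := L * ‖x' - x‖) (x := x) (y := x')
    (fun z _ => (h z).hasFDerivWithinAt) (fun z hz => (hL z x).trans (by
      gcongr; simpa [dist_eq_norm] using hz)) (by simp) (by simp [dist_eq_norm])
  refine this.trans_eq (by ring)

/-- Expansion along the path (x, y), (x', y), (x', y'); the third term accounts for moving the base
point of the y-derivative from x to x'. -/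
theorem norm_taylor_pair_le {φ : V → W → E} {A : V → W → V →L[ℝ] E} {A' : V → W → W →L[ℝ] E}
    (h : ∀ x y, HasFDerivAt (fun x => φ x y) (A x y) x)
    (h' : ∀ x y, HasFDerivAt (fun y => φ x y) (A' x y) y) {L : ℝ} (hL0 : 0 ≤ L)
    (hL : ∀ x x' y y', ‖A x y - A x' y'‖ ≤ L * (‖x - x'‖ + ‖y - y'‖))
    (hL' : ∀ x x' y y', ‖A' x y - A' x' y'‖ ≤ L * (‖x - x'‖ + ‖y - y'‖)) (x x' : V) (y y' : W) :
    ‖φ x' y' - φ x y - A x y (x' - x) - A' x y (y' - y)‖ ≤ L * (‖x' - x‖ + ‖y' - y‖) ^ 2 := by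
  have h1 := norm_taylor_le (φ := fun x => φ x y) (fun x => h x y) hL0
    (fun x x' => by simpa using hL x x' y y) x x'
  have h2 := norm_taylor_le (φ := fun y => φ x' y) (fun y => h' x' y) hL0
    (fun y y' => by simpa using hL' x' x' y y') y y'
  have h3 : ‖(A' x' y - A' x y) (y' - y)‖ ≤ L * ‖x' - x‖ * ‖y' - y‖ :=
    ((A' x' y - A' x y).le_opNorm _).trans (by gcongr; simpa using hL' x' x y y)
  have e : φ x' y' - φ x y - A x y (x' - x) - A' x y (y' - y)
      = (φ x' y - φ x y - A x y (x' - x)) + (φ x' y' - φ x' y - A' x' y (y' - y))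
        + (A' x' y - A' x y) (y' - y) := by
    rw [sub_apply]; abel
  rw [e]
  refine (norm_add₃_le).trans ?_
  nlinarith [norm_nonneg (x' - x), norm_nonneg (y' - y),
    mul_nonneg hL0 (mul_nonneg (norm_nonneg (x' - x)) (norm_nonneg (y' - y)))]

/-- A quadratic remainder identifies the derivative. Remainder bounds pass through integrals and
finite averages, so this yields the derivatives of expected objectives and of F without dominated
convergence and without an implicit function theorem. -/
theorem hasFDerivAt_of_norm_taylor_le {φ : V → E} {A : V →L[ℝ] E} {x : V} {L : ℝ}
    (h : ∀ x', ‖φ x' - φ x - A (x' - x)‖ ≤ L * ‖x' - x‖ ^ 2) : HasFDerivAt φ A x := by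
  rw [hasFDerivAt_iff_isLittleO]
  have h1 : (fun x' => φ x' - φ x - A (x' - x)) =O[nhds x] fun x' => ‖x' - x‖ ^ 2 :=
    Asymptotics.IsBigO.of_bound L (Filter.Eventually.of_forall fun x' => by simpa using h x')
  refine h1.trans_isLittleO ?_
  rw [← Asymptotics.isLittleO_norm_right]
  have h2 : (fun t : ℝ => t ^ 2) =o[nhds 0] fun t : ℝ => t := by
    simpa using Asymptotics.isLittleO_pow_id (𝕜 := ℝ) (n := 2) one_lt_two
  have h3 : Filter.Tendsto (fun x' => ‖x' - x‖) (nhds x) (nhds 0) := by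
    have : Continuous fun x' : V => ‖x' - x‖ := by fun_prop
    simpa using this.tendsto x
  exact h2.comp_tendsto h3

end Taylor

/-! ### Jacobians stored as matrices of partial derivatives. -/

section Jacobian

variable {a b : ℕ}

/-- The linear map with matrix entries `J (r, c) = ∂_r (·)_c`. -/
noncomputable def jacCLM (J : Mat a b) : Vec a →L[ℝ] Vec b :=
  LinearMap.toContinuousLinearMap
    { toFun := fun v => matVec (toMatrix J).transpose v
      map_add' := matVec_add _
      map_smul' := fun c v => by ext i; simp [matVec, Matrix.mulVec_smul] }

theorem jacCLM_apply (J : Mat a b) (v : Vec a) : jacCLM J v = matVec (toMatrix J).transpose v := rfl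

theorem jacCLM_apply_apply (J : Mat a b) (v : Vec a) (c : Fin b) :
    jacCLM J v c = ∑ r, J (r, c) * v r := rfl

theorem jacCLM_sub (J J' : Mat a b) : jacCLM (J - J') = jacCLM J - jacCLM J' := by
  ext v c
  rw [sub_apply, PiLp.sub_apply]
  simp only [jacCLM_apply_apply, PiLp.sub_apply, sub_mul, Finset.sum_sub_distrib]

theorem norm_jacCLM_le (J : Mat a b) : ‖jacCLM J‖ ≤ ‖J‖ :=
  ContinuousLinearMap.opNorm_le_bound _ (norm_nonneg _) fun v => norm_transpose_matVec_le J v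

/-- Matrix of partial derivatives, with entries `∂_r ψ_c`. -/
noncomputable def jac (ψ : Vec a → Vec b) (x : Vec a) : Mat a b :=
  WithLp.toLp 2 fun rc => (fderiv ℝ ψ x (EuclideanSpace.single rc.1 (1 : ℝ))) rc.2

theorem jacCLM_single (J : Mat a b) (r : Fin a) (c : Fin b) :
    jacCLM J (EuclideanSpace.single r (1 : ℝ)) c = J (r, c) := by
  rw [jacCLM_apply_apply]; simp

theorem jac_eq_of_hasFDerivAt {ψ : Vec a → Vec b} {J : Mat a b} {x : Vec a}
    (h : HasFDerivAt ψ (jacCLM J) x) : jac ψ x = J := by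
  ext ⟨r, c⟩
  simp only [jac, h.fderiv]
  exact jacCLM_single J r c

theorem euclidean_sum_single (v : Vec a) : v = ∑ r, v r • EuclideanSpace.single r (1 : ℝ) := by
  ext i; simp [Pi.single_apply]

theorem hasFDerivAt_jac {ψ : Vec a → Vec b} {x : Vec a} (h : DifferentiableAt ℝ ψ x) :
    HasFDerivAt ψ (jacCLM (jac ψ x)) x := by
  convert h.hasFDerivAt using 1
  ext v c
  rw [jacCLM_apply_apply]
  conv_rhs => rw [euclidean_sum_single v]
  rw [map_sum, WithLp.ofLp_sum, Finset.sum_apply]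
  refine Finset.sum_congr rfl fun r _ => ?_
  rw [map_smul]; simp [jac, mul_comm]

/-- The rows of J are the images of the basis vectors under `jacCLM J`. -/
theorem norm_sq_le_of_norm_jacCLM_le {J : Mat a b} {C : ℝ} (h : ‖jacCLM J‖ ≤ C) :
    ‖J‖ ^ 2 ≤ a * C ^ 2 := by
  rw [matSq_eq]
  calc ∑ i, ∑ j, J (i, j) ^ 2 ≤ ∑ _i : Fin a, C ^ 2 := by
        refine Finset.sum_le_sum fun i _ => ?_
        have h1 : ‖jacCLM J (EuclideanSpace.single i (1 : ℝ))‖ ≤ C := by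
          refine ((jacCLM J).le_opNorm _).trans ?_
          simpa using h
        have h2 : ‖jacCLM J (EuclideanSpace.single i (1 : ℝ))‖ ^ 2 = ∑ j, J (i, j) ^ 2 := by
          rw [EuclideanSpace.norm_sq_eq]
          refine Finset.sum_congr rfl fun j _ => ?_
          rw [jacCLM_single]; simp
        rw [← h2]
        exact pow_le_pow_left₀ (norm_nonneg _) h1 2
    _ = a * C ^ 2 := by simp

end Jacobian

section Columns

variable {a b : ℕ}

theorem abs_taylor_gradient_le {Ω : Type*} {φ : Vec a → Ω → ℝ} {φ' : Vec a → Ω → Vec a} {L : ℝ}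
    (hd : ∀ x ω, HasGradientAt (fun x => φ x ω) (φ' x ω) x)
    (hL0 : 0 ≤ L) (hL : ∀ x x' ω, ‖φ' x ω - φ' x' ω‖ ≤ L * ‖x - x'‖) (x v : Vec a) (ω : Ω) :
    |φ (x + v) ω - φ x ω - inner ℝ (φ' x ω) v| ≤ L * ‖v‖ ^ 2 := by
  have h := norm_taylor_le (φ := fun x => φ x ω)
    (φ' := fun x => InnerProductSpace.toDual ℝ (Vec a) (φ' x ω)) (fun x => hd x ω) hL0
    (fun x x' => by rw [← map_sub, LinearIsometryEquiv.norm_map]; exact hL x x' ω) x (x + v)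
  simpa using h

theorem norm_column_le (J : Mat a b) (c : Fin b) :
    ‖(WithLp.toLp 2 fun r => J (r, c) : Vec a)‖ ≤ ‖J‖ := by
  apply le_of_sq_le_sq _ (norm_nonneg _)
  rw [matSq_eq, Finset.sum_comm, EuclideanSpace.norm_sq_eq]
  simp only [Real.norm_eq_abs, sq_abs]
  exact Finset.single_le_sum (f := fun c => ∑ r, J (r, c) ^ 2)
    (fun _ _ => Finset.sum_nonneg fun _ _ => sq_nonneg _) (Finset.mem_univ c)

theorem norm_column_jac_sub_le {Ω : Type*} {ψ : Vec a → Ω → Vec b} {L : ℝ}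
    (hL : ∀ x x' ω, ‖jac (fun x => ψ x ω) x - jac (fun x => ψ x ω) x'‖ ≤ L * ‖x - x'‖) (c : Fin b)
    (x x' : Vec a) (ω : Ω) :
    ‖(WithLp.toLp 2 fun r => jac (fun x => ψ x ω) x (r, c) : Vec a)
      - WithLp.toLp 2 fun r => jac (fun x => ψ x ω) x' (r, c)‖ ≤ L * ‖x - x'‖ :=
  (norm_column_le (jac (fun x => ψ x ω) x - jac (fun x => ψ x ω) x') c).trans (hL x x' ω)

end Columns

/-! ### Differentiation under the integral sign, scalar case. -/

section ParametricIntegral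

variable {a b : ℕ} {Ω : Type*} [MeasurableSpace Ω] {M : Measure Ω} [IsProbabilityMeasure M]

theorem measurable_euclidean {ι : Type*} [Fintype ι] {f : Ω → EuclideanSpace ℝ ι}
    (h : ∀ i, Measurable fun ω => f ω i) : Measurable f :=
  (WithLp.measurable_toLp 2 (ι → ℝ)).comp (measurable_pi_lambda _ h)

variable {φ : Vec a → Ω → ℝ} {φ' : Vec a → Ω → Vec a} {L : ℝ}

/-- Each partial derivative is a limit of difference quotients with step 1/(n+1); the Taylor bound
makes the error at most L/(n+1). -/
theorem measurable_gradient_param (hd : ∀ x ω, HasGradientAt (fun x => φ x ω) (φ' x ω) x)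
    (hL0 : 0 ≤ L) (hL : ∀ x x' ω, ‖φ' x ω - φ' x' ω‖ ≤ L * ‖x - x'‖)
    (hm : ∀ x, Measurable (φ x)) (x : Vec a) : Measurable (φ' x) := by
  refine measurable_euclidean fun i => ?_
  refine measurable_of_tendsto_metrizable
    (f := fun (n : ℕ) ω => ((n : ℝ) + 1) *
      (φ (x + (1 / ((n : ℝ) + 1)) • EuclideanSpace.single i (1 : ℝ)) ω - φ x ω))
    (fun n => (((hm _).sub (hm x)).const_mul _)) ?_
  rw [tendsto_pi_nhds]
  intro ω
  rw [tendsto_iff_dist_tendsto_zero]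
  refine squeeze_zero (fun _ => dist_nonneg) (g := fun n : ℕ => L * (1 / ((n : ℝ) + 1))) ?_
    (by simpa using (tendsto_one_div_add_atTop_nhds_zero_nat (𝕜 := ℝ)).const_mul L)
  intro n
  have hn : (0 : ℝ) < (n : ℝ) + 1 := by positivity
  have h := abs_taylor_gradient_le hd hL0 hL x
    ((1 / ((n : ℝ) + 1)) • EuclideanSpace.single i (1 : ℝ)) ω
  rw [norm_smul, inner_smul_right] at h
  have e : inner ℝ (φ' x ω) (EuclideanSpace.single i (1 : ℝ)) = φ' x ω i := by
    rw [EuclideanSpace.inner_single_right]; simp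
  rw [e] at h
  simp only [PiLp.norm_single, norm_one, mul_one, Real.norm_eq_abs, sq_abs] at h
  rw [Real.dist_eq]
  have e2 : ((n : ℝ) + 1) * (φ (x + (1 / ((n : ℝ) + 1)) • EuclideanSpace.single i (1 : ℝ)) ω - φ x ω)
      - φ' x ω i = ((n : ℝ) + 1) * (φ (x + (1 / ((n : ℝ) + 1)) • EuclideanSpace.single i (1 : ℝ)) ω
        - φ x ω - 1 / ((n : ℝ) + 1) * φ' x ω i) := by
    field_simp
  rw [e2, abs_mul, abs_of_pos hn]
  calc _ ≤ ((n : ℝ) + 1) * (L * (1 / ((n : ℝ) + 1)) ^ 2) := by gcongr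
    _ = _ := by field_simp

/-- The Taylor bound for the displacement by a basis vector dominates a partial derivative by |φ(x +
e_i)| + |φ(x)| + L, so no integrability of the gradient has to be assumed. -/
theorem integrable_gradient_param (hd : ∀ x ω, HasGradientAt (fun x => φ x ω) (φ' x ω) x)
    (hL0 : 0 ≤ L) (hL : ∀ x x' ω, ‖φ' x ω - φ' x' ω‖ ≤ L * ‖x - x'‖)
    (hm : ∀ x, Measurable (φ x)) (hi : ∀ x, Integrable (φ x) M) (x : Vec a) :
    Integrable (φ' x) M := by
  refine Integrable.of_eval_piLp fun i => ?_
  have hm' := measurable_gradient_param hd hL0 hL hm x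
  refine Integrable.mono' (g := fun ω => |φ (x + EuclideanSpace.single i (1 : ℝ)) ω| + |φ x ω| + L)
    (((hi _).abs.add (hi x).abs).add (integrable_const L)) ?_ ?_
  · exact Measurable.aestronglyMeasurable (by fun_prop)
  · refine Filter.Eventually.of_forall fun ω => ?_
    have h := abs_taylor_gradient_le hd hL0 hL x (EuclideanSpace.single i (1 : ℝ)) ω
    have e : inner ℝ (φ' x ω) (EuclideanSpace.single i (1 : ℝ)) = φ' x ω i := by
      rw [EuclideanSpace.inner_single_right]; simp
    rw [e] at h
    simp only [PiLp.norm_single, norm_one, one_pow, mul_one] at h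
    rw [Real.norm_eq_abs]
    have h1 := abs_le.1 h
    rw [abs_le]
    have h2 := abs_le.1 (le_refl |φ (x + EuclideanSpace.single i (1 : ℝ)) ω|)
    have h3 := abs_le.1 (le_refl |φ x ω|)
    constructor <;> linarith

/-- The Taylor remainder is bounded uniformly in ω; integrating it leaves a quadratic remainder for
the integral. -/
theorem hasGradientAt_integral (hd : ∀ x ω, HasGradientAt (fun x => φ x ω) (φ' x ω) x)
    (hL0 : 0 ≤ L) (hL : ∀ x x' ω, ‖φ' x ω - φ' x' ω‖ ≤ L * ‖x - x'‖)
    (hm : ∀ x, Measurable (φ x)) (hi : ∀ x, Integrable (φ x) M) (x : Vec a) :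
    HasGradientAt (fun x => ∫ ω, φ x ω ∂M) (∫ ω, φ' x ω ∂M) x := by
  have hi' := integrable_gradient_param hd hL0 hL hm hi x
  refine hasFDerivAt_of_norm_taylor_le (L := L) fun x' => ?_
  have e : (∫ ω, φ x' ω ∂M) - (∫ ω, φ x ω ∂M)
      - InnerProductSpace.toDual ℝ (Vec a) (∫ ω, φ' x ω ∂M) (x' - x)
      = ∫ ω, (φ x' ω - φ x ω - inner ℝ (φ' x ω) (x' - x)) ∂M := by
    have e1 : ∫ ω, (φ x' ω - φ x ω - inner ℝ (φ' x ω) (x' - x)) ∂M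
        = ∫ ω, (φ x' ω - φ x ω) ∂M - ∫ ω, inner ℝ (φ' x ω) (x' - x) ∂M :=
      integral_sub ((hi _).sub (hi _)) (hi'.inner_const _)
    rw [e1, integral_sub (hi _) (hi _), InnerProductSpace.toDual_apply_apply]
    congr 1
    have := integral_inner (𝕜 := ℝ) hi' (x' - x)
    rw [real_inner_comm, ← this]
    refine integral_congr_ae (Filter.Eventually.of_forall fun ω => real_inner_comm _ _)
  rw [e]
  have := norm_integral_le_of_norm_le_const (μ := M) (C := L * ‖x' - x‖ ^ 2)
    (f := fun ω => φ x' ω - φ x ω - inner ℝ (φ' x ω) (x' - x))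
    (Filter.Eventually.of_forall fun ω => by
      simpa using abs_taylor_gradient_le hd hL0 hL x (x' - x) ω)
  simpa using this

end ParametricIntegral

/-! ### Differentiation under the integral sign, vector-valued case. -/

section ParametricJacobian

variable {a b : ℕ} {Ω : Type*} [MeasurableSpace Ω] {M : Measure Ω} [IsProbabilityMeasure M]
  {ψ : Vec a → Ω → Vec b} {L : ℝ}

/-- Column c of the Jacobian is the gradient of component c; this reduces vector-valued integrands
to the scalar case. -/
theorem hasGradientAt_component {ψ : Vec a → Vec b} {J : Mat a b} {x : Vec a}
    (h : HasFDerivAt ψ (jacCLM J) x) (c : Fin b) :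
    HasGradientAt (fun x => ψ x c) (WithLp.toLp 2 fun r => J (r, c)) x := by
  have h1 := (hasFDerivWithinAt_euclidean.1 (h.hasFDerivWithinAt (s := Set.univ))) c
  rw [hasGradientAt_iff_hasFDerivAt, ← hasFDerivWithinAt_univ]
  convert h1 using 1
  ext v
  simp [jacCLM_apply_apply, PiLp.inner_apply, mul_comm]

theorem measurable_jac_param (hd : ∀ x ω, DifferentiableAt ℝ (fun x => ψ x ω) x) (hL0 : 0 ≤ L)
    (hL : ∀ x x' ω, ‖jac (fun x => ψ x ω) x - jac (fun x => ψ x ω) x'‖ ≤ L * ‖x - x'‖)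
    (hm : ∀ x, Measurable (ψ x)) (x : Vec a) : Measurable fun ω => jac (fun x => ψ x ω) x := by
  refine measurable_euclidean fun rc => ?_
  have := measurable_gradient_param (φ := fun x ω => ψ x ω rc.2)
    (φ' := fun x ω => WithLp.toLp 2 fun r => jac (fun x => ψ x ω) x (r, rc.2))
    (fun x ω => hasGradientAt_component (hasFDerivAt_jac (hd x ω)) rc.2) hL0
    (norm_column_jac_sub_le hL rc.2) (fun x => by have := hm x; fun_prop) x
  exact (measurable_pi_apply rc.1).comp ((WithLp.measurable_ofLp 2 _).comp this)

theorem integrable_jac_param (hd : ∀ x ω, DifferentiableAt ℝ (fun x => ψ x ω) x) (hL0 : 0 ≤ L)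
    (hL : ∀ x x' ω, ‖jac (fun x => ψ x ω) x - jac (fun x => ψ x ω) x'‖ ≤ L * ‖x - x'‖)
    (hm : ∀ x, Measurable (ψ x)) (hi : ∀ x, Integrable (ψ x) M) (x : Vec a) :
    Integrable (fun ω => jac (fun x => ψ x ω) x) M := by
  refine Integrable.of_eval_piLp fun rc => ?_
  have := integrable_gradient_param (M := M) (φ := fun x ω => ψ x ω rc.2)
    (φ' := fun x ω => WithLp.toLp 2 fun r => jac (fun x => ψ x ω) x (r, rc.2))
    (fun x ω => hasGradientAt_component (hasFDerivAt_jac (hd x ω)) rc.2) hL0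
    (norm_column_jac_sub_le hL rc.2) (fun x => by have := hm x; fun_prop)
    (fun x => (hi x).eval_piLp rc.2) x
  exact this.eval_piLp rc.1

theorem hasFDerivAt_integral_jac (hd : ∀ x ω, DifferentiableAt ℝ (fun x => ψ x ω) x) (hL0 : 0 ≤ L)
    (hL : ∀ x x' ω, ‖jac (fun x => ψ x ω) x - jac (fun x => ψ x ω) x'‖ ≤ L * ‖x - x'‖)
    (hm : ∀ x, Measurable (ψ x)) (hi : ∀ x, Integrable (ψ x) M) (x : Vec a) :
    HasFDerivAt (fun x => ∫ ω, ψ x ω ∂M) (jacCLM (∫ ω, jac (fun x => ψ x ω) x ∂M)) x := by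
  rw [← hasFDerivWithinAt_univ, hasFDerivWithinAt_euclidean]
  intro c
  have h := hasGradientAt_integral (M := M) (φ := fun x ω => ψ x ω c)
    (φ' := fun x ω => WithLp.toLp 2 fun r => jac (fun x => ψ x ω) x (r, c))
    (fun x ω => hasGradientAt_component (hasFDerivAt_jac (hd x ω)) c) hL0
    (norm_column_jac_sub_le hL c) (fun x => by have := hm x; fun_prop)
    (fun x => (hi x).eval_piLp c) x
  have hi' := integrable_jac_param hd hL0 hL hm hi x
  have hi'' := integrable_gradient_param (M := M) (φ := fun x ω => ψ x ω c)
    (φ' := fun x ω => WithLp.toLp 2 fun r => jac (fun x => ψ x ω) x (r, c))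
    (fun x ω => hasGradientAt_component (hasFDerivAt_jac (hd x ω)) c) hL0
    (norm_column_jac_sub_le hL c) (fun x => by have := hm x; fun_prop)
    (fun x => (hi x).eval_piLp c) x
  have e1 : (fun x => (∫ ω, ψ x ω ∂M) c) = fun x => ∫ ω, ψ x ω c ∂M := by
    funext x
    exact eval_integral_piLp (fun i => (hi x).eval_piLp i) c
  have e2 : InnerProductSpace.toDual ℝ (Vec a)
      (∫ ω, (WithLp.toLp 2 fun r => jac (fun x => ψ x ω) x (r, c) : Vec a) ∂M)
      = (PiLp.proj 2 (fun _ => ℝ) c).comp (jacCLM (∫ ω, jac (fun x => ψ x ω) x ∂M)) := by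
    ext v
    rw [ContinuousLinearMap.comp_apply, PiLp.proj_apply, jacCLM_apply_apply,
      InnerProductSpace.toDual_apply_apply, PiLp.inner_apply]
    refine Finset.sum_congr rfl fun r _ => ?_
    rw [eval_integral_piLp (fun i => hi''.eval_piLp i) r,
      eval_integral_piLp (fun i => hi'.eval_piLp i) (r, c)]
    simp [mul_comm]
  rw [e1, ← e2]
  exact h.hasFDerivAt.hasFDerivWithinAt

end ParametricJacobian

end Bilevel

namespace Bilevel

/-! ### Functions Lipschitz in the pair (x, y). -/

section JointLipschitz

variable {a b : ℕ} {E : Type*}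

theorem JointLipschitz.fst [Sub E] {N : E → ℝ} {h : Vec a → Vec b → E} {L : ℝ}
    (hl : JointLipschitz N h L) (x x' : Vec a) (y : Vec b) :
    N (h x y - h x' y) ≤ L * ‖x - x'‖ := by
  simpa [Real.sqrt_sq] using hl x x' y y

theorem JointLipschitz.snd [Sub E] {N : E → ℝ} {h : Vec a → Vec b → E} {L : ℝ}
    (hl : JointLipschitz N h L) (x : Vec a) (y y' : Vec b) :
    N (h x y - h x y') ≤ L * ‖y - y'‖ := by
  simpa [Real.sqrt_sq] using hl x x y y'

theorem JointLipschitz.mono [Sub E] {N N' : E → ℝ} {h : Vec a → Vec b → E} {L L' : ℝ}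
    (hl : JointLipschitz N h L) {c : ℝ} (hc : 0 ≤ c) (hN : ∀ z, N' z ≤ c * N z) (hL : c * L ≤ L') :
    JointLipschitz N' h L' := fun x x' y y' => by
  refine (hN _).trans ((mul_le_mul_of_nonneg_left (hl x x' y y') hc).trans ?_)
  rw [← mul_assoc]
  exact mul_le_mul_of_nonneg_right hL (Real.sqrt_nonneg _)

variable [NormedAddCommGroup E]

theorem JointLipschitz.norm_sq_le {h : Vec a → Vec b → E} {L : ℝ} (hl : JointLipschitz norm h L)
    (x x' : Vec a) (y y' : Vec b) :
    ‖h x y - h x' y'‖ ^ 2 ≤ L ^ 2 * (‖x - x'‖ ^ 2 + ‖y - y'‖ ^ 2) := by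
  have h1 := pow_le_pow_left₀ (norm_nonneg _) (hl x x' y y') 2
  rwa [mul_pow, Real.sq_sqrt (by positivity)] at h1

theorem JointLipschitz.norm_le_add {h : Vec a → Vec b → E} {L : ℝ} (hL : 0 ≤ L)
    (hl : JointLipschitz norm h L) (x x' : Vec a) (y y' : Vec b) :
    ‖h x y - h x' y'‖ ≤ L * (‖x - x'‖ + ‖y - y'‖) := by
  refine (hl x x' y y').trans (mul_le_mul_of_nonneg_left ?_ hL)
  rw [Real.sqrt_le_iff]
  refine ⟨by positivity, ?_⟩
  nlinarith [norm_nonneg (x - x'), norm_nonneg (y - y')]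

theorem JointLipschitz.continuous {h : Vec a → Vec b → E} {L : ℝ}
    (hl : JointLipschitz norm h L) : Continuous fun q : Vec a × Vec b => h q.1 q.2 := by
  have hl' : JointLipschitz norm h (max L 0) :=
    hl.mono zero_le_one (fun z => (one_mul _).ge) (by simp)
  refine (LipschitzWith.of_dist_le_mul (K := Real.toNNReal (max L 0 * 2)) fun q q' => ?_).continuous
  rw [dist_eq_norm, Real.coe_toNNReal _ (by positivity), dist_eq_norm]
  refine (hl'.norm_le_add (le_max_right _ _) _ _ _ _).trans ?_
  rw [mul_assoc]
  refine mul_le_mul_of_nonneg_left ?_ (le_max_right _ _)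
  have h1 := norm_fst_le (q - q')
  have h2 := norm_snd_le (q - q')
  simp only [Prod.fst_sub, Prod.snd_sub] at h1 h2
  linarith

end JointLipschitz

/-! ### Stochastic oracles and their means. -/

section Oracle

variable {a b : ℕ} {Ω Ω' : Type*} [MeasurableSpace Ω] [MeasurableSpace Ω']
  {E : Type*} [NormedAddCommGroup E] [NormedSpace ℝ E] [MeasurableSpace E]

/-- `h` is an unbiased stochastic oracle for `hb`, Lipschitz in `(x, y)`, whose second moment on
`X` times the ball of radius `R` is at most `σ²`. -/
structure Oracle (M : Measure Ω) (h : Vec a → Vec b → Ω → E) (hb : Vec a → Vec b → E)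
    (X : Set (Vec a)) (R Λ σ : ℝ) : Prop where
  meas : ∀ x y, Measurable (h x y)
  lip : ∀ ω, JointLipschitz norm (fun x y => h x y ω) Λ
  int : ∀ x y, Integrable (h x y) M
  mean : ∀ x y, ∫ ω, h x y ω ∂M = hb x y
  mom : ∀ x ∈ X, ∀ y, ‖y‖ ≤ R → SecondMomentLE M (fun ω => ‖h x y ω‖) σ

variable {M : Measure Ω} {h : Vec a → Vec b → Ω → E} {hb : Vec a → Vec b → E} {X : Set (Vec a)}
  {R Λ σ : ℝ}

theorem Oracle.comp [BorelSpace E] [SecondCountableTopology E] {M' : Measure Ω'} {π : Ω' → Ω}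
    (ho : Oracle M h hb X R Λ σ) (hπ : MeasurePreserving π M' M) :
    Oracle M' (fun x y ω => h x y (π ω)) hb X R Λ σ where
  meas x y := (ho.meas x y).comp hπ.measurable
  lip ω := ho.lip (π ω)
  int x y := hπ.integrable_comp_of_integrable (ho.int x y)
  mean x y := by
    rw [← ho.mean, ← hπ.map_eq, integral_map hπ.measurable.aemeasurable
      (ho.meas x y).aestronglyMeasurable]
  mom x hx y hy := by
    obtain ⟨h1, h2⟩ := ho.mom x hx y hy
    refine ⟨hπ.integrable_comp_of_integrable h1, h2.trans' (le_of_eq ?_)⟩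
    have := integral_map (μ := M') (φ := π) hπ.measurable.aemeasurable
      (f := fun ω => ‖h x y ω‖ ^ 2) (by
        exact ((ho.meas x y).norm.pow_const 2).aestronglyMeasurable)
    rw [hπ.map_eq] at this
    exact this.symm

theorem Oracle.lip_mean [IsProbabilityMeasure M] (ho : Oracle M h hb X R Λ σ) :
    JointLipschitz norm hb Λ := fun x x' y y' => by
  rw [← ho.mean, ← ho.mean, ← integral_sub (ho.int _ _) (ho.int _ _)]
  have := norm_integral_le_of_norm_le_const (μ := M)
    (f := fun ω => h x y ω - h x' y' ω) (Filter.Eventually.of_forall fun ω => ho.lip ω x x' y y')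
  simpa using this

/-- Integrability follows from |N| ≤ N² + 1, and the bound from nonnegativity of the variance. -/
theorem integral_le_of_secondMomentLE [IsProbabilityMeasure M] {N : Ω → ℝ} {C : ℝ}
    (hN : Measurable N) (hC : 0 ≤ C) (hm : SecondMomentLE M N C) :
    Integrable N M ∧ ∫ ω, N ω ∂M ≤ C := by
  have hi : Integrable N M := by
    refine Integrable.mono' (hm.1.add (integrable_const 1)) hN.aestronglyMeasurable
      (Filter.Eventually.of_forall fun ω => ?_)
    simp only [Pi.add_apply, Real.norm_eq_abs]
    rw [← sq_abs (N ω)]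
    nlinarith [sq_nonneg (|N ω| - 1), sq_nonneg (|N ω|)]
  refine ⟨hi, ?_⟩
  set c := ∫ ω, N ω ∂M
  have h1 : 0 ≤ ∫ ω, (N ω ^ 2 - 2 * c * N ω + c ^ 2) ∂M :=
    integral_nonneg fun ω => by
      change 0 ≤ N ω ^ 2 - 2 * c * N ω + c ^ 2
      nlinarith [sq_nonneg (N ω - c)]
  have e1 : ∫ ω, (N ω ^ 2 - 2 * c * N ω + c ^ 2) ∂M
      = ∫ ω, (N ω ^ 2 - 2 * c * N ω) ∂M + ∫ _ω, c ^ 2 ∂M :=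
    integral_add (hm.1.sub (hi.const_mul _)) (integrable_const _)
  rw [e1, integral_sub hm.1 (hi.const_mul _), integral_const_mul] at h1
  simp only [integral_const, probReal_univ, one_smul] at h1
  have h2 := hm.2
  refine le_of_sq_le_sq ?_ hC
  have : ∫ ω, N ω ∂M = c := rfl
  nlinarith

open scoped Matrix.Norms.L2Operator in
-- The norm of `Mat` is the Frobenius norm, so the integral is carried by a continuous linear map to
-- the space of matrices with the operator norm, where the triangle inequality for integrals is the
-- spectral one.
theorem specNorm_integral_le {M : Measure Ω} {J : Ω → Mat a b} (hJ : Integrable J M) :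
    specNorm (∫ ω, J ω ∂M) ≤ ∫ ω, specNorm (J ω) ∂M := by
  let T : Mat a b →L[ℝ] Matrix (Fin a) (Fin b) ℝ := LinearMap.toContinuousLinearMap
    { toFun := fun A => toMatrix A
      map_add' := toMatrix_add
      map_smul' := toMatrix_smul }
  have : CompleteSpace (Matrix (Fin a) (Fin b) ℝ) := FiniteDimensional.complete ℝ _
  have h1 : toMatrix (∫ ω, J ω ∂M) = ∫ ω, T (J ω) ∂M := (T.integral_comp_comm hJ).symm
  unfold specNorm
  rw [h1]
  exact norm_integral_le_integral_norm _

end Oracle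

/-! ### Measurability, integrability and means of the stochastic derivatives. -/

section Construction

variable {a b : ℕ} {Ω : Type*} [MeasurableSpace Ω] {M : Measure Ω} [IsProbabilityMeasure M]
  {φ : Vec a → Vec b → Ω → ℝ} {L : ℝ}

theorem hasGradientAt_gradX {f : Vec a → Vec b → ℝ}
    (hd : ContDiff ℝ 1 fun q : Vec a × Vec b => f q.1 q.2) (x : Vec a) (y : Vec b) :
    HasGradientAt (fun x => f x y) (gradX f x y) x := by
  have h : ContDiff ℝ 1 fun x : Vec a => f x y :=
    hd.comp (contDiff_id.prodMk (contDiff_const (c := y)))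
  exact ((h.differentiable one_ne_zero) x).hasGradientAt

theorem hasGradientAt_gradY {f : Vec a → Vec b → ℝ}
    (hd : ContDiff ℝ 1 fun q : Vec a × Vec b => f q.1 q.2) (x : Vec a) (y : Vec b) :
    HasGradientAt (fun y => f x y) (gradY f x y) y := by
  have h : ContDiff ℝ 1 fun y : Vec b => f x y :=
    hd.comp ((contDiff_const (c := x)).prodMk contDiff_id)
  exact ((h.differentiable one_ne_zero) y).hasGradientAt

theorem contDiff_gradY {f : Vec a → Vec b → ℝ}
    (hd : ContDiff ℝ 2 fun q : Vec a × Vec b => f q.1 q.2) :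
    ContDiff ℝ 1 fun q : Vec a × Vec b => gradY f q.1 q.2 := by
  have h1 : ContDiff ℝ 1 fun q : Vec a × Vec b => fderiv ℝ (fun y => f q.1 y) q.2 := by
    refine ContDiff.fderiv (f := fun (q : Vec a × Vec b) y => f q.1 y) (m := 2) (n := 1) ?_
      contDiff_snd one_add_one_eq_two.le
    exact hd.comp ((contDiff_fst.comp contDiff_fst).prodMk contDiff_snd)
  exact (InnerProductSpace.toDual ℝ (Vec b)).symm.contDiff.comp h1

theorem differentiableAt_gradY_fst {f : Vec a → Vec b → ℝ}
    (hd : ContDiff ℝ 2 fun q : Vec a × Vec b => f q.1 q.2) (x : Vec a) (y : Vec b) :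
    DifferentiableAt ℝ (fun x => gradY f x y) x := by
  have h : ContDiff ℝ 1 fun x : Vec a => gradY f x y :=
    (contDiff_gradY hd).comp (contDiff_id.prodMk (contDiff_const (c := y)))
  exact h.differentiable one_ne_zero x

theorem differentiableAt_gradY_snd {f : Vec a → Vec b → ℝ}
    (hd : ContDiff ℝ 2 fun q : Vec a × Vec b => f q.1 q.2) (x : Vec a) (y : Vec b) :
    DifferentiableAt ℝ (fun y => gradY f x y) y := by
  have h : ContDiff ℝ 1 fun y : Vec b => gradY f x y :=
    (contDiff_gradY hd).comp ((contDiff_const (c := x)).prodMk contDiff_id)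
  exact h.differentiable one_ne_zero y

theorem gradX_param (hd : ∀ ω, ContDiff ℝ 1 fun q : Vec a × Vec b => φ q.1 q.2 ω)
    (hm : ∀ x y, Measurable (φ x y)) (hi : ∀ x y, Integrable (φ x y) M) (hL0 : 0 ≤ L)
    (hL : ∀ ω, JointLipschitz norm (gradX fun x y => φ x y ω) L) (x : Vec a) (y : Vec b) :
    Measurable (fun ω => gradX (fun x y => φ x y ω) x y) ∧
    Integrable (fun ω => gradX (fun x y => φ x y ω) x y) M ∧
    HasGradientAt (fun x => ∫ ω, φ x y ω ∂M) (∫ ω, gradX (fun x y => φ x y ω) x y ∂M) x := by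
  have h1 : ∀ x ω, HasGradientAt (fun x => φ x y ω) (gradX (fun x y => φ x y ω) x y) x :=
    fun x ω => hasGradientAt_gradX (f := fun x y => φ x y ω) (hd ω) x y
  have h2 : ∀ x x' ω, ‖gradX (fun x y => φ x y ω) x y - gradX (fun x y => φ x y ω) x' y‖
      ≤ L * ‖x - x'‖ := fun x x' ω => (hL ω).fst x x' y
  exact ⟨measurable_gradient_param (φ := fun x => φ x y) h1 hL0 h2 (fun x => hm x y) x,
    integrable_gradient_param (φ := fun x => φ x y) h1 hL0 h2 (fun x => hm x y) (fun x => hi x y) x,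
    hasGradientAt_integral (φ := fun x => φ x y) h1 hL0 h2 (fun x => hm x y) (fun x => hi x y) x⟩

theorem gradY_param (hd : ∀ ω, ContDiff ℝ 1 fun q : Vec a × Vec b => φ q.1 q.2 ω)
    (hm : ∀ x y, Measurable (φ x y)) (hi : ∀ x y, Integrable (φ x y) M) (hL0 : 0 ≤ L)
    (hL : ∀ ω, JointLipschitz norm (gradY fun x y => φ x y ω) L) (x : Vec a) (y : Vec b) :
    Measurable (fun ω => gradY (fun x y => φ x y ω) x y) ∧
    Integrable (fun ω => gradY (fun x y => φ x y ω) x y) M ∧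
    HasGradientAt (fun y => ∫ ω, φ x y ω ∂M) (∫ ω, gradY (fun x y => φ x y ω) x y ∂M) y := by
  have h1 : ∀ y ω, HasGradientAt (fun y => φ x y ω) (gradY (fun x y => φ x y ω) x y) y :=
    fun y ω => hasGradientAt_gradY (f := fun x y => φ x y ω) (hd ω) x y
  have h2 : ∀ y y' ω, ‖gradY (fun x y => φ x y ω) x y - gradY (fun x y => φ x y ω) x y'‖
      ≤ L * ‖y - y'‖ := fun y y' ω => (hL ω).snd x y y'
  exact ⟨measurable_gradient_param (φ := fun y => φ x y) h1 hL0 h2 (fun y => hm x y) y,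
    integrable_gradient_param (φ := fun y => φ x y) h1 hL0 h2 (fun y => hm x y) (fun y => hi x y) y,
    hasGradientAt_integral (φ := fun y => φ x y) h1 hL0 h2 (fun y => hm x y) (fun y => hi x y) y⟩

theorem hessXY_param {ψb : Vec a → Vec b → Vec b}
    (hd : ∀ ω, ContDiff ℝ 2 fun q : Vec a × Vec b => φ q.1 q.2 ω)
    (hm : ∀ x y, Measurable fun ω => gradY (fun x y => φ x y ω) x y)
    (hi : ∀ x y, Integrable (fun ω => gradY (fun x y => φ x y ω) x y) M)
    (hb : ∀ x y, ∫ ω, gradY (fun x y => φ x y ω) x y ∂M = ψb x y) (hL0 : 0 ≤ L)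
    (hL : ∀ ω, JointLipschitz norm (hessXY fun x y => φ x y ω) L) (x : Vec a) (y : Vec b) :
    Measurable (fun ω => hessXY (fun x y => φ x y ω) x y) ∧
    Integrable (fun ω => hessXY (fun x y => φ x y ω) x y) M ∧
    HasFDerivAt (fun x => ψb x y) (jacCLM (∫ ω, hessXY (fun x y => φ x y ω) x y ∂M)) x := by
  have h1 : ∀ x ω, DifferentiableAt ℝ (fun x => gradY (fun x y => φ x y ω) x y) x :=
    fun x ω => differentiableAt_gradY_fst (hd ω) x y
  have h2 : ∀ x x' ω, ‖jac (fun x => gradY (fun x y => φ x y ω) x y) x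
      - jac (fun x => gradY (fun x y => φ x y ω) x y) x'‖ ≤ L * ‖x - x'‖ :=
    fun x x' ω => (hL ω).fst x x' y
  refine ⟨measurable_jac_param (ψ := fun x ω => gradY (fun x y => φ x y ω) x y) h1 hL0 h2
    (fun x => hm x y) x,
    integrable_jac_param (ψ := fun x ω => gradY (fun x y => φ x y ω) x y) h1 hL0 h2
      (fun x => hm x y) (fun x => hi x y) x, ?_⟩
  have := hasFDerivAt_integral_jac (ψ := fun x ω => gradY (fun x y => φ x y ω) x y) h1 hL0 h2
    (fun x => hm x y) (fun x => hi x y) x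
  simp only [hb] at this
  exact this

theorem hessYY_param {ψb : Vec a → Vec b → Vec b}
    (hd : ∀ ω, ContDiff ℝ 2 fun q : Vec a × Vec b => φ q.1 q.2 ω)
    (hm : ∀ x y, Measurable fun ω => gradY (fun x y => φ x y ω) x y)
    (hi : ∀ x y, Integrable (fun ω => gradY (fun x y => φ x y ω) x y) M)
    (hb : ∀ x y, ∫ ω, gradY (fun x y => φ x y ω) x y ∂M = ψb x y) (hL0 : 0 ≤ L)
    (hL : ∀ ω, JointLipschitz norm (hessYY fun x y => φ x y ω) L) (x : Vec a) (y : Vec b) :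
    Measurable (fun ω => hessYY (fun x y => φ x y ω) x y) ∧
    Integrable (fun ω => hessYY (fun x y => φ x y ω) x y) M ∧
    HasFDerivAt (fun y => ψb x y) (jacCLM (∫ ω, hessYY (fun x y => φ x y ω) x y ∂M)) y := by
  have h1 : ∀ y ω, DifferentiableAt ℝ (fun y => gradY (fun x y => φ x y ω) x y) y :=
    fun y ω => differentiableAt_gradY_snd (hd ω) x y
  have h2 : ∀ y y' ω, ‖jac (fun y => gradY (fun x y => φ x y ω) x y) y
      - jac (fun y => gradY (fun x y => φ x y ω) x y) y'‖ ≤ L * ‖y - y'‖ :=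
    fun y y' ω => (hL ω).snd x y y'
  refine ⟨measurable_jac_param (ψ := fun y ω => gradY (fun x y => φ x y ω) x y) h1 hL0 h2
    (fun y => hm x y) y,
    integrable_jac_param (ψ := fun y ω => gradY (fun x y => φ x y ω) x y) h1 hL0 h2
      (fun y => hm x y) (fun y => hi x y) y, ?_⟩
  have := hasFDerivAt_integral_jac (ψ := fun y ω => gradY (fun x y => φ x y ω) x y) h1 hL0 h2
    (fun y => hm x y) (fun y => hi x y) y
  simp only [hb] at this
  exact this

end Construction

/-! ### The five oracles of a problem. -/

section ProblemOracles

variable {m d : ℕ} {e : Fin m → ℕ} {Ξ Z : Type*} [MeasurableSpace Ξ] [MeasurableSpace Z]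
  {pb : Problem m d e Ξ Z} {X : Set (Vec d)} {lam B κ : ℝ} {D : ℕ}

theorem UniformBounds.B_nonneg (hA : Assumptions pb X) (hU : UniformBounds pb lam B κ D)
    (i : Fin m) : 0 ≤ B := (hA.const_nonneg i).1.trans (hU.const_le i).1

/-- Lipschitz constant of all oracles for the Euclidean (Frobenius) norm. -/
noncomputable def lipConst (B : ℝ) (D : ℕ) : ℝ := (D + 1) * B

theorem one_le_dim_succ (D : ℕ) : (1 : ℝ) ≤ D + 1 := by
  have := (Nat.cast_nonneg D : (0 : ℝ) ≤ D); linarith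

theorem secondMomentLE_dim {Ω : Type*} [MeasurableSpace Ω] {M : Measure Ω} {N : Ω → ℝ} {C : ℝ}
    (h : SecondMomentLE M N C) : SecondMomentLE M N ((D + 1) * C) :=
  ⟨h.1, h.2.trans (by
    rw [mul_pow]
    exact le_mul_of_one_le_left (sq_nonneg _) (one_le_pow₀ (one_le_dim_succ D)))⟩

theorem jointLipschitz_norm_dim {a b : ℕ} {E : Type*} [NormedAddCommGroup E]
    {h : Vec a → Vec b → E} {L : ℝ} (hl : JointLipschitz norm h L) (hL0 : 0 ≤ L) (hLB : L ≤ B) :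
    JointLipschitz norm h (lipConst B D) :=
  hl.mono zero_le_one (fun z => (one_mul _).ge) (by
    rw [one_mul]
    exact hLB.trans (le_mul_of_one_le_left (hL0.trans hLB) (one_le_dim_succ D)))

theorem jointLipschitz_spec_dim {a b a' b' : ℕ}
    {h : Vec a → Vec b → Mat a' b'} {L : ℝ} (hl : JointLipschitz specNorm h L) (hLB : L ≤ B)
    (hb : b' ≤ D) : JointLipschitz norm h (lipConst B D) :=
  hl.mono (by positivity) (fun z => norm_le_spec hb z)
    (mul_le_mul_of_nonneg_left hLB (by positivity))

theorem secondMomentLE_spec_dim {Ω : Type*} [MeasurableSpace Ω] {M : Measure Ω} {a b : ℕ}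
    {J : Ω → Mat a b} {C : ℝ} (hJ : Measurable J) (hb : b ≤ D)
    (h : SecondMomentLE M (fun ω => specNorm (J ω)) C) :
    SecondMomentLE M (fun ω => ‖J ω‖) ((D + 1) * C) := by
  have hle : ∀ ω, ‖J ω‖ ^ 2 ≤ ((D : ℝ) + 1) ^ 2 * specNorm (J ω) ^ 2 := fun ω => by
    rw [← mul_pow]
    exact pow_le_pow_left₀ (norm_nonneg _) (norm_le_spec hb _) 2
  have hi := h.1.const_mul (((D : ℝ) + 1) ^ 2)
  refine ⟨Integrable.mono' hi (hJ.norm.pow_const 2).aestronglyMeasurable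
    (Filter.Eventually.of_forall fun ω => ?_), ?_⟩
  · rw [Real.norm_of_nonneg (sq_nonneg _)]; exact hle ω
  · refine (integral_mono_of_nonneg (Filter.Eventually.of_forall fun ω => sq_nonneg _) hi
      (Filter.Eventually.of_forall hle)).trans ?_
    rw [integral_const_mul, mul_pow]
    exact mul_le_mul_of_nonneg_left h.2 (by positivity)

theorem lipConst_nonneg (hB : 0 ≤ B) : 0 ≤ lipConst B D := by unfold lipConst; positivity

variable (hA : Assumptions pb X) (hU : UniformBounds pb lam B κ D) (i : Fin m)
include hA hU

theorem hasGradientAt_fbar_x (x : Vec d) (y : Vec (e i)) :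
    HasGradientAt (fun x => pb.fbar i x y) (gradX (pb.fbar i) x y) x := by
  have := hA.prob_P i
  have h := (gradX_param (M := pb.P i) (hA.f_diff i) (hA.f_meas i) (hA.f_int i)
    (lipConst_nonneg (D := D) (hU.B_nonneg hA i)) (fun ξ => jointLipschitz_norm_dim (hA.lip_fx i ξ)
      (hA.const_nonneg i).2.2.2.2.2.1 (hU.const_le i).2.2.2.2.2.1) x y).2.2
  exact h.differentiableAt.hasGradientAt

theorem oracle_fx : Oracle (pb.P i) (fun x y ξ => gradX (fun x y => pb.f i x y ξ) x y)
    (gradX (pb.fbar i)) X (pb.R i) (lipConst B D) ((D + 1) * pb.Cfx i) := by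
  have := hA.prob_P i
  have h := gradX_param (M := pb.P i) (hA.f_diff i) (hA.f_meas i) (hA.f_int i)
    (lipConst_nonneg (D := D) (hU.B_nonneg hA i)) (fun ξ => jointLipschitz_norm_dim (hA.lip_fx i ξ)
      (hA.const_nonneg i).2.2.2.2.2.1 (hU.const_le i).2.2.2.2.2.1)
  exact ⟨fun x y => (h x y).1, fun ξ => jointLipschitz_norm_dim (hA.lip_fx i ξ)
      (hA.const_nonneg i).2.2.2.2.2.1 (hU.const_le i).2.2.2.2.2.1, fun x y => (h x y).2.1,
    fun x y => ((h x y).2.2).gradient.symm, fun x hx y hy => secondMomentLE_dim (hA.mom_fx i x hx y hy)⟩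

theorem hasGradientAt_fbar_y (x : Vec d) (y : Vec (e i)) :
    HasGradientAt (fun y => pb.fbar i x y) (gradY (pb.fbar i) x y) y := by
  have := hA.prob_P i
  have h := (gradY_param (M := pb.P i) (hA.f_diff i) (hA.f_meas i) (hA.f_int i)
    (lipConst_nonneg (D := D) (hU.B_nonneg hA i)) (fun ξ => jointLipschitz_norm_dim (hA.lip_fy i ξ)
      (hA.const_nonneg i).2.2.2.2.2.2.1 (hU.const_le i).2.2.2.2.2.2.1) x y).2.2
  exact h.differentiableAt.hasGradientAt

theorem oracle_fy : Oracle (pb.P i) (fun x y ξ => gradY (fun x y => pb.f i x y ξ) x y)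
    (gradY (pb.fbar i)) X (pb.R i) (lipConst B D) ((D + 1) * pb.Cfy i) := by
  have := hA.prob_P i
  have h := gradY_param (M := pb.P i) (hA.f_diff i) (hA.f_meas i) (hA.f_int i)
    (lipConst_nonneg (D := D) (hU.B_nonneg hA i)) (fun ξ => jointLipschitz_norm_dim (hA.lip_fy i ξ)
      (hA.const_nonneg i).2.2.2.2.2.2.1 (hU.const_le i).2.2.2.2.2.2.1)
  exact ⟨fun x y => (h x y).1, fun ξ => jointLipschitz_norm_dim (hA.lip_fy i ξ)
      (hA.const_nonneg i).2.2.2.2.2.2.1 (hU.const_le i).2.2.2.2.2.2.1, fun x y => (h x y).2.1,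
    fun x y => ((h x y).2.2).gradient.symm, fun x hx y hy => secondMomentLE_dim (hA.mom_fy i x hx y hy)⟩

/-- The mean obeys the bound `Cfy` itself, without the dimensional factor of the oracle. Hence the
true derivative lies in the ball onto which the estimator is projected. -/
theorem norm_gradY_fbar_le {x : Vec d} (hx : x ∈ X) {y : Vec (e i)} (hy : ‖y‖ ≤ pb.R i) :
    ‖gradY (pb.fbar i) x y‖ ≤ pb.Cfy i := by
  have := hA.prob_P i
  have ho := oracle_fy hA hU i
  rw [← ho.mean]
  exact (norm_integral_le_integral_norm _).trans (integral_le_of_secondMomentLE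
    (ho.meas x y).norm (hA.const_nonneg i).2.1 (hA.mom_fy i x hx y hy)).2

theorem norm_gradX_fbar_le {x : Vec d} (hx : x ∈ X) {y : Vec (e i)} (hy : ‖y‖ ≤ pb.R i) :
    ‖gradX (pb.fbar i) x y‖ ≤ pb.Cfx i := by
  have := hA.prob_P i
  have ho := oracle_fx hA hU i
  rw [← ho.mean]
  exact (norm_integral_le_integral_norm _).trans (integral_le_of_secondMomentLE
    (ho.meas x y).norm (hA.const_nonneg i).1 (hA.mom_fx i x hx y hy)).2

theorem gbar_gradY_param (x : Vec d) (y : Vec (e i)) :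
    Measurable (fun ζ => gradY (fun x y => pb.g i x y ζ) x y) ∧
    Integrable (fun ζ => gradY (fun x y => pb.g i x y ζ) x y) (pb.Q i) ∧
    HasGradientAt (fun y => pb.gbar i x y)
      (∫ ζ, gradY (fun x y => pb.g i x y ζ) x y ∂(pb.Q i)) y := by
  have := hA.prob_Q i
  exact gradY_param (M := pb.Q i) (fun ζ => (hA.g_diff i ζ).of_le (by norm_num)) (hA.g_meas i)
    (hA.g_int i) (hU.B_nonneg hA i) (fun ζ => (hA.lip_gy i ζ).mono zero_le_one
      (fun z => (one_mul _).ge) (by rw [one_mul]; exact (hU.const_le i).2.2.2.2.2.2.2.1)) x y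

theorem hasGradientAt_gbar_y (x : Vec d) (y : Vec (e i)) :
    HasGradientAt (fun y => pb.gbar i x y) (gradY (pb.gbar i) x y) y :=
  (gbar_gradY_param hA hU i x y).2.2.differentiableAt.hasGradientAt

theorem integral_gradY_g (x : Vec d) (y : Vec (e i)) :
    ∫ ζ, gradY (fun x y => pb.g i x y ζ) x y ∂(pb.Q i) = gradY (pb.gbar i) x y :=
  (gbar_gradY_param hA hU i x y).2.2.gradient.symm

theorem oracle_gy : Oracle (pb.Q i) (fun x y ζ => gradY (fun x y => pb.g i x y ζ) x y)
    (gradY (pb.gbar i)) X (pb.R i) (lipConst B D) ((D + 1) * pb.Cgy i) :=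
  ⟨fun x y => (gbar_gradY_param hA hU i x y).1, fun ζ => jointLipschitz_norm_dim (hA.lip_gy i ζ)
      (hA.const_nonneg i).2.2.2.2.2.2.2.1 (hU.const_le i).2.2.2.2.2.2.2.1,
    fun x y => (gbar_gradY_param hA hU i x y).2.1, integral_gradY_g hA hU i,
    fun x hx y hy => secondMomentLE_dim (hA.mom_gy i x hx y hy)⟩

theorem lip_gradY_gbar : JointLipschitz norm (gradY (pb.gbar i)) B := fun x x' y y' => by
  have := hA.prob_Q i
  rw [← integral_gradY_g hA hU i, ← integral_gradY_g hA hU i,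
    ← integral_sub (gbar_gradY_param hA hU i _ _).2.1 (gbar_gradY_param hA hU i _ _).2.1]
  have := norm_integral_le_of_norm_le_const (μ := pb.Q i)
    (f := fun ζ => gradY (fun x y => pb.g i x y ζ) x y - gradY (fun x y => pb.g i x y ζ) x' y')
    (Filter.Eventually.of_forall fun ζ => (hA.lip_gy i ζ x x' y y').trans
      (mul_le_mul_of_nonneg_right (hU.const_le i).2.2.2.2.2.2.2.1 (Real.sqrt_nonneg _)))
  simpa using this

theorem gbar_hessXY_param (x : Vec d) (y : Vec (e i)) :
    Measurable (fun ζ => hessXY (fun x y => pb.g i x y ζ) x y) ∧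
    Integrable (fun ζ => hessXY (fun x y => pb.g i x y ζ) x y) (pb.Q i) ∧
    HasFDerivAt (fun x => gradY (pb.gbar i) x y)
      (jacCLM (∫ ζ, hessXY (fun x y => pb.g i x y ζ) x y ∂(pb.Q i))) x := by
  have := hA.prob_Q i
  exact hessXY_param (M := pb.Q i) (hA.g_diff i) (fun x y => (gbar_gradY_param hA hU i x y).1)
    (fun x y => (gbar_gradY_param hA hU i x y).2.1) (integral_gradY_g hA hU i)
    (lipConst_nonneg (D := D) (hU.B_nonneg hA i))
    (fun ζ => jointLipschitz_spec_dim (hA.lip_gxy i ζ) (hU.const_le i).2.2.2.2.2.2.2.2.1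
      (hU.dim_le i)) x y

theorem oracle_gxy : Oracle (pb.Q i) (fun x y ζ => hessXY (fun x y => pb.g i x y ζ) x y)
    (hessXY (pb.gbar i)) X (pb.R i) (lipConst B D) ((D + 1) * pb.Cgxy i) :=
  ⟨fun x y => (gbar_hessXY_param hA hU i x y).1,
    fun ζ => jointLipschitz_spec_dim (hA.lip_gxy i ζ) (hU.const_le i).2.2.2.2.2.2.2.2.1
      (hU.dim_le i),
    fun x y => (gbar_hessXY_param hA hU i x y).2.1,
    fun x y => (jac_eq_of_hasFDerivAt (gbar_hessXY_param hA hU i x y).2.2).symm,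
    fun x hx y hy => secondMomentLE_spec_dim (gbar_hessXY_param hA hU i x y).1 (hU.dim_le i)
      (hA.mom_gxy i x hx y hy)⟩

theorem hasFDerivAt_gradY_gbar_x (x : Vec d) (y : Vec (e i)) :
    HasFDerivAt (fun x => gradY (pb.gbar i) x y) (jacCLM (hessXY (pb.gbar i) x y)) x := by
  rw [← (oracle_gxy hA hU i).mean]; exact (gbar_hessXY_param hA hU i x y).2.2

/-- The moment assumption is used in spectral norm, which is what places the true mixed Hessian in
the spectral ball of the projection. -/
theorem specNorm_hessXY_gbar_le {x : Vec d} (hx : x ∈ X) {y : Vec (e i)} (hy : ‖y‖ ≤ pb.R i) :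
    specNorm (hessXY (pb.gbar i) x y) ≤ pb.Cgxy i := by
  have := hA.prob_Q i
  have ho := oracle_gxy hA hU i
  rw [← ho.mean]
  exact (specNorm_integral_le (ho.int x y)).trans (integral_le_of_secondMomentLE
    (continuous_specNorm.measurable.comp (ho.meas x y)) (hA.const_nonneg i).2.2.2.1
    (hA.mom_gxy i x hx y hy)).2

theorem gbar_hessYY_param (x : Vec d) (y : Vec (e i)) :
    Measurable (fun ζ => hessYY (fun x y => pb.g i x y ζ) x y) ∧
    Integrable (fun ζ => hessYY (fun x y => pb.g i x y ζ) x y) (pb.Q i) ∧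
    HasFDerivAt (fun y => gradY (pb.gbar i) x y)
      (jacCLM (∫ ζ, hessYY (fun x y => pb.g i x y ζ) x y ∂(pb.Q i))) y := by
  have := hA.prob_Q i
  exact hessYY_param (M := pb.Q i) (hA.g_diff i) (fun x y => (gbar_gradY_param hA hU i x y).1)
    (fun x y => (gbar_gradY_param hA hU i x y).2.1) (integral_gradY_g hA hU i)
    (lipConst_nonneg (D := D) (hU.B_nonneg hA i))
    (fun ζ => jointLipschitz_spec_dim (hA.lip_gyy i ζ) (hU.const_le i).2.2.2.2.2.2.2.2.2
      (hU.dim_le i)) x y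

theorem oracle_gyy : Oracle (pb.Q i) (fun x y ζ => hessYY (fun x y => pb.g i x y ζ) x y)
    (hessYY (pb.gbar i)) X (pb.R i) (lipConst B D) ((D + 1) * pb.Cgyy i) :=
  ⟨fun x y => (gbar_hessYY_param hA hU i x y).1,
    fun ζ => jointLipschitz_spec_dim (hA.lip_gyy i ζ) (hU.const_le i).2.2.2.2.2.2.2.2.2
      (hU.dim_le i),
    fun x y => (gbar_hessYY_param hA hU i x y).2.1,
    fun x y => (jac_eq_of_hasFDerivAt (gbar_hessYY_param hA hU i x y).2.2).symm,
    fun x hx y hy => secondMomentLE_spec_dim (gbar_hessYY_param hA hU i x y).1 (hU.dim_le i)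
      (hA.mom_gyy i x hx y hy)⟩

theorem hasFDerivAt_gradY_gbar_y (x : Vec d) (y : Vec (e i)) :
    HasFDerivAt (fun y => gradY (pb.gbar i) x y) (jacCLM (hessYY (pb.gbar i) x y)) y := by
  rw [← (oracle_gyy hA hU i).mean]; exact (gbar_hessYY_param hA hU i x y).2.2

/-- Derived from the Lipschitz constant of ∇_y g rather than from the moments, so it holds at every
point. It is needed at the previous point of a state, which is not assumed to lie in X. -/
theorem norm_hessYY_gbar_le (x : Vec d) (y : Vec (e i)) :
    ‖hessYY (pb.gbar i) x y‖ ≤ lipConst B D := by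
  have hB := hU.B_nonneg hA i
  have hJ : ‖jacCLM (hessYY (pb.gbar i) x y)‖ ≤ B :=
    (hasFDerivAt_gradY_gbar_y hA hU i x y).le_of_lip' hB (Filter.Eventually.of_forall fun y' =>
      (lip_gradY_gbar hA hU i).snd x y' y)
  apply le_of_sq_le_sq _ (lipConst_nonneg hB)
  refine (norm_sq_le_of_norm_jacCLM_le hJ).trans ?_
  unfold lipConst
  rw [mul_pow]
  have h1 : ((e i : ℕ) : ℝ) ≤ D := by exact_mod_cast hU.dim_le i
  have h2 : ((e i : ℕ) : ℝ) ≤ (D + 1) ^ 2 := by nlinarith [(Nat.cast_nonneg D : (0 : ℝ) ≤ D)]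
  gcongr

end ProblemOracles

end Bilevel

namespace Bilevel

/-! ### The lower solution map, and the gradient of F. -/

section Hypergradient

variable {m d : ℕ} {e : Fin m → ℕ} {Ξ Z : Type*} [MeasurableSpace Ξ] [MeasurableSpace Z]
  {pb : Problem m d e Ξ Z} {X : Set (Vec d)} {lam B κ : ℝ} {D : ℕ}

theorem Assumptions.gbar_ystar_le (hA : Assumptions pb X) (i : Fin m) (x : Vec d) (y : Vec (e i)) :
    pb.gbar i x (pb.ystar i x) ≤ pb.gbar i x y :=
  Classical.epsilon_spec (hA.exists_min i x) y

theorem Assumptions.m_pos (hA : Assumptions pb X) : 0 < m := by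
  rcases Nat.eq_zero_or_pos m with h | h
  · subst h
    have := hA.p_sum
    simp at this
  · exact h

/-- The hypergradient of task `i`. -/
noncomputable def Problem.zstar (pb : Problem m d e Ξ Z) (i : Fin m) (x : Vec d) : Vec d :=
  zmap (gradX (pb.fbar i) x (pb.ystar i x)) (gradY (pb.fbar i) x (pb.ystar i x))
    (hessXY (pb.gbar i) x (pb.ystar i x)) (hessYY (pb.gbar i) x (pb.ystar i x))

variable (hA : Assumptions pb X) (hU : UniformBounds pb lam B κ D) (hlam : 0 < lam) (i : Fin m)
include hA hU

theorem hessYY_gbar_mem (x : Vec d) (y : Vec (e i)) : hessYY (pb.gbar i) x y ∈ psdAbove (e i) lam :=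
  psdAbove_mono hU.lam_le (hA.strong i x y)

theorem gradY_gbar_ystar (x : Vec d) : gradY (pb.gbar i) x (pb.ystar i x) = 0 := by
  have h := (hasGradientAt_gbar_y hA hU i x (pb.ystar i x))
  have h2 := (show IsLocalMin (fun y => pb.gbar i x y) (pb.ystar i x) from
    Filter.Eventually.of_forall fun y => hA.gbar_ystar_le i x y).hasFDerivAt_eq_zero h.hasFDerivAt
  simpa using h2

theorem jacCLM_hessYY_gbar (x : Vec d) (y v : Vec (e i)) :
    jacCLM (hessYY (pb.gbar i) x y) v = matVec (toMatrix (hessYY (pb.gbar i) x y)) v := by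
  rw [jacCLM_apply, transpose_of_mem_psdAbove (hessYY_gbar_mem hA hU i x y)]

/-- Mean value theorem for t ↦ ⟨∇_y g(x, y' + t v), v⟩ with v = y − y', whose derivative is the
quadratic form of the Hessian at v. -/
theorem gradY_gbar_strongMono (x : Vec d) (y y' : Vec (e i)) :
    lam * ‖y - y'‖ ^ 2 ≤ inner ℝ (gradY (pb.gbar i) x y - gradY (pb.gbar i) x y') (y - y') := by
  set v := y - y' with hv
  have hd : ∀ t : ℝ, HasDerivAt (fun t : ℝ => inner ℝ (gradY (pb.gbar i) x (y' + t • v)) v)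
      (inner ℝ (jacCLM (hessYY (pb.gbar i) x (y' + t • v)) v) v) t := by
    intro t
    have h1 : HasDerivAt (fun t : ℝ => y' + t • v) v t := by
      simpa using ((hasDerivAt_id t).smul_const v).const_add y'
    have h2 := (hasFDerivAt_gradY_gbar_y hA hU i x (y' + t • v)).comp_hasDerivAt t h1
    simpa using h2.inner ℝ (hasDerivAt_const t v)
  obtain ⟨c, _, hc⟩ := exists_hasDerivAt_eq_slope
    (fun t : ℝ => inner ℝ (gradY (pb.gbar i) x (y' + t • v)) v) _ zero_lt_one
    (fun t _ => (hd t).continuousAt.continuousWithinAt) (fun t _ => hd t)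
  have h3 := (mem_psdAbove_iff.1 (hessYY_gbar_mem hA hU i x (y' + c • v))).2 v
  rw [jacCLM_hessYY_gbar hA hU, real_inner_comm] at hc
  rw [hc] at h3
  simpa [hv, inner_sub_left] using h3

include hlam

/-- Strong monotonicity at x is applied to y*(x) and y*(x'). Only ∇_y g(x, y*(x')) survives, and it
is at most B‖x − x'‖ because ∇_y g(x', y*(x')) = 0. -/
theorem norm_ystar_sub_le (x x' : Vec d) :
    ‖pb.ystar i x - pb.ystar i x'‖ ≤ B / lam * ‖x - x'‖ := by
  have h1 := gradY_gbar_strongMono hA hU i x (pb.ystar i x) (pb.ystar i x')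
  rw [gradY_gbar_ystar hA hU] at h1
  have h2 := (lip_gradY_gbar hA hU i).fst x' x (pb.ystar i x')
  rw [gradY_gbar_ystar hA hU, zero_sub] at h2
  rw [zero_sub] at h1
  have h3 := real_inner_le_norm (-gradY (pb.gbar i) x (pb.ystar i x'))
    (pb.ystar i x - pb.ystar i x')
  set r := ‖pb.ystar i x - pb.ystar i x'‖
  have h4 : lam * r ^ 2 ≤ B * ‖x - x'‖ * r := by
    rw [norm_sub_rev x x']
    exact h1.trans (h3.trans (mul_le_mul_of_nonneg_right h2 (norm_nonneg _)))
  rcases (norm_nonneg (pb.ystar i x - pb.ystar i x')).eq_or_lt with h0 | h0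
  · change r ≤ _
    rw [show r = 0 from h0.symm]
    have := hU.B_nonneg hA i
    positivity
  · have : lam * r ≤ B * ‖x - x'‖ := by
      refine le_of_mul_le_mul_right ?_ h0
      change lam * r * r ≤ _ * r
      linarith
    rw [div_mul_eq_mul_div, le_div_iff₀ hlam]
    linarith

theorem continuous_ystar : Continuous (pb.ystar i) := by
  have hB := hU.B_nonneg hA i
  refine (LipschitzWith.of_dist_le_mul (K := Real.toNNReal (B / lam)) fun x x' => ?_).continuous
  rw [Real.coe_toNNReal _ (by positivity), dist_eq_norm, dist_eq_norm]
  exact norm_ystar_sub_le hA hU hlam i x x'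

omit hlam in
theorem fbar_taylor (x x' : Vec d) (y y' : Vec (e i)) :
    |pb.fbar i x' y' - pb.fbar i x y - inner ℝ (gradX (pb.fbar i) x y) (x' - x)
      - inner ℝ (gradY (pb.fbar i) x y) (y' - y)|
      ≤ lipConst B D * (‖x' - x‖ + ‖y' - y‖) ^ 2 := by
  have := hA.prob_P i
  have hL := lipConst_nonneg (D := D) (hU.B_nonneg hA i)
  have h := norm_taylor_pair_le (φ := pb.fbar i)
    (A := fun x y => InnerProductSpace.toDual ℝ _ (gradX (pb.fbar i) x y))
    (A' := fun x y => InnerProductSpace.toDual ℝ _ (gradY (pb.fbar i) x y))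
    (fun x y => (hasGradientAt_fbar_x hA hU i x y).hasFDerivAt)
    (fun x y => (hasGradientAt_fbar_y hA hU i x y).hasFDerivAt) hL
    (fun x x' y y' => by
      rw [← map_sub, LinearIsometryEquiv.norm_map]
      exact (oracle_fx hA hU i).lip_mean.norm_le_add hL x x' y y')
    (fun x x' y y' => by
      rw [← map_sub, LinearIsometryEquiv.norm_map]
      exact (oracle_fy hA hU i).lip_mean.norm_le_add hL x x' y y') x x' y y'
  simpa using h

omit hlam in
theorem gradY_gbar_taylor (x x' : Vec d) (y y' : Vec (e i)) :
    ‖gradY (pb.gbar i) x' y' - gradY (pb.gbar i) x y - jacCLM (hessXY (pb.gbar i) x y) (x' - x)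
      - jacCLM (hessYY (pb.gbar i) x y) (y' - y)‖
      ≤ lipConst B D * (‖x' - x‖ + ‖y' - y‖) ^ 2 := by
  have := hA.prob_Q i
  have hL := lipConst_nonneg (D := D) (hU.B_nonneg hA i)
  exact norm_taylor_pair_le (φ := gradY (pb.gbar i))
    (A := fun x y => jacCLM (hessXY (pb.gbar i) x y))
    (A' := fun x y => jacCLM (hessYY (pb.gbar i) x y))
    (fun x y => hasFDerivAt_gradY_gbar_x hA hU i x y)
    (fun x y => hasFDerivAt_gradY_gbar_y hA hU i x y) hL
    (fun x x' y y' => by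
      rw [← jacCLM_sub]
      exact (norm_jacCLM_le _).trans ((oracle_gxy hA hU i).lip_mean.norm_le_add hL x x' y y'))
    (fun x x' y y' => by
      rw [← jacCLM_sub]
      exact (norm_jacCLM_le _).trans ((oracle_gyy hA hU i).lip_mean.norm_le_add hL x x' y y'))
    x x' y y'

/-- Implicit differentiation with explicit remainders. Both lower gradients vanish, so with h = x' −
x and Δ = y*(x') − y*(x) the expansion of ∇_y g says Vᵀh + HΔ = O(‖h‖²). Pairing it with q = H⁻¹∇_y
f, H being symmetric, turns ⟨∇_y f, Δ⟩ into −⟨V q, h⟩, which is the second term of the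
hypergradient. -/
theorem fbar_ystar_taylor (x x' : Vec d) :
    |pb.fbar i x' (pb.ystar i x') - pb.fbar i x (pb.ystar i x) - inner ℝ (pb.zstar i x) (x' - x)|
      ≤ lipConst B D * (1 + B / lam) ^ 2 * (1 + ‖gradY (pb.fbar i) x (pb.ystar i x)‖ / lam)
        * ‖x' - x‖ ^ 2 := by
  have hB := hU.B_nonneg hA i
  have hL := lipConst_nonneg (D := D) hB
  have h1 := fbar_taylor hA hU i x x' (pb.ystar i x) (pb.ystar i x')
  have h2 := gradY_gbar_taylor hA hU i x x' (pb.ystar i x) (pb.ystar i x')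
  rw [gradY_gbar_ystar hA hU, gradY_gbar_ystar hA hU] at h2
  have h3 := norm_ystar_sub_le hA hU hlam i x' x
  have hmem := hessYY_gbar_mem hA hU i x (pb.ystar i x)
  set gy := gradY (pb.fbar i) x (pb.ystar i x)
  set gx := gradX (pb.fbar i) x (pb.ystar i x)
  set V := hessXY (pb.gbar i) x (pb.ystar i x)
  set H := hessYY (pb.gbar i) x (pb.ystar i x)
  set Δ := pb.ystar i x' - pb.ystar i x
  set h := x' - x
  set q := matVec (toMatrix H)⁻¹ gy
  have hq : ‖q‖ ≤ ‖gy‖ / lam := norm_inv_matVec_le hlam hmem gy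
  have e1 : inner ℝ (pb.zstar i x) h = inner ℝ gx h - inner ℝ q (jacCLM V h) := by
    change inner ℝ (gx - matVec (toMatrix V) q) h = _
    rw [inner_sub_left, inner_matVec_left, jacCLM_apply]
  have e2 : inner ℝ gy Δ = inner ℝ q (jacCLM H Δ) := by
    rw [jacCLM_apply, ← inner_matVec_left, matVec_inv_matVec hlam hmem]
  have hb : ‖h‖ + ‖Δ‖ ≤ (1 + B / lam) * ‖h‖ := by linarith
  have hsq : lipConst B D * (‖h‖ + ‖Δ‖) ^ 2 ≤ lipConst B D * (1 + B / lam) ^ 2 * ‖h‖ ^ 2 := by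
    rw [mul_assoc, ← mul_pow]
    gcongr
  set K := lipConst B D * (1 + B / lam) ^ 2 * ‖h‖ ^ 2
  have h4 : |inner ℝ q (0 - 0 - jacCLM V h - jacCLM H Δ)| ≤ ‖gy‖ / lam * K :=
    (abs_real_inner_le_norm _ _).trans (mul_le_mul hq (h2.trans hsq) (norm_nonneg _) (by positivity))
  have e3 : inner ℝ q (0 - 0 - jacCLM V h - jacCLM H Δ)
      = - inner ℝ q (jacCLM V h) - inner ℝ q (jacCLM H Δ) := by
    simp [inner_sub_right]
  rw [e3, abs_le] at h4
  have h5 := abs_le.1 (h1.trans hsq)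
  rw [e2] at h5
  rw [e1, show lipConst B D * (1 + B / lam) ^ 2 * (1 + ‖gy‖ / lam) * ‖h‖ ^ 2 = K + ‖gy‖ / lam * K by
    simp only [K]; ring, abs_le]
  constructor <;> linarith [h4.1, h4.2, h5.1, h5.2]

omit i

/-- G need only bound the gradients at the base point x. With G depending on x this gives
differentiability everywhere; with G = B on X it gives uniform smoothness. -/
theorem F_taylor_of_le {x : Vec d} {G : ℝ} (hG : ∀ i, ‖gradY (pb.fbar i) x (pb.ystar i x)‖ ≤ G)
    (x' : Vec d) :
    |pb.F x' - pb.F x - inner ℝ ((1 / (m : ℝ)) • ∑ i, pb.zstar i x) (x' - x)|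
      ≤ lipConst B D * (1 + B / lam) ^ 2 * (1 + G / lam) * ‖x' - x‖ ^ 2 := by
  have hm : (0 : ℝ) < m := by exact_mod_cast hA.m_pos
  have e : pb.F x' - pb.F x - inner ℝ ((1 / (m : ℝ)) • ∑ i, pb.zstar i x) (x' - x)
      = (1 / (m : ℝ)) * ∑ i, (pb.fbar i x' (pb.ystar i x') - pb.fbar i x (pb.ystar i x)
        - inner ℝ (pb.zstar i x) (x' - x)) := by
    simp only [Problem.F, real_inner_smul_left, sum_inner, Finset.sum_sub_distrib]
    ring
  rw [e, abs_mul, abs_of_pos (by positivity)]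
  set K := lipConst B D * (1 + B / lam) ^ 2 * (1 + G / lam) * ‖x' - x‖ ^ 2
  calc _ ≤ (1 / (m : ℝ)) * ∑ _i : Fin m, K := by
        refine mul_le_mul_of_nonneg_left ?_ (by positivity)
        refine (Finset.abs_sum_le_sum_abs _ _).trans (Finset.sum_le_sum fun i _ => ?_)
        refine (fbar_ystar_taylor hA hU hlam i x x').trans ?_
        have hB := hU.B_nonneg hA i
        have hL := lipConst_nonneg (D := D) hB
        have := hG i
        simp only [K]
        gcongr
    _ = K := by simp; field_simp

theorem hasGradientAt_F (x : Vec d) :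
    HasGradientAt pb.F ((1 / (m : ℝ)) • ∑ i, pb.zstar i x) x := by
  refine hasFDerivAt_of_norm_taylor_le (L := lipConst B D * (1 + B / lam) ^ 2 *
    (1 + (∑ i, ‖gradY (pb.fbar i) x (pb.ystar i x)‖) / lam)) fun x' => ?_
  have := F_taylor_of_le hA hU hlam (x := x) (fun i => Finset.single_le_sum
    (f := fun i => ‖gradY (pb.fbar i) x (pb.ystar i x)‖) (fun _ _ => norm_nonneg _)
    (Finset.mem_univ i)) x'
  simpa [real_inner_smul_left, sum_inner] using this

theorem continuous_F : Continuous pb.F :=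
  continuous_iff_continuousAt.2 fun x => (hasGradientAt_F hA hU hlam x).hasFDerivAt.continuousAt

/-- Smoothness constant in the descent inequality for `F`. -/
noncomputable def smoothConst (lam B : ℝ) (D : ℕ) : ℝ := lipConst B D * (1 + B / lam) ^ 3

omit hA hU hlam in
theorem smoothConst_nonneg (hlam : 0 < lam) (hB : 0 ≤ B) : 0 ≤ smoothConst lam B D := by
  have := lipConst_nonneg (D := D) hB
  unfold smoothConst; positivity

/-- Only the base point has to lie in X, so nothing is required of the point reached by a step. -/
theorem F_descent {x : Vec d} (hx : x ∈ X) (x' : Vec d) :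
    pb.F x' ≤ pb.F x + inner ℝ (gradient pb.F x) (x' - x) + smoothConst lam B D * ‖x' - x‖ ^ 2 := by
  have h := F_taylor_of_le hA hU hlam (x := x) (G := B) (fun i =>
    (norm_gradY_fbar_le hA hU i hx (hA.ystar_le i x hx)).trans (hU.const_le i).2.1) x'
  rw [← (hasGradientAt_F hA hU hlam x).gradient] at h
  have h2 := (abs_le.1 h).2
  have e : lipConst B D * (1 + B / lam) ^ 2 * (1 + B / lam) = smoothConst lam B D := by
    unfold smoothConst; ring
  rw [e] at h2
  linarith

omit hlam in
theorem zBounds_mean (i : Fin m) {x : Vec d} (hx : x ∈ X) {y : Vec (e i)} (hy : ‖y‖ ≤ pb.R i) :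
    ZBounds B lam (gradX (pb.fbar i) x y) (gradY (pb.fbar i) x y) (hessXY (pb.gbar i) x y)
      (hessYY (pb.gbar i) x y) :=
  ⟨(norm_gradX_fbar_le hA hU i hx hy).trans (hU.const_le i).1,
    (norm_gradY_fbar_le hA hU i hx hy).trans (hU.const_le i).2.1,
    (specNorm_hessXY_gbar_le hA hU i hx hy).trans (hU.const_le i).2.2.2.1,
    hessYY_gbar_mem hA hU i x y⟩

theorem norm_gradient_F_sub_le {x x' : Vec d} (hx : x ∈ X) (hx' : x' ∈ X) :
    ‖gradient pb.F x - gradient pb.F x'‖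
      ≤ 4 * zLip B lam * lipConst B D * (1 + B / lam) * ‖x - x'‖ := by
  have hm : (0 : ℝ) < m := by exact_mod_cast hA.m_pos
  rw [(hasGradientAt_F hA hU hlam x).gradient, (hasGradientAt_F hA hU hlam x').gradient, ← smul_sub,
    ← Finset.sum_sub_distrib, norm_smul, Real.norm_of_nonneg (by positivity)]
  set K := 4 * zLip B lam * lipConst B D * (1 + B / lam) * ‖x - x'‖ with hK
  calc _ ≤ (1 / (m : ℝ)) * ∑ _i : Fin m, K := by
        refine mul_le_mul_of_nonneg_left ?_ (by positivity)
        refine (norm_sum_le _ _).trans (Finset.sum_le_sum fun i _ => ?_)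
        have hB := hU.B_nonneg hA i
        have hL := lipConst_nonneg (D := D) hB
        have hP := hA.prob_P i
        have hQ := hA.prob_Q i
        have hy := norm_ystar_sub_le hA hU hlam i x x'
        have hz := norm_zmap_sub_le hB hlam (zBounds_mean hA hU i hx (hA.ystar_le i x hx))
          (zBounds_mean hA hU i hx' (hA.ystar_le i x' hx'))
        refine hz.trans ?_
        have h1 := (oracle_fx hA hU i).lip_mean.norm_le_add hL x x' (pb.ystar i x) (pb.ystar i x')
        have h2 := (oracle_fy hA hU i).lip_mean.norm_le_add hL x x' (pb.ystar i x) (pb.ystar i x')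
        have h3 := (oracle_gxy hA hU i).lip_mean.norm_le_add hL x x' (pb.ystar i x) (pb.ystar i x')
        have h4 := (oracle_gyy hA hU i).lip_mean.norm_le_add hL x x' (pb.ystar i x) (pb.ystar i x')
        have h5 : lipConst B D * (‖x - x'‖ + ‖pb.ystar i x - pb.ystar i x'‖)
            ≤ lipConst B D * ((1 + B / lam) * ‖x - x'‖) := by gcongr; linarith
        have hz1 : 0 ≤ zLip B lam := zero_le_one.trans (zLip_ge_one hB hlam)
        rw [hK, show 4 * zLip B lam * lipConst B D * (1 + B / lam) * ‖x - x'‖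
          = zLip B lam * (4 * (lipConst B D * ((1 + B / lam) * ‖x - x'‖))) by ring]
        gcongr
        linarith
    _ = K := by simp; field_simp

end Hypergradient

end Bilevel

namespace Bilevel

/-! ### Measurability of functions of the state. -/

section StateMeasurability

variable {m d : ℕ} {e : Fin m → ℕ}

theorem State.measurable_toProd : Measurable (State.toProd : State m d e → _) :=
  comap_measurable _

theorem State.measurable_xprev : Measurable (State.xprev : State m d e → Vec d) :=
  State.measurable_toProd.fst

theorem State.measurable_yprev (k : Fin m) : Measurable fun s : State m d e => s.yprev k :=
  (measurable_pi_apply k).comp State.measurable_toProd.snd.fst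

theorem State.measurable_x : Measurable (State.x : State m d e → Vec d) :=
  State.measurable_toProd.snd.snd.fst

theorem State.measurable_y (k : Fin m) : Measurable fun s : State m d e => s.y k :=
  (measurable_pi_apply k).comp State.measurable_toProd.snd.snd.snd.fst

theorem State.measurable_u (k : Fin m) : Measurable fun s : State m d e => s.u k :=
  (measurable_pi_apply k).comp State.measurable_toProd.snd.snd.snd.snd.fst

theorem State.measurable_v (k : Fin m) : Measurable fun s : State m d e => s.v k :=
  (measurable_pi_apply k).comp State.measurable_toProd.snd.snd.snd.snd.snd.fst

theorem State.measurable_V (k : Fin m) : Measurable fun s : State m d e => s.V k :=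
  (measurable_pi_apply k).comp State.measurable_toProd.snd.snd.snd.snd.snd.snd.fst

theorem State.measurable_H (k : Fin m) : Measurable fun s : State m d e => s.H k :=
  (measurable_pi_apply k).comp State.measurable_toProd.snd.snd.snd.snd.snd.snd.snd.fst

theorem State.measurable_w (k : Fin m) : Measurable fun s : State m d e => s.w k :=
  (measurable_pi_apply k).comp State.measurable_toProd.snd.snd.snd.snd.snd.snd.snd.snd.fst

theorem State.measurable_d : Measurable (State.d : State m d e → Vec d) :=
  State.measurable_toProd.snd.snd.snd.snd.snd.snd.snd.snd.snd

theorem State.measurable_mk {α : Type*} [MeasurableSpace α] {f : α → State m d e}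
    (hxp : Measurable fun a => (f a).xprev) (hyp : ∀ k, Measurable fun a => (f a).yprev k)
    (hx : Measurable fun a => (f a).x) (hy : ∀ k, Measurable fun a => (f a).y k)
    (hu : ∀ k, Measurable fun a => (f a).u k) (hv : ∀ k, Measurable fun a => (f a).v k)
    (hV : ∀ k, Measurable fun a => (f a).V k) (hH : ∀ k, Measurable fun a => (f a).H k)
    (hw : ∀ k, Measurable fun a => (f a).w k) (hd : Measurable fun a => (f a).d) :
    Measurable f :=
  measurable_comap_iff.2 <| hxp.prodMk <| (measurable_pi_lambda _ hyp).prodMk <| hx.prodMk <|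
    (measurable_pi_lambda _ hy).prodMk <| (measurable_pi_lambda _ hu).prodMk <|
    (measurable_pi_lambda _ hv).prodMk <| (measurable_pi_lambda _ hV).prodMk <|
    (measurable_pi_lambda _ hH).prodMk <| (measurable_pi_lambda _ hw).prodMk hd

theorem State.measurable_restart : Measurable (State.restart : State m d e → State m d e) :=
  State.measurable_mk State.measurable_x State.measurable_y State.measurable_x State.measurable_y
    State.measurable_u State.measurable_v State.measurable_V State.measurable_H State.measurable_w
    State.measurable_d

theorem measurable_matVec {α : Type*} [MeasurableSpace α] {a b : ℕ}
    {A : α → Matrix (Fin a) (Fin b) ℝ} {v : α → Vec b} (hA : ∀ i j, Measurable fun s => A s i j)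
    (hv : Measurable v) : Measurable fun s => matVec (A s) (v s) :=
  measurable_euclidean fun i => by
    simp only [matVec_apply]
    exact Finset.measurable_sum _ fun j _ => (hA i j).mul (by fun_prop)

/-- The inverse is the adjugate divided by the determinant, both continuous; on singular matrices
the convention 0⁻¹ = 0 keeps the formula measurable. -/
theorem measurable_inv_toMatrix {α : Type*} [MeasurableSpace α] {b : ℕ} {H : α → Mat b b}
    (hH : Measurable H) (i j : Fin b) : Measurable fun s => (toMatrix (H s))⁻¹ i j := by
  have h1 : Continuous fun A : Mat b b => (toMatrix A).det := by
    refine Continuous.matrix_det (continuous_matrix fun i j => ?_)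
    simp only [toMatrix, Matrix.of_apply]
    fun_prop
  have h2 : Continuous fun A : Mat b b => (toMatrix A).adjugate i j := by
    have : Continuous fun A : Mat b b => (toMatrix A).adjugate := by
      refine Continuous.matrix_adjugate (continuous_matrix fun i j => ?_)
      simp only [toMatrix, Matrix.of_apply]
      fun_prop
    exact this.matrix_elem i j
  simp only [Matrix.inv_def, Ring.inverse_eq_inv', Matrix.smul_apply, smul_eq_mul]
  exact (h1.measurable.comp hH).inv.mul (h2.measurable.comp hH)

theorem State.measurable_z (k : Fin m) : Measurable fun s : State m d e => s.z k := by
  unfold State.z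
  refine (State.measurable_u k).sub (measurable_matVec (fun i j => ?_) (measurable_matVec (fun i j =>
    measurable_inv_toMatrix (State.measurable_H k) i j) (State.measurable_v k)))
  have := State.measurable_V (d := d) (e := e) k
  simp only [toMatrix, Matrix.of_apply]
  fun_prop

end StateMeasurability

/-! ### Measurability of the oracles along random points. -/

section OracleMeasurability

variable {a b : ℕ} {Ω : Type*} [MeasurableSpace Ω] {E : Type*} [NormedAddCommGroup E]
  [NormedSpace ℝ E] [MeasurableSpace E] [BorelSpace E]
  {M : Measure Ω} {h : Vec a → Vec b → Ω → E} {hb : Vec a → Vec b → E}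
  {X : Set (Vec a)} {R Λ σ : ℝ}

/-- The oracle is continuous in (x, y) and measurable in ω, hence jointly measurable. -/
theorem Oracle.measurable_comp (ho : Oracle M h hb X R Λ σ) {α : Type*} [MeasurableSpace α]
    {fx : α → Vec a} {fy : α → Vec b} {fω : α → Ω} (hx : Measurable fx) (hy : Measurable fy)
    (hω : Measurable fω) : Measurable fun s => h (fx s) (fy s) (fω s) := by
  have h1 : Measurable (Function.uncurry fun (q : Vec a × Vec b) (ω : Ω) => h q.1 q.2 ω) :=
    measurable_uncurry_of_continuous_of_measurable (fun ω => (ho.lip ω).continuous)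
      fun q => ho.meas q.1 q.2
  exact h1.comp ((hx.prodMk hy).prodMk hω)

theorem measurable_storm [SecondCountableTopology E] {α : Type*} [MeasurableSpace α] (β p : ℝ) {f f₀ f₁ : α → E}
    (hf : Measurable f) (hf₀ : Measurable f₀) (hf₁ : Measurable f₁) :
    Measurable fun s => storm β p (f s) (f₀ s) (f₁ s) := by
  unfold storm
  exact ((hf.sub (hf₀.const_smul _)).const_smul _).add (hf₁.const_smul _)

end OracleMeasurability

/-! ### One iteration: measurability and invariance of feasibility. -/

section Step

variable {m d : ℕ} {e : Fin m → ℕ} {Ξ Z : Type*} [MeasurableSpace Ξ] [MeasurableSpace Z]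
  {pb : Problem m d e Ξ Z} {X : Set (Vec d)} {lam B κ : ℝ} {D : ℕ}

section Unfold

variable (pb) (θ : Params) (s : State m d e) (i j : Fin m) (ξ : Ξ) (ζ : Z)

theorem step_u (k : Fin m) : (step pb θ s i j ξ ζ).u k =
    if k = i then proj (Metric.closedBall 0 (pb.Cfx k))
      (storm θ.βfx (pb.p k) (s.u k) (gradX (fun x y => pb.f k x y ξ) s.xprev (s.yprev k))
        (gradX (fun x y => pb.f k x y ξ) s.x (s.y k)))
    else (1 - θ.βfx) • s.u k := rfl

theorem step_v (k : Fin m) : (step pb θ s i j ξ ζ).v k =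
    if k = i then proj (Metric.closedBall 0 (pb.Cfy k))
      (storm θ.βfy (pb.p k) (s.v k) (gradY (fun x y => pb.f k x y ξ) s.xprev (s.yprev k))
        (gradY (fun x y => pb.f k x y ξ) s.x (s.y k)))
    else (1 - θ.βfy) • s.v k := rfl

theorem step_V (k : Fin m) : (step pb θ s i j ξ ζ).V k =
    if k = i then proj (specBall d (e k) (pb.Cgxy k))
      (storm θ.βgxy (pb.p k) (s.V k) (hessXY (fun x y => pb.g k x y ζ) s.xprev (s.yprev k))
        (hessXY (fun x y => pb.g k x y ζ) s.x (s.y k)))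
    else (1 - θ.βgxy) • s.V k := rfl

theorem step_H (k : Fin m) : (step pb θ s i j ξ ζ).H k =
    if k = i then proj (psdAbove (e k) pb.lam)
      (storm θ.βgyy (pb.p k) (s.H k) (hessYY (fun x y => pb.g k x y ζ) s.xprev (s.yprev k))
        (hessYY (fun x y => pb.g k x y ζ) s.x (s.y k)))
    else proj (psdAbove (e k) pb.lam) ((1 - θ.βgyy) • s.H k) := rfl

theorem step_w (k : Fin m) : (step pb θ s i j ξ ζ).w k =
    if k = i then
      storm θ.βgy (pb.p k) (s.w k) (gradY (fun x y => pb.g k x y ζ) s.xprev (s.yprev k))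
        (gradY (fun x y => pb.g k x y ζ) s.x (s.y k))
    else (1 - θ.βgy) • s.w k := rfl

theorem step_d : (step pb θ s i j ξ ζ).d
    = (1 - θ.βd) • (s.d - s.z j) + (step pb θ s i j ξ ζ).z j := rfl

theorem step_x : (step pb θ s i j ξ ζ).x = s.x - (θ.η * θ.γ) • (step pb θ s i j ξ ζ).d := rfl

theorem step_y (k : Fin m) : (step pb θ s i j ξ ζ).y k = (1 - θ.η) • s.y k +
    θ.η • proj (Metric.closedBall 0 (pb.R k)) (s.y k - θ.τ • (step pb θ s i j ξ ζ).w k) := rfl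

end Unfold

theorem closedBall_props {n : ℕ} {C : ℝ} (hC : 0 ≤ C) :
    (Metric.closedBall (0 : Vec n) C).Nonempty ∧ IsClosed (Metric.closedBall (0 : Vec n) C) ∧
      Convex ℝ (Metric.closedBall (0 : Vec n) C) :=
  ⟨⟨0, by simpa using hC⟩, Metric.isClosed_closedBall, convex_closedBall _ _⟩

theorem measurable_proj_closedBall {n : ℕ} {C : ℝ} (hC : 0 ≤ C) :
    Measurable (proj (Metric.closedBall (0 : Vec n) C)) :=
  (continuous_proj (closedBall_props hC).1 (closedBall_props hC).2.1
    (closedBall_props hC).2.2).measurable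

set_option maxHeartbeats 1000000 in
theorem measurable_step (hA : Assumptions pb X) (hU : UniformBounds pb lam B κ D) (θ : Params)
    (i j : Fin m) :
    Measurable fun q : State m d e × (Ξ × Z) => step pb θ q.1 i j q.2.1 q.2.2 := by
  have hx : Measurable fun q : State m d e × (Ξ × Z) => q.1.x :=
    State.measurable_x.comp measurable_fst
  have hxp : Measurable fun q : State m d e × (Ξ × Z) => q.1.xprev :=
    State.measurable_xprev.comp measurable_fst
  have hy : ∀ k, Measurable fun q : State m d e × (Ξ × Z) => q.1.y k :=
    fun k => (State.measurable_y k).comp measurable_fst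
  have hyp : ∀ k, Measurable fun q : State m d e × (Ξ × Z) => q.1.yprev k :=
    fun k => (State.measurable_yprev k).comp measurable_fst
  have hξ : Measurable fun q : State m d e × (Ξ × Z) => q.2.1 := measurable_fst.comp measurable_snd
  have hζ : Measurable fun q : State m d e × (Ξ × Z) => q.2.2 := measurable_snd.comp measurable_snd
  have hu : ∀ k, Measurable fun q : State m d e × (Ξ × Z) => (step pb θ q.1 i j q.2.1 q.2.2).u k := by
    intro k
    have h0 : Measurable fun q : State m d e × (Ξ × Z) => q.1.u k :=
      (State.measurable_u k).comp measurable_fst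
    simp only [step_u]
    split_ifs
    · exact (measurable_proj_closedBall (hA.const_nonneg k).1).comp (measurable_storm _ _ h0
        ((oracle_fx hA hU k).measurable_comp hxp (hyp k) hξ)
        ((oracle_fx hA hU k).measurable_comp hx (hy k) hξ))
    · exact h0.const_smul (1 - θ.βfx)
  have hv : ∀ k, Measurable fun q : State m d e × (Ξ × Z) => (step pb θ q.1 i j q.2.1 q.2.2).v k := by
    intro k
    have h0 : Measurable fun q : State m d e × (Ξ × Z) => q.1.v k :=
      (State.measurable_v k).comp measurable_fst
    simp only [step_v]
    split_ifs
    · exact (measurable_proj_closedBall (hA.const_nonneg k).2.1).comp (measurable_storm _ _ h0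
        ((oracle_fy hA hU k).measurable_comp hxp (hyp k) hξ)
        ((oracle_fy hA hU k).measurable_comp hx (hy k) hξ))
    · exact h0.const_smul (1 - θ.βfy)
  have hV : ∀ k, Measurable fun q : State m d e × (Ξ × Z) => (step pb θ q.1 i j q.2.1 q.2.2).V k := by
    intro k
    have h0 : Measurable fun q : State m d e × (Ξ × Z) => q.1.V k :=
      (State.measurable_V k).comp measurable_fst
    simp only [step_V]
    split_ifs
    · exact (continuous_proj ⟨0, zero_mem_specBall (hA.const_nonneg k).2.2.2.1⟩
        (isClosed_specBall _) (convex_specBall _)).measurable.comp (measurable_storm _ _ h0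
        ((oracle_gxy hA hU k).measurable_comp hxp (hyp k) hζ)
        ((oracle_gxy hA hU k).measurable_comp hx (hy k) hζ))
    · exact h0.const_smul (1 - θ.βgxy)
  have hH : ∀ k, Measurable fun q : State m d e × (Ξ × Z) => (step pb θ q.1 i j q.2.1 q.2.2).H k := by
    intro k
    have h0 : Measurable fun q : State m d e × (Ξ × Z) => q.1.H k :=
      (State.measurable_H k).comp measurable_fst
    simp only [step_H]
    have hp := (continuous_proj (nonempty_psdAbove (b := e k) pb.lam)
        (isClosed_psdAbove _) (convex_psdAbove _)).measurable
    split_ifs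
    · exact hp.comp (measurable_storm _ _ h0
        ((oracle_gyy hA hU k).measurable_comp hxp (hyp k) hζ)
        ((oracle_gyy hA hU k).measurable_comp hx (hy k) hζ))
    · exact hp.comp (h0.const_smul (1 - θ.βgyy))
  have hw : ∀ k, Measurable fun q : State m d e × (Ξ × Z) => (step pb θ q.1 i j q.2.1 q.2.2).w k := by
    intro k
    have h0 : Measurable fun q : State m d e × (Ξ × Z) => q.1.w k :=
      (State.measurable_w k).comp measurable_fst
    simp only [step_w]
    split_ifs
    · exact measurable_storm _ _ h0
        ((oracle_gy hA hU k).measurable_comp hxp (hyp k) hζ)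
        ((oracle_gy hA hU k).measurable_comp hx (hy k) hζ)
    · exact h0.const_smul (1 - θ.βgy)
  have hz : Measurable fun q : State m d e × (Ξ × Z) => (step pb θ q.1 i j q.2.1 q.2.2).z j := by
    unfold State.z
    refine (hu j).sub (measurable_matVec (fun r c => ?_) (measurable_matVec (fun r c =>
      measurable_inv_toMatrix (hH j) r c) (hv j)))
    have := hV j
    simp only [toMatrix, Matrix.of_apply]
    exact (measurable_pi_apply (r, c)).comp ((WithLp.measurable_ofLp 2 _).comp this)
  have hd : Measurable fun q : State m d e × (Ξ × Z) => (step pb θ q.1 i j q.2.1 q.2.2).d := by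
    simp only [step_d]
    have h1 : Measurable fun q : State m d e × (Ξ × Z) => q.1.d - q.1.z j :=
      (State.measurable_d.comp measurable_fst).sub ((State.measurable_z j).comp measurable_fst)
    exact (h1.const_smul (1 - θ.βd)).add hz
  refine State.measurable_mk hx hy ?_ (fun k => ?_) hu hv hV hH hw hd
  · simp only [step_x]
    exact hx.sub (hd.const_smul (θ.η * θ.γ))
  · simp only [step_y]
    have h1 : Measurable fun q : State m d e × (Ξ × Z) =>
        q.1.y k - θ.τ • (step pb θ q.1 i j q.2.1 q.2.2).w k := (hy k).sub ((hw k).const_smul θ.τ)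
    have h2 : Measurable fun q : State m d e × (Ξ × Z) => proj (Metric.closedBall 0 (pb.R k))
        (q.1.y k - θ.τ • (step pb θ q.1 i j q.2.1 q.2.2).w k) :=
      (measurable_proj_closedBall (hA.const_nonneg k).2.2.2.2.2.2.2.2.2.2).comp h1
    exact ((hy k).const_smul (1 - θ.η)).add (h2.const_smul θ.η)

theorem measurableSet_feasible (pb : Problem m d e Ξ Z) : MeasurableSet {s | Feasible pb s} := by
  have : {s | Feasible pb s} = ⋂ i, ({s : State m d e | ‖s.y i‖ ≤ pb.R i} ∩
      ({s | ‖s.u i‖ ≤ pb.Cfx i} ∩ ({s | ‖s.v i‖ ≤ pb.Cfy i} ∩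
      ({s | s.V i ∈ specBall d (e i) (pb.Cgxy i)} ∩ {s | s.H i ∈ psdAbove (e i) pb.lam})))) := by
    ext s; simp [Feasible]
  rw [this]
  refine MeasurableSet.iInter fun i => ?_
  refine (measurableSet_le (State.measurable_y i).norm measurable_const).inter <|
    (measurableSet_le (State.measurable_u i).norm measurable_const).inter <|
    (measurableSet_le (State.measurable_v i).norm measurable_const).inter <|
    ((isClosed_specBall _).measurableSet.preimage (State.measurable_V i)).inter
    ((isClosed_psdAbove _).measurableSet.preimage (State.measurable_H i))

theorem Feasible.step (hA : Assumptions pb X) {θ : Params} (hη : 0 ≤ θ.η ∧ θ.η ≤ 1)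
    (hfx : 0 ≤ θ.βfx ∧ θ.βfx ≤ 1) (hfy : 0 ≤ θ.βfy ∧ θ.βfy ≤ 1)
    (hgxy : 0 ≤ θ.βgxy ∧ θ.βgxy ≤ 1) {s : State m d e} (hs : Feasible pb s)
    (i j : Fin m) (ξ : Ξ) (ζ : Z) : Feasible pb (step pb θ s i j ξ ζ) := by
  intro k
  obtain ⟨hy, hu, hv, hV, hH⟩ := hs k
  have hball : ∀ {n : ℕ} {C : ℝ} (_ : 0 ≤ C) (x : Vec n), ‖proj (Metric.closedBall 0 C) x‖ ≤ C :=
    fun hC x => by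
      simpa using proj_mem (closedBall_props hC).1 (closedBall_props hC).2.1
        (closedBall_props hC).2.2 x
  have hshrink : ∀ {n : ℕ} {C β : ℝ} (_ : 0 ≤ β ∧ β ≤ 1) {x : Vec n} (_ : ‖x‖ ≤ C),
      ‖(1 - β) • x‖ ≤ C := fun hβ x hx => by
    rw [norm_smul, Real.norm_of_nonneg (by linarith)]
    nlinarith [norm_nonneg x]
  refine ⟨?_, ?_, ?_, ?_, ?_⟩
  · have hR := (hA.const_nonneg k).2.2.2.2.2.2.2.2.2.2
    rw [step_y]
    refine (norm_add_le _ _).trans ?_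
    rw [norm_smul, norm_smul, Real.norm_of_nonneg (by linarith), Real.norm_of_nonneg hη.1]
    have := hball hR (s.y k - θ.τ • (Bilevel.step pb θ s i j ξ ζ).w k)
    nlinarith
  · rw [step_u]; split_ifs
    · exact hball (hA.const_nonneg k).1 _
    · exact hshrink hfx hu
  · rw [step_v]; split_ifs
    · exact hball (hA.const_nonneg k).2.1 _
    · exact hshrink hfy hv
  · rw [step_V]; split_ifs
    · exact proj_mem ⟨0, zero_mem_specBall (hA.const_nonneg k).2.2.2.1⟩
        (isClosed_specBall _) (convex_specBall _) _
    · refine (specNorm_smul_le _ _).trans ?_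
      rw [abs_of_nonneg (by linarith)]
      have hV' : specNorm (s.V k) ≤ pb.Cgxy k := hV
      nlinarith [specNorm_nonneg (s.V k)]
  -- Shrinking by 1 − β may leave {A ⪰ λI}, unlike the balls around 0; the projection is therefore
  -- present in both branches.
  · rw [step_H]; split_ifs
    · exact proj_mem (nonempty_psdAbove _) (isClosed_psdAbove _) (convex_psdAbove _) _
    · exact proj_mem (nonempty_psdAbove _) (isClosed_psdAbove _) (convex_psdAbove _) _

theorem Feasible.zBounds (hU : UniformBounds pb lam B κ D)
    {s : State m d e} (hs : Feasible pb s) (k : Fin m) :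
    ZBounds B lam (s.u k) (s.v k) (s.V k) (s.H k) := by
  obtain ⟨-, hu, hv, hV, hH⟩ := hs k
  exact ⟨hu.trans (hU.const_le k).1, hv.trans (hU.const_le k).2.1,
    le_trans hV (hU.const_le k).2.2.2.1, psdAbove_mono hU.lam_le hH⟩

end Step

end Bilevel

namespace Bilevel

/-! ### Bounds for averages over the sampled task and its data. -/

section AvgLE

variable {m : ℕ} {Ω : Type*} [MeasurableSpace Ω] {p : Fin m → ℝ} {M : Fin m → Measure Ω}

/-- When `i` is drawn from `p` and then `ω` from `M i`, the expectation of `φ i ω` exists and is at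
most `c`. -/
def AvgLE (p : Fin m → ℝ) (M : Fin m → Measure Ω) (φ : Fin m → Ω → ℝ) (c : ℝ) : Prop :=
  (∀ i, Integrable (φ i) (M i)) ∧ ∑ i, p i * ∫ ω, φ i ω ∂(M i) ≤ c

theorem AvgLE.mono {φ : Fin m → Ω → ℝ} {c c' : ℝ} (h : AvgLE p M φ c) (hc : c ≤ c') :
    AvgLE p M φ c' := ⟨h.1, h.2.trans hc⟩

theorem AvgLE.add {φ ψ : Fin m → Ω → ℝ} {c c' : ℝ} (h : AvgLE p M φ c) (h' : AvgLE p M ψ c') :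
    AvgLE p M (fun i ω => φ i ω + ψ i ω) (c + c') := by
  refine ⟨fun i => (h.1 i).add (h'.1 i), ?_⟩
  simp only [fun i => integral_add (h.1 i) (h'.1 i), mul_add, Finset.sum_add_distrib]
  exact add_le_add h.2 h'.2

theorem AvgLE.const_mul {φ : Fin m → Ω → ℝ} {c : ℝ} (h : AvgLE p M φ c) {a : ℝ} (ha : 0 ≤ a) :
    AvgLE p M (fun i ω => a * φ i ω) (a * c) := by
  refine ⟨fun i => (h.1 i).const_mul a, ?_⟩
  simp only [integral_const_mul, mul_left_comm _ a, ← Finset.mul_sum]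
  exact mul_le_mul_of_nonneg_left h.2 ha

theorem AvgLE.const [∀ i, IsProbabilityMeasure (M i)] (hp : ∑ i, p i = 1) (c : ℝ) :
    AvgLE p M (fun _ _ => c) c := by
  refine ⟨fun i => integrable_const c, ?_⟩
  simp only [integral_const, probReal_univ, one_smul, ← Finset.sum_mul, hp, one_mul, le_refl]

theorem AvgLE.sum {ι : Type*} (s : Finset ι) {φ : ι → Fin m → Ω → ℝ} {c : ι → ℝ}
    (h : ∀ k ∈ s, AvgLE p M (φ k) (c k)) :
    AvgLE p M (fun i ω => ∑ k ∈ s, φ k i ω) (∑ k ∈ s, c k) := by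
  refine ⟨fun i => integrable_finsetSum s fun k hk => (h k hk).1 i, ?_⟩
  simp only [fun i => integral_finsetSum s fun k hk => (h k hk).1 i, Finset.mul_sum]
  rw [Finset.sum_comm]
  exact Finset.sum_le_sum fun k hk => (h k hk).2

theorem AvgLE.of_le (hp : ∀ i, 0 ≤ p i) {φ ψ : Fin m → Ω → ℝ} {c : ℝ} (h : AvgLE p M ψ c)
    (hm : ∀ i, Measurable (φ i)) (h0 : ∀ i ω, 0 ≤ φ i ω) (hle : ∀ i ω, φ i ω ≤ ψ i ω) :
    AvgLE p M φ c := by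
  have hi : ∀ i, Integrable (φ i) (M i) := fun i =>
    (h.1 i).mono' (hm i).aestronglyMeasurable (Filter.Eventually.of_forall fun ω => by
      rw [Real.norm_of_nonneg (h0 i ω)]; exact hle i ω)
  refine ⟨hi, (Finset.sum_le_sum fun i _ => ?_).trans h.2⟩
  exact mul_le_mul_of_nonneg_left (integral_mono (hi i) (h.1 i) (hle i)) (hp i)

end AvgLE

/-! ### The recursion for a single estimator. -/

section Storm

variable {m : ℕ} {Ω : Type*} [MeasurableSpace Ω] {E : Type*} [NormedAddCommGroup E]
  [InnerProductSpace ℝ E] [CompleteSpace E] [MeasurableSpace E] [BorelSpace E]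
  [SecondCountableTopology E]

omit [MeasurableSpace E] [BorelSpace E] [SecondCountableTopology E] in
theorem integral_norm_sq_add_smul {M : Measure Ω} [IsProbabilityMeasure M] {N : Ω → E}
    (hN : Integrable N M) (hN2 : Integrable (fun ω => ‖N ω‖ ^ 2) M) (e : E) (c : ℝ) :
    Integrable (fun ω => ‖e + c • N ω‖ ^ 2) M ∧
    ∫ ω, ‖e + c • N ω‖ ^ 2 ∂M
      = ‖e‖ ^ 2 + 2 * c * inner ℝ e (∫ ω, N ω ∂M) + c ^ 2 * ∫ ω, ‖N ω‖ ^ 2 ∂M := by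
  have hfun : (fun ω => ‖e + c • N ω‖ ^ 2)
      = fun ω => ‖e‖ ^ 2 + 2 * c * inner ℝ e (N ω) + c ^ 2 * ‖N ω‖ ^ 2 := by
    funext ω
    rw [norm_add_sq_real, inner_smul_right, norm_smul, mul_pow, Real.norm_eq_abs, sq_abs]
    ring
  have h1 : Integrable (fun ω => 2 * c * inner ℝ e (N ω)) M := (hN.const_inner e).const_mul _
  have h2 : Integrable (fun ω => c ^ 2 * ‖N ω‖ ^ 2) M := hN2.const_mul _
  have h0 : Integrable (fun _ : Ω => ‖e‖ ^ 2) M := integrable_const _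
  rw [hfun]
  refine ⟨(h0.add h1).add h2, ?_⟩
  have e1 : ∫ ω, (‖e‖ ^ 2 + 2 * c * inner ℝ e (N ω) + c ^ 2 * ‖N ω‖ ^ 2) ∂M
      = ∫ ω, (‖e‖ ^ 2 + 2 * c * inner ℝ e (N ω)) ∂M + ∫ ω, c ^ 2 * ‖N ω‖ ^ 2 ∂M :=
    integral_add (h0.add h1) h2
  have e2 : ∫ ω, (‖e‖ ^ 2 + 2 * c * inner ℝ e (N ω)) ∂M
      = ∫ _ω, ‖e‖ ^ 2 ∂M + ∫ ω, 2 * c * inner ℝ e (N ω) ∂M := integral_add h0 h1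
  rw [e1, e2, integral_const_mul, integral_const_mul, integral_inner hN e]
  simp

omit [MeasurableSpace E] [BorelSpace E] [SecondCountableTopology E] in
theorem norm_integral_sq_le {M : Measure Ω} [IsProbabilityMeasure M] {N : Ω → E}
    (hN : Integrable N M) (hN2 : Integrable (fun ω => ‖N ω‖ ^ 2) M) :
    ‖∫ ω, N ω ∂M‖ ^ 2 ≤ ∫ ω, ‖N ω‖ ^ 2 ∂M := by
  have h := (integral_norm_sq_add_smul hN hN2 (-∫ ω, N ω ∂M) 1).2
  have h0 : 0 ≤ ∫ ω, ‖-∫ ω, N ω ∂M + (1 : ℝ) • N ω‖ ^ 2 ∂M := integral_nonneg fun ω => sq_nonneg _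
  rw [h, inner_neg_left, real_inner_self_eq_norm_sq, norm_neg] at h0
  linarith

variable {M : Fin m → Measure Ω} [∀ i, IsProbabilityMeasure (M i)] {p : Fin m → ℝ}

omit [SecondCountableTopology E] in
-- The deviation is e + N/p_k with probability p_k and at most e in norm otherwise. In the mean of
-- the square, the weight p_k cancels 1/p_k in the cross term and leaves one factor 1/p_k in the
-- quadratic term.
theorem avgLE_sampled_update (hp0 : ∀ i, 0 < p i) (hp : ∑ i, p i = 1) (k : Fin m) {N : Ω → E}
    (hN : Integrable N (M k)) (hN2 : Integrable (fun ω => ‖N ω‖ ^ 2) (M k)) (e : E)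
    {φ : Fin m → Ω → E} (hφ : ∀ i, Measurable (φ i))
    (hs : ∀ ω, ‖φ k ω‖ ≤ ‖e + (1 / p k) • N ω‖) (hn : ∀ i, i ≠ k → ∀ ω, ‖φ i ω‖ ≤ ‖e‖) :
    AvgLE p M (fun i ω => ‖φ i ω‖ ^ 2)
      (‖e‖ ^ 2 + 2 * inner ℝ e (∫ ω, N ω ∂(M k)) + (∫ ω, ‖N ω‖ ^ 2 ∂(M k)) / p k) := by
  obtain ⟨hi, he⟩ := integral_norm_sq_add_smul hN hN2 e (1 / p k)
  refine AvgLE.of_le (fun i => (hp0 i).le)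
    (ψ := fun i ω => if i = k then ‖e + (1 / p k) • N ω‖ ^ 2 else ‖e‖ ^ 2) ?_
    (fun i => (hφ i).norm.pow_const 2) (fun i ω => sq_nonneg _) (fun i ω => ?_)
  · refine ⟨fun i => ?_, ?_⟩
    · by_cases hik : i = k
      · subst hik; simpa using hi
      · simp [hik]
    · have hsum : ∀ i, p i * ∫ ω, (if i = k then ‖e + (1 / p k) • N ω‖ ^ 2 else ‖e‖ ^ 2) ∂(M i)
          = p i * ‖e‖ ^ 2 + if i = k then
            p k * (∫ ω, ‖e + (1 / p k) • N ω‖ ^ 2 ∂(M k) - ‖e‖ ^ 2) else 0 := by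
        intro i
        by_cases hik : i = k
        · subst hik; simp only [if_true]; ring
        · simp [hik]
      rw [Finset.sum_congr rfl fun i _ => hsum i, Finset.sum_add_distrib, ← Finset.sum_mul, hp,
        Finset.sum_ite_eq' Finset.univ k, if_pos (Finset.mem_univ k), he]
      have := (hp0 k).ne'
      refine le_of_eq ?_
      field_simp
      ring
  · by_cases hik : i = k
    · subst hik; simpa using pow_le_pow_left₀ (norm_nonneg _) (hs ω) 2
    · simpa [hik] using pow_le_pow_left₀ (norm_nonneg _) (hn i hik ω) 2

theorem p_le_one (hp0 : ∀ i, 0 < p i) (hp : ∑ i, p i = 1) (k : Fin m) : p k ≤ 1 := by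
  rw [← hp]; exact Finset.single_le_sum (fun i _ => (hp0 i).le) (Finset.mem_univ k)

variable {a b : ℕ} {h : Vec a → Vec b → Ω → E} {hb : Vec a → Vec b → E}
  {X : Set (Vec a)} {R Λ σ β : ℝ}

omit [CompleteSpace E] in
-- The previous point enters only through a difference, which is controlled by the Lipschitz
-- property; the moment bound is needed only at the current point, the one known to be in range.
theorem Oracle.innovation {M : Measure Ω} [IsProbabilityMeasure M] (ho : Oracle M h hb X R Λ σ)
    (hβ0 : 0 ≤ β) (hβ1 : β ≤ 1) (x₀ : Vec a) (y₀ : Vec b) {x : Vec a} (hx : x ∈ X) {y : Vec b}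
    (hy : ‖y‖ ≤ R) :
    Integrable (fun ω => (1 - β) • (h x y ω - h x₀ y₀ ω) + β • h x y ω) M ∧
    Integrable (fun ω => ‖(1 - β) • (h x y ω - h x₀ y₀ ω) + β • h x y ω‖ ^ 2) M ∧
    ∫ ω, ((1 - β) • (h x y ω - h x₀ y₀ ω) + β • h x y ω) ∂M
      = (1 - β) • (hb x y - hb x₀ y₀) + β • hb x y ∧
    ∫ ω, ‖(1 - β) • (h x y ω - h x₀ y₀ ω) + β • h x y ω‖ ^ 2 ∂M
      ≤ 2 * Λ ^ 2 * (‖x - x₀‖ ^ 2 + ‖y - y₀‖ ^ 2) + 2 * β ^ 2 * σ ^ 2 := by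
  have i1 : Integrable (fun ω => (1 - β) • (h x y ω - h x₀ y₀ ω)) M :=
    ((ho.int x y).sub (ho.int x₀ y₀)).smul _
  have i2 : Integrable (fun ω => β • h x y ω) M := (ho.int x y).smul _
  have hle : ∀ ω, ‖(1 - β) • (h x y ω - h x₀ y₀ ω) + β • h x y ω‖ ^ 2
      ≤ 2 * Λ ^ 2 * (‖x - x₀‖ ^ 2 + ‖y - y₀‖ ^ 2) + 2 * β ^ 2 * ‖h x y ω‖ ^ 2 := fun ω => by
    have h1 := (ho.lip ω).norm_sq_le x x₀ y y₀
    have h2 : ‖(1 - β) • (h x y ω - h x₀ y₀ ω)‖ ≤ ‖h x y ω - h x₀ y₀ ω‖ := by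
      rw [norm_smul, Real.norm_of_nonneg (by linarith)]
      exact mul_le_of_le_one_left (norm_nonneg _) (by linarith)
    have h3 : ‖β • h x y ω‖ = β * ‖h x y ω‖ := by rw [norm_smul, Real.norm_of_nonneg hβ0]
    have h4 := pow_le_pow_left₀ (norm_nonneg _) (norm_add_le ((1 - β) • (h x y ω - h x₀ y₀ ω))
      (β • h x y ω)) 2
    have h5 := pow_le_pow_left₀ (norm_nonneg _) h2 2
    rw [h3] at h4
    nlinarith [sq_nonneg (‖(1 - β) • (h x y ω - h x₀ y₀ ω)‖ - β * ‖h x y ω‖)]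
  obtain ⟨m1, m2⟩ := ho.mom x hx y hy
  have i3 : Integrable (fun ω => 2 * Λ ^ 2 * (‖x - x₀‖ ^ 2 + ‖y - y₀‖ ^ 2)
      + 2 * β ^ 2 * ‖h x y ω‖ ^ 2) M := (integrable_const _).add (m1.const_mul _)
  have i4 : Integrable (fun ω => ‖(1 - β) • (h x y ω - h x₀ y₀ ω) + β • h x y ω‖ ^ 2) M := by
    refine i3.mono' ?_ (Filter.Eventually.of_forall fun ω => ?_)
    · have k1 := ho.meas x y
      have k2 := ho.meas x₀ y₀
      exact (((k1.sub k2).const_smul (1 - β)).add (k1.const_smul β)).norm.pow_const 2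
        |>.aestronglyMeasurable
    · rw [Real.norm_of_nonneg (sq_nonneg _)]; exact hle ω
  refine ⟨i1.add i2, i4, ?_, ?_⟩
  · rw [integral_add i1 i2, integral_smul, integral_smul,
      integral_sub (ho.int x y) (ho.int x₀ y₀), ho.mean, ho.mean]
  · refine (integral_mono i4 i3 hle).trans ?_
    rw [integral_add (integrable_const _) (m1.const_mul _)]
    simp only [integral_const, probReal_univ, one_smul]
    rw [integral_const_mul]
    have : 2 * β ^ 2 * ∫ ω, ‖h x y ω‖ ^ 2 ∂M ≤ 2 * β ^ 2 * σ ^ 2 :=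
      mul_le_mul_of_nonneg_left m2 (by positivity)
    linarith

omit [CompleteSpace E] [MeasurableSpace E] [BorelSpace E] [SecondCountableTopology E] in
theorem storm_eq (β q : ℝ) (u h₀ h₁ c : E) :
    storm β q u h₀ h₁ - c = ((1 - β) • u - c) + (1 / q) • ((1 - β) • (h₁ - h₀) + β • h₁) := by
  unfold storm
  module

variable (hp0 : ∀ i, 0 < p i) (hp : ∑ i, p i = 1) (k : Fin m) (ho : Oracle (M k) h hb X R Λ σ)
  (hβ0 : 0 ≤ β) (hβ1 : β ≤ 1) (x₀ : Vec a) (y₀ : Vec b) {x : Vec a} (hx : x ∈ X) {y : Vec b}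
  (hy : ‖y‖ ≤ R) (u : E) {u' : Fin m → Ω → E} (hu' : ∀ i, Measurable (u' i))
include hp0 hp ho hβ0 hβ1 hx hy hu'

/-- Let n be the mean innovation and e = (1−β)(u − old mean) − n the deviation before the
correction. Then ‖e‖² + 2⟨e, n⟩ = (1−β)²‖u − old mean‖² − ‖n‖², so the bias cancels exactly and only
the second moment of the innovation remains. -/
theorem Oracle.avgLE_error
    (hs : ∀ ω, ‖u' k ω - hb x y‖ ≤ ‖storm β (p k) u (h x₀ y₀ ω) (h x y ω) - hb x y‖)
    (hn : ∀ i, i ≠ k → ∀ ω, ‖u' i ω - hb x y‖ ≤ ‖(1 - β) • u - hb x y‖) :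
    AvgLE p M (fun i ω => ‖u' i ω - hb x y‖ ^ 2) ((1 - β) * ‖u - hb x₀ y₀‖ ^ 2
      + (2 * Λ ^ 2 * (‖x - x₀‖ ^ 2 + ‖y - y₀‖ ^ 2) + 2 * β ^ 2 * σ ^ 2) / p k) := by
  obtain ⟨h1, h2, h3, h4⟩ := ho.innovation hβ0 hβ1 x₀ y₀ hx hy
  refine (avgLE_sampled_update (M := M) hp0 hp k h1 h2 ((1 - β) • u - hb x y)
    (φ := fun i ω => u' i ω - hb x y) (fun i => (hu' i).sub_const _)
    (fun ω => by rw [← storm_eq]; exact hs ω) hn).mono ?_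
  rw [h3]
  set n := (1 - β) • (hb x y - hb x₀ y₀) + β • hb x y with hn
  have e1 : (1 - β) • u - hb x y = (1 - β) • (u - hb x₀ y₀) - n := by rw [hn]; module
  rw [e1, norm_sub_sq_real, inner_sub_left, real_inner_self_eq_norm_sq, norm_smul, mul_pow,
    Real.norm_eq_abs, sq_abs]
  have e2 : (∫ ω, ‖(1 - β) • (h x y ω - h x₀ y₀ ω) + β • h x y ω‖ ^ 2 ∂(M k)) / p k
      ≤ (2 * Λ ^ 2 * (‖x - x₀‖ ^ 2 + ‖y - y₀‖ ^ 2) + 2 * β ^ 2 * σ ^ 2) / p k :=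
    div_le_div_of_nonneg_right h4 (hp0 k).le
  have e3 : (1 - β) ^ 2 * ‖u - hb x₀ y₀‖ ^ 2 ≤ (1 - β) * ‖u - hb x₀ y₀‖ ^ 2 :=
    mul_le_mul_of_nonneg_right (by nlinarith) (sq_nonneg _)
  nlinarith [sq_nonneg ‖n‖]

/-- Here the reference point is the old value u, so the deviation before the correction is −βu. The
cross term is split by Young's inequality, and ‖n‖² is bounded by the second moment and then, as p_k
≤ 1, by that moment over p_k. This bound drives the recursion for d. -/
theorem Oracle.avgLE_movement
    (hs : ∀ ω, ‖u' k ω - u‖ ≤ ‖storm β (p k) u (h x₀ y₀ ω) (h x y ω) - u‖)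
    (hn : ∀ i, i ≠ k → ∀ ω, ‖u' i ω - u‖ ≤ ‖(1 - β) • u - u‖) :
    AvgLE p M (fun i ω => ‖u' i ω - u‖ ^ 2) (2 * β ^ 2 * ‖u‖ ^ 2
      + 2 * ((2 * Λ ^ 2 * (‖x - x₀‖ ^ 2 + ‖y - y₀‖ ^ 2) + 2 * β ^ 2 * σ ^ 2) / p k)) := by
  obtain ⟨h1, h2, -, h4⟩ := ho.innovation hβ0 hβ1 x₀ y₀ hx hy
  refine (avgLE_sampled_update (M := M) hp0 hp k h1 h2 ((1 - β) • u - u)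
    (φ := fun i ω => u' i ω - u) (fun i => (hu' i).sub_const _)
    (fun ω => by rw [← storm_eq]; exact hs ω) hn).mono ?_
  have h5 := norm_integral_sq_le h1 h2
  set N := ∫ ω, ((1 - β) • (h x y ω - h x₀ y₀ ω) + β • h x y ω) ∂(M k)
  set Q := ∫ ω, ‖(1 - β) • (h x y ω - h x₀ y₀ ω) + β • h x y ω‖ ^ 2 ∂(M k)
  set W := 2 * Λ ^ 2 * (‖x - x₀‖ ^ 2 + ‖y - y₀‖ ^ 2) + 2 * β ^ 2 * σ ^ 2
  have e1 : ‖(1 - β) • u - u‖ = β * ‖u‖ := by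
    rw [show (1 - β) • u - u = (-β) • u by module, norm_smul, norm_neg, Real.norm_of_nonneg hβ0]
  have e2 : 2 * inner ℝ ((1 - β) • u - u) N ≤ ‖(1 - β) • u - u‖ ^ 2 + ‖N‖ ^ 2 := by
    have := real_inner_le_norm ((1 - β) • u - u) N
    nlinarith [sq_nonneg (‖(1 - β) • u - u‖ - ‖N‖)]
  have e3 : Q / p k ≤ W / p k := div_le_div_of_nonneg_right h4 (hp0 k).le
  have hW : 0 ≤ W := by positivity
  have e4 : W ≤ W / p k := by
    rw [le_div_iff₀ (hp0 k)]
    exact mul_le_of_le_one_right hW (p_le_one hp0 hp k)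
  rw [e1] at e2 ⊢
  nlinarith

end Storm

/-! ### The recursion for d under uniform sampling of j. -/

section UniformMean

variable {m : ℕ} {E : Type*} [NormedAddCommGroup E] [InnerProductSpace ℝ E]

/-- The same cancellation with n_j = (1−β)(b_j − a_j) + βb_j: the mean of the n_j is exactly the
shift of the target, so the cross term removes the bias. -/
theorem mean_norm_sq_storm_le (hm : 0 < m) {β : ℝ} (hβ0 : 0 ≤ β) (hβ1 : β ≤ 1) (c : E)
    (a b : Fin m → E) :
    (1 / (m : ℝ)) * ∑ j, ‖(1 - β) • (c - a j) + b j - (1 / (m : ℝ)) • ∑ i, b i‖ ^ 2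
      ≤ (1 - β) * ‖c - (1 / (m : ℝ)) • ∑ i, a i‖ ^ 2
        + 2 * ((1 / (m : ℝ)) * ∑ j, ‖b j - a j‖ ^ 2)
        + 2 * β ^ 2 * ((1 / (m : ℝ)) * ∑ j, ‖b j‖ ^ 2) := by
  have hm' : (0 : ℝ) < m := by exact_mod_cast hm
  set n : Fin m → E := fun j => (1 - β) • (b j - a j) + β • b j with hn
  set nb := (1 / (m : ℝ)) • ∑ j, n j with hnb
  set ε := (1 - β) • (c - (1 / (m : ℝ)) • ∑ i, a i) with hε
  have e0 : nb = (1 / (m : ℝ)) • ∑ i, b i - (1 - β) • ((1 / (m : ℝ)) • ∑ i, a i) := by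
    rw [hnb, hn]
    simp only [Finset.sum_add_distrib, ← Finset.smul_sum, Finset.sum_sub_distrib]
    module
  have e1 : ∀ j, (1 - β) • (c - a j) + b j - (1 / (m : ℝ)) • ∑ i, b i = (ε - nb) + n j := by
    intro j; rw [e0, hε, hn]; module
  have e2 : (1 / (m : ℝ)) * ∑ j, ‖(ε - nb) + n j‖ ^ 2
      = ‖ε - nb‖ ^ 2 + 2 * inner ℝ (ε - nb) nb + (1 / (m : ℝ)) * ∑ j, ‖n j‖ ^ 2 := by
    simp only [norm_add_sq_real, Finset.sum_add_distrib, ← Finset.mul_sum, ← inner_sum]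
    rw [hnb, inner_smul_right]
    simp only [Finset.sum_const, Finset.card_univ, Fintype.card_fin, nsmul_eq_mul]
    field_simp
  have e3 : ∀ j, ‖n j‖ ^ 2 ≤ 2 * ‖b j - a j‖ ^ 2 + 2 * β ^ 2 * ‖b j‖ ^ 2 := fun j => by
    have h1 : ‖n j‖ ≤ ‖b j - a j‖ + β * ‖b j‖ := by
      refine (norm_add_le _ _).trans ?_
      rw [norm_smul, norm_smul, Real.norm_of_nonneg (by linarith), Real.norm_of_nonneg hβ0]
      nlinarith [norm_nonneg (b j - a j)]
    have h2 := pow_le_pow_left₀ (norm_nonneg _) h1 2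
    nlinarith [sq_nonneg (‖b j - a j‖ - β * ‖b j‖)]
  have e4 : (1 / (m : ℝ)) * ∑ j, ‖n j‖ ^ 2 ≤ 2 * ((1 / (m : ℝ)) * ∑ j, ‖b j - a j‖ ^ 2)
        + 2 * β ^ 2 * ((1 / (m : ℝ)) * ∑ j, ‖b j‖ ^ 2) := by
    calc _ ≤ (1 / (m : ℝ)) * ∑ j, (2 * ‖b j - a j‖ ^ 2 + 2 * β ^ 2 * ‖b j‖ ^ 2) := by
          gcongr with j; exact e3 j
      _ = _ := by rw [Finset.sum_add_distrib, ← Finset.mul_sum, ← Finset.mul_sum]; ring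
  simp only [e1]
  rw [e2, norm_sub_sq_real, inner_sub_left, real_inner_self_eq_norm_sq]
  have e5 : ‖ε‖ ^ 2 ≤ (1 - β) * ‖c - (1 / (m : ℝ)) • ∑ i, a i‖ ^ 2 := by
    rw [hε, norm_smul, mul_pow, Real.norm_eq_abs, sq_abs]
    exact mul_le_mul_of_nonneg_right (by nlinarith) (sq_nonneg _)
  nlinarith [sq_nonneg ‖nb‖]

theorem norm_mean_sq_le (hm : 0 < m) (b : Fin m → E) :
    ‖(1 / (m : ℝ)) • ∑ i, b i‖ ^ 2 ≤ (1 / (m : ℝ)) * ∑ i, ‖b i‖ ^ 2 := by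
  have hm' : (0 : ℝ) < m := by exact_mod_cast hm
  have h1 : ‖∑ i, b i‖ ^ 2 ≤ m * ∑ i, ‖b i‖ ^ 2 := by
    refine (pow_le_pow_left₀ (norm_nonneg _) (norm_sum_le _ _) 2).trans ?_
    simpa using sq_sum_le_card_mul_sum_sq (s := Finset.univ) (f := fun i => ‖b i‖)
  rw [norm_smul, mul_pow, Real.norm_of_nonneg (by positivity)]
  calc (1 / (m : ℝ)) ^ 2 * ‖∑ i, b i‖ ^ 2 ≤ (1 / (m : ℝ)) ^ 2 * (m * ∑ i, ‖b i‖ ^ 2) := by gcongr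
    _ = _ := by field_simp

end UniformMean

end Bilevel

namespace Bilevel

/-! ### Error functionals. After an iteration the estimators refer to the point before it, hence the
evaluation at the previous point. -/

section Errors

variable {m d : ℕ} {e : Fin m → ℕ} {Ξ Z : Type*} [MeasurableSpace Ξ] [MeasurableSpace Z]

/-- Average squared error of `u` at the previous point. -/
noncomputable def errFx (pb : Problem m d e Ξ Z) (s : State m d e) : ℝ :=
  (1 / (m : ℝ)) * ∑ k, ‖s.u k - gradX (pb.fbar k) s.xprev (s.yprev k)‖ ^ 2

/-- Average squared error of `v` at the previous point. -/
noncomputable def errFy (pb : Problem m d e Ξ Z) (s : State m d e) : ℝ :=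
  (1 / (m : ℝ)) * ∑ k, ‖s.v k - gradY (pb.fbar k) s.xprev (s.yprev k)‖ ^ 2

/-- Average squared error of `V` at the previous point. -/
noncomputable def errGxy (pb : Problem m d e Ξ Z) (s : State m d e) : ℝ :=
  (1 / (m : ℝ)) * ∑ k, ‖s.V k - hessXY (pb.gbar k) s.xprev (s.yprev k)‖ ^ 2

/-- Average squared error of `H` at the previous point. -/
noncomputable def errGyy (pb : Problem m d e Ξ Z) (s : State m d e) : ℝ :=
  (1 / (m : ℝ)) * ∑ k, ‖s.H k - hessYY (pb.gbar k) s.xprev (s.yprev k)‖ ^ 2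

/-- Average squared error of `w` at the previous point. -/
noncomputable def errGy (pb : Problem m d e Ξ Z) (s : State m d e) : ℝ :=
  (1 / (m : ℝ)) * ∑ k, ‖s.w k - gradY (pb.gbar k) s.xprev (s.yprev k)‖ ^ 2

/-- Squared error of `d`. -/
noncomputable def errD (s : State m d e) : ℝ := ‖s.d - (1 / (m : ℝ)) • ∑ k, s.z k‖ ^ 2

/-- Average squared error of the lower variables. -/
noncomputable def errY (pb : Problem m d e Ξ Z) (s : State m d e) : ℝ :=
  (1 / (m : ℝ)) * ∑ k, ‖s.y k - pb.ystar k s.x‖ ^ 2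

/-- Squared length of the last move. -/
noncomputable def drift (s : State m d e) : ℝ :=
  ‖s.x - s.xprev‖ ^ 2 + (1 / (m : ℝ)) * ∑ k, ‖s.y k - s.yprev k‖ ^ 2

/-- Total squared error of the estimators. -/
noncomputable def errEst (pb : Problem m d e Ξ Z) (s : State m d e) : ℝ :=
  errD s + (errFx pb s + errFy pb s + errGxy pb s + errGyy pb s + errGy pb s)

/-- Momentum parameters all equal to `β`. -/
def Params.uniform (η γ τ β : ℝ) : Params := ⟨η, γ, τ, β, β, β, β, β, β⟩

/-- Law of the sampled data of task `i`. -/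
noncomputable def Problem.dataLaw (pb : Problem m d e Ξ Z) (i : Fin m) : Measure (Ξ × Z) :=
  (pb.P i).prod (pb.Q i)

theorem mean_sq_nonneg {α : Fin m → ℝ} : 0 ≤ (1 / (m : ℝ)) * ∑ k, α k ^ 2 :=
  mul_nonneg (by positivity) (Finset.sum_nonneg fun _ _ => sq_nonneg _)

theorem mean_le_of_le (hm : 0 < m) {α : Fin m → ℝ} {c : ℝ} (h : ∀ k, α k ≤ c) :
    (1 / (m : ℝ)) * ∑ k, α k ≤ c := by
  have hm' : (0 : ℝ) < m := by exact_mod_cast hm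
  calc (1 / (m : ℝ)) * ∑ k, α k ≤ (1 / (m : ℝ)) * ∑ _k : Fin m, c := by gcongr with k; exact h k
    _ = c := by simp; field_simp

theorem mean_mono {α α' : Fin m → ℝ} (h : ∀ k, α k ≤ α' k) :
    (1 / (m : ℝ)) * ∑ k, α k ≤ (1 / (m : ℝ)) * ∑ k, α' k := by
  gcongr with k; exact h k

theorem errFx_nonneg (pb : Problem m d e Ξ Z) (s : State m d e) : 0 ≤ errFx pb s := mean_sq_nonneg
theorem errFy_nonneg (pb : Problem m d e Ξ Z) (s : State m d e) : 0 ≤ errFy pb s := mean_sq_nonneg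
theorem errGxy_nonneg (pb : Problem m d e Ξ Z) (s : State m d e) : 0 ≤ errGxy pb s := mean_sq_nonneg
theorem errGyy_nonneg (pb : Problem m d e Ξ Z) (s : State m d e) : 0 ≤ errGyy pb s := mean_sq_nonneg
theorem errGy_nonneg (pb : Problem m d e Ξ Z) (s : State m d e) : 0 ≤ errGy pb s := mean_sq_nonneg
theorem errY_nonneg (pb : Problem m d e Ξ Z) (s : State m d e) : 0 ≤ errY pb s := mean_sq_nonneg
theorem errD_nonneg (s : State m d e) : 0 ≤ errD s := sq_nonneg _
theorem drift_nonneg (s : State m d e) : 0 ≤ drift s := add_nonneg (sq_nonneg _) mean_sq_nonneg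

theorem errEst_nonneg (pb : Problem m d e Ξ Z) (s : State m d e) : 0 ≤ errEst pb s := by
  have h1 := errFx_nonneg pb s
  have h2 := errFy_nonneg pb s
  have h3 := errGxy_nonneg pb s
  have h4 := errGyy_nonneg pb s
  have h5 := errGy_nonneg pb s
  have h6 := errD_nonneg s
  unfold errEst; linarith

end Errors

/-! ### One step of the five families of estimators. -/

section OneStep

variable {m d : ℕ} {e : Fin m → ℕ} {Ξ Z : Type*} [MeasurableSpace Ξ] [MeasurableSpace Z]
  {pb : Problem m d e Ξ Z} {X : Set (Vec d)} {lam B κ : ℝ} {D : ℕ}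

/-- Per-iteration variance and drift contribution of one estimator. -/
noncomputable def noise (pb : Problem m d e Ξ Z) (B κ : ℝ) (D : ℕ) (β : ℝ) (s : State m d e) : ℝ :=
  2 * lipConst B D ^ 2 * (κ * (pb.Cp / m)) * drift s + 2 * (D + 1) ^ 2 * β ^ 2 * (pb.Cp / m)

variable (hA : Assumptions pb X) (hU : UniformBounds pb lam B κ D)

include hA in
theorem dataLaw_prob (i : Fin m) : IsProbabilityMeasure (pb.dataLaw i) := by
  have := hA.prob_P i
  have := hA.prob_Q i
  unfold Problem.dataLaw; infer_instance

include hA hU in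
theorem inv_p_le (k : Fin m) : 1 / pb.p k ≤ κ * (pb.Cp / m) := by
  have hm : (0 : ℝ) < m := by exact_mod_cast hA.m_pos
  have h := hU.balanced k
  have := hA.p_pos k
  rw [← mul_div_assoc, le_div_iff₀ hm]
  calc 1 / pb.p k * m = m / pb.p k := by ring
    _ ≤ _ := h

include hA hU in
-- Since p_k ≤ 1 ≤ κ(C(p)/m)p_k. It allows terms without the factor C(p)/m to be absorbed into terms
-- with it.
theorem one_le_scale : 1 ≤ κ * (pb.Cp / m) := by
  have k : Fin m := ⟨0, hA.m_pos⟩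
  refine le_trans ?_ (inv_p_le hA hU k)
  rw [le_div_iff₀ (hA.p_pos k), one_mul]
  exact p_le_one hA.p_pos hA.p_sum k

include hA in
theorem Cp_nonneg : 0 ≤ pb.Cp :=
  Finset.sum_nonneg fun i _ => div_nonneg (by positivity) (hA.p_pos i).le

include hA in
-- The two parts are averaged differently: the drift part uses 1/p_k ≤ κC(p)/m for each task, while
-- the moment part is summed and compared directly with C(p).
theorem mean_task_noise_le (hU : UniformBounds pb lam B κ D) {C : Fin m → ℝ}
    (hC : ∑ k, C k ^ 2 / pb.p k ≤ pb.Cp) (β : ℝ) (s : State m d e) :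
    (1 / (m : ℝ)) * ∑ k, (2 * lipConst B D ^ 2 * (‖s.x - s.xprev‖ ^ 2 + ‖s.y k - s.yprev k‖ ^ 2)
      + 2 * β ^ 2 * ((D + 1) * C k) ^ 2) / pb.p k ≤ noise pb B κ D β s := by
  have hm : (0 : ℝ) < m := by exact_mod_cast hA.m_pos
  have h1 : ∀ k, (2 * lipConst B D ^ 2 * (‖s.x - s.xprev‖ ^ 2 + ‖s.y k - s.yprev k‖ ^ 2)
      + 2 * β ^ 2 * ((D + 1) * C k) ^ 2) / pb.p k
      ≤ 2 * lipConst B D ^ 2 * (κ * (pb.Cp / m)) * (‖s.x - s.xprev‖ ^ 2 + ‖s.y k - s.yprev k‖ ^ 2)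
        + 2 * (D + 1) ^ 2 * β ^ 2 * (C k ^ 2 / pb.p k) := fun k => by
    have h := mul_le_mul_of_nonneg_left (inv_p_le hA hU k)
      (show 0 ≤ 2 * lipConst B D ^ 2 * (‖s.x - s.xprev‖ ^ 2 + ‖s.y k - s.yprev k‖ ^ 2) by positivity)
    calc _ = 2 * lipConst B D ^ 2 * (‖s.x - s.xprev‖ ^ 2 + ‖s.y k - s.yprev k‖ ^ 2) * (1 / pb.p k)
        + 2 * (D + 1) ^ 2 * β ^ 2 * (C k ^ 2 / pb.p k) := by ring
      _ ≤ _ := by linarith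
  refine (mean_mono h1).trans ?_
  rw [Finset.sum_add_distrib, ← Finset.mul_sum, ← Finset.mul_sum, Finset.sum_add_distrib]
  simp only [Finset.sum_const, Finset.card_univ, Fintype.card_fin, nsmul_eq_mul]
  have h2 : 2 * ((D : ℝ) + 1) ^ 2 * β ^ 2 * ((1 / (m : ℝ)) * ∑ k, C k ^ 2 / pb.p k)
      ≤ 2 * (D + 1) ^ 2 * β ^ 2 * ((1 / (m : ℝ)) * pb.Cp) := by gcongr
  have h3 : (1 / (m : ℝ)) * (m * ‖s.x - s.xprev‖ ^ 2 + ∑ k, ‖s.y k - s.yprev k‖ ^ 2) = drift s := by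
    unfold drift; field_simp
  unfold noise
  rw [← h3]
  calc _ = 2 * lipConst B D ^ 2 * (κ * (pb.Cp / m))
        * ((1 / (m : ℝ)) * (m * ‖s.x - s.xprev‖ ^ 2 + ∑ k, ‖s.y k - s.yprev k‖ ^ 2))
        + 2 * ((D : ℝ) + 1) ^ 2 * β ^ 2 * ((1 / (m : ℝ)) * ∑ k, C k ^ 2 / pb.p k) := by ring
    _ ≤ _ := by
      have : 2 * ((D : ℝ) + 1) ^ 2 * β ^ 2 * ((1 / (m : ℝ)) * pb.Cp)
        = 2 * ((D : ℝ) + 1) ^ 2 * β ^ 2 * (pb.Cp / m) := by ring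
      linarith

section Family

variable {E : Fin m → Type*} [∀ k, NormedAddCommGroup (E k)] [∀ k, InnerProductSpace ℝ (E k)]
  [∀ k, CompleteSpace (E k)] [∀ k, MeasurableSpace (E k)] [∀ k, BorelSpace (E k)]
  [∀ k, SecondCountableTopology (E k)]

include hA hU in
-- The set K k must contain both the old estimate and the true derivative: the first serves the
-- movement bound, the second the error bound.
theorem family_avgLE {h : ∀ k, Vec d → Vec (e k) → Ξ × Z → E k} {hb : ∀ k, Vec d → Vec (e k) → E k}
    {C : Fin m → ℝ} (hC : ∑ k, C k ^ 2 / pb.p k ≤ pb.Cp)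
    (ho : ∀ k, Oracle (pb.dataLaw k) (h k) (hb k) X (pb.R k) (lipConst B D) ((D + 1) * C k))
    {β : ℝ} (hβ0 : 0 ≤ β) (hβ1 : β ≤ 1) {s : State m d e} (hx : s.x ∈ X)
    (hy : ∀ k, ‖s.y k‖ ≤ pb.R k) (a : ∀ k, E k) {a' : ∀ k, Fin m → Ξ × Z → E k}
    (hm : ∀ k i, Measurable (a' k i)) (K : ∀ k, Set (E k)) (ha : ∀ k, a k ∈ K k)
    (hmean : ∀ k, hb k s.x (s.y k) ∈ K k)
    (hs : ∀ k ω, ∀ c ∈ K k, ‖a' k k ω - c‖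
      ≤ ‖storm β (pb.p k) (a k) (h k s.xprev (s.yprev k) ω) (h k s.x (s.y k) ω) - c‖)
    (hn : ∀ k i, i ≠ k → ∀ ω, ∀ c ∈ K k, ‖a' k i ω - c‖ ≤ ‖(1 - β) • a k - c‖) :
    AvgLE pb.p pb.dataLaw (fun i ω => (1 / (m : ℝ)) * ∑ k, ‖a' k i ω - hb k s.x (s.y k)‖ ^ 2)
      ((1 - β) * ((1 / (m : ℝ)) * ∑ k, ‖a k - hb k s.xprev (s.yprev k)‖ ^ 2)
        + noise pb B κ D β s) ∧
    AvgLE pb.p pb.dataLaw (fun i ω => (1 / (m : ℝ)) * ∑ k, ‖a' k i ω - a k‖ ^ 2)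
      (2 * β ^ 2 * ((1 / (m : ℝ)) * ∑ k, ‖a k‖ ^ 2) + 2 * noise pb B κ D β s) := by
  have hM := dataLaw_prob hA
  have hN := mean_task_noise_le hA hU hC β s
  constructor
  · refine ((AvgLE.sum Finset.univ fun k _ => (ho k).avgLE_error hA.p_pos hA.p_sum k hβ0 hβ1
      s.xprev (s.yprev k) hx (hy k) (a k) (hm k) (fun ω => hs k ω _ (hmean k))
      (fun i hi ω => hn k i hi ω _ (hmean k))).const_mul
        (show 0 ≤ 1 / (m : ℝ) by positivity)).mono ?_
    rw [Finset.sum_add_distrib, ← Finset.mul_sum, mul_add]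
    linarith
  · refine ((AvgLE.sum Finset.univ fun k _ => (ho k).avgLE_movement hA.p_pos hA.p_sum k hβ0 hβ1
      s.xprev (s.yprev k) hx (hy k) (a k) (hm k) (fun ω => hs k ω _ (ha k))
      (fun i hi ω => hn k i hi ω _ (ha k))).const_mul
        (show 0 ≤ 1 / (m : ℝ) by positivity)).mono ?_
    rw [Finset.sum_add_distrib, ← Finset.mul_sum, ← Finset.mul_sum, mul_add]
    linarith

end Family

variable {η γ τ β : ℝ} (hβ0 : 0 ≤ β) (hβ1 : β ≤ 1) {s : State m d e} (hs : Feasible pb s)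
  (hx : s.x ∈ X)

include hA in
theorem sum_le_Cp {C : Fin m → ℝ} (h : ∀ k, C k ^ 2 ≤ pb.Cfx k ^ 2 + pb.Cfy k ^ 2 + pb.Cgy k ^ 2 +
    pb.Cgxy k ^ 2 + pb.Cgyy k ^ 2) : ∑ k, C k ^ 2 / pb.p k ≤ pb.Cp :=
  Finset.sum_le_sum fun k _ => div_le_div_of_nonneg_right (h k) (hA.p_pos k).le

include hA hU in
theorem measurable_step_data (θ : Params) (s : State m d e) (i j : Fin m) :
    Measurable fun ω : Ξ × Z => step pb θ s i j ω.1 ω.2 :=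
  (measurable_step hA hU θ i j).comp (measurable_const.prodMk measurable_id)

include hA hU hβ0 hβ1 hs hx

theorem step_errFx : AvgLE pb.p pb.dataLaw
      (fun i ω => errFx pb (step pb (Params.uniform η γ τ β) s i i ω.1 ω.2))
      ((1 - β) * errFx pb s + noise pb B κ D β s) ∧
    AvgLE pb.p pb.dataLaw (fun i ω => (1 / (m : ℝ)) * ∑ k,
      ‖(step pb (Params.uniform η γ τ β) s i i ω.1 ω.2).u k - s.u k‖ ^ 2)
      (2 * β ^ 2 * ((1 / (m : ℝ)) * ∑ k, ‖s.u k‖ ^ 2) + 2 * noise pb B κ D β s) := by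
  have hP := hA.prob_P
  have hQ := hA.prob_Q
  refine family_avgLE hA hU (E := fun _ => Vec d)
    (h := fun k x y ω => gradX (fun x y => pb.f k x y ω.1) x y)
    (hb := fun k => gradX (pb.fbar k)) (C := pb.Cfx)
    (sum_le_Cp hA fun k => by nlinarith) (fun k => (oracle_fx hA hU k).comp measurePreserving_fst)
    hβ0 hβ1 hx (fun k => (hs k).1) s.u
    (a' := fun k i ω => (step pb (Params.uniform η γ τ β) s i i ω.1 ω.2).u k)
    (fun k i => (State.measurable_u k).comp (measurable_step_data hA hU _ s i i))
    (fun k => Metric.closedBall 0 (pb.Cfx k)) (fun k => by simpa using (hs k).2.1)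
    (fun k => by simpa using norm_gradX_fbar_le hA hU k hx (hs k).1) (fun k ω c hc => ?_)
    (fun k i hik ω c hc => ?_)
  · rw [step_u, if_pos rfl]
    exact norm_proj_sub_le Metric.isClosed_closedBall (convex_closedBall _ _) _ hc
  · rw [step_u, if_neg hik.symm]; rfl

theorem step_errFy : AvgLE pb.p pb.dataLaw
      (fun i ω => errFy pb (step pb (Params.uniform η γ τ β) s i i ω.1 ω.2))
      ((1 - β) * errFy pb s + noise pb B κ D β s) ∧
    AvgLE pb.p pb.dataLaw (fun i ω => (1 / (m : ℝ)) * ∑ k,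
      ‖(step pb (Params.uniform η γ τ β) s i i ω.1 ω.2).v k - s.v k‖ ^ 2)
      (2 * β ^ 2 * ((1 / (m : ℝ)) * ∑ k, ‖s.v k‖ ^ 2) + 2 * noise pb B κ D β s) := by
  have hP := hA.prob_P
  have hQ := hA.prob_Q
  refine family_avgLE hA hU (E := fun k => Vec (e k))
    (h := fun k x y ω => gradY (fun x y => pb.f k x y ω.1) x y)
    (hb := fun k => gradY (pb.fbar k)) (C := pb.Cfy)
    (sum_le_Cp hA fun k => by nlinarith) (fun k => (oracle_fy hA hU k).comp measurePreserving_fst)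
    hβ0 hβ1 hx (fun k => (hs k).1) s.v
    (a' := fun k i ω => (step pb (Params.uniform η γ τ β) s i i ω.1 ω.2).v k)
    (fun k i => (State.measurable_v k).comp (measurable_step_data hA hU _ s i i))
    (fun k => Metric.closedBall 0 (pb.Cfy k)) (fun k => by simpa using (hs k).2.2.1)
    (fun k => by simpa using norm_gradY_fbar_le hA hU k hx (hs k).1) (fun k ω c hc => ?_)
    (fun k i hik ω c hc => ?_)
  · rw [step_v, if_pos rfl]
    exact norm_proj_sub_le Metric.isClosed_closedBall (convex_closedBall _ _) _ hc
  · rw [step_v, if_neg hik.symm]; rfl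

theorem step_errGxy : AvgLE pb.p pb.dataLaw
      (fun i ω => errGxy pb (step pb (Params.uniform η γ τ β) s i i ω.1 ω.2))
      ((1 - β) * errGxy pb s + noise pb B κ D β s) ∧
    AvgLE pb.p pb.dataLaw (fun i ω => (1 / (m : ℝ)) * ∑ k,
      ‖(step pb (Params.uniform η γ τ β) s i i ω.1 ω.2).V k - s.V k‖ ^ 2)
      (2 * β ^ 2 * ((1 / (m : ℝ)) * ∑ k, ‖s.V k‖ ^ 2) + 2 * noise pb B κ D β s) := by
  have hP := hA.prob_P
  have hQ := hA.prob_Q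
  refine family_avgLE hA hU (E := fun k => Mat d (e k))
    (h := fun k x y ω => hessXY (fun x y => pb.g k x y ω.2) x y)
    (hb := fun k => hessXY (pb.gbar k)) (C := pb.Cgxy)
    (sum_le_Cp hA fun k => by nlinarith) (fun k => (oracle_gxy hA hU k).comp measurePreserving_snd)
    hβ0 hβ1 hx (fun k => (hs k).1) s.V
    (a' := fun k i ω => (step pb (Params.uniform η γ τ β) s i i ω.1 ω.2).V k)
    (fun k i => (State.measurable_V k).comp (measurable_step_data hA hU _ s i i))
    (fun k => specBall d (e k) (pb.Cgxy k)) (fun k => (hs k).2.2.2.1)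
    (fun k => specNorm_hessXY_gbar_le hA hU k hx (hs k).1) (fun k ω c hc => ?_)
    (fun k i hik ω c hc => ?_)
  · rw [step_V, if_pos rfl]
    exact norm_proj_sub_le (isClosed_specBall _) (convex_specBall _) _ hc
  · rw [step_V, if_neg hik.symm]; rfl

theorem step_errGyy : AvgLE pb.p pb.dataLaw
      (fun i ω => errGyy pb (step pb (Params.uniform η γ τ β) s i i ω.1 ω.2))
      ((1 - β) * errGyy pb s + noise pb B κ D β s) ∧
    AvgLE pb.p pb.dataLaw (fun i ω => (1 / (m : ℝ)) * ∑ k,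
      ‖(step pb (Params.uniform η γ τ β) s i i ω.1 ω.2).H k - s.H k‖ ^ 2)
      (2 * β ^ 2 * ((1 / (m : ℝ)) * ∑ k, ‖s.H k‖ ^ 2) + 2 * noise pb B κ D β s) := by
  have hP := hA.prob_P
  have hQ := hA.prob_Q
  refine family_avgLE hA hU (E := fun k => Mat (e k) (e k))
    (h := fun k x y ω => hessYY (fun x y => pb.g k x y ω.2) x y)
    (hb := fun k => hessYY (pb.gbar k)) (C := pb.Cgyy)
    (sum_le_Cp hA fun k => by nlinarith) (fun k => (oracle_gyy hA hU k).comp measurePreserving_snd)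
    hβ0 hβ1 hx (fun k => (hs k).1) s.H
    (a' := fun k i ω => (step pb (Params.uniform η γ τ β) s i i ω.1 ω.2).H k)
    (fun k i => (State.measurable_H k).comp (measurable_step_data hA hU _ s i i))
    (fun k => psdAbove (e k) pb.lam) (fun k => (hs k).2.2.2.2)
    (fun k => hA.strong k s.x (s.y k)) (fun k ω c hc => ?_)
    (fun k i hik ω c hc => ?_)
  · rw [step_H, if_pos rfl]
    exact norm_proj_sub_le (isClosed_psdAbove _) (convex_psdAbove _) _ hc
  · rw [step_H, if_neg hik.symm]
    exact norm_proj_sub_le (isClosed_psdAbove _) (convex_psdAbove _) _ hc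

theorem step_errGy : AvgLE pb.p pb.dataLaw
      (fun i ω => errGy pb (step pb (Params.uniform η γ τ β) s i i ω.1 ω.2))
      ((1 - β) * errGy pb s + noise pb B κ D β s) := by
  have hP := hA.prob_P
  have hQ := hA.prob_Q
  refine (family_avgLE hA hU (E := fun k => Vec (e k))
    (h := fun k x y ω => gradY (fun x y => pb.g k x y ω.2) x y)
    (hb := fun k => gradY (pb.gbar k)) (C := pb.Cgy)
    (sum_le_Cp hA fun k => by nlinarith) (fun k => (oracle_gy hA hU k).comp measurePreserving_snd)
    hβ0 hβ1 hx (fun k => (hs k).1) s.w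
    (a' := fun k i ω => (step pb (Params.uniform η γ τ β) s i i ω.1 ω.2).w k)
    (fun k i => (State.measurable_w k).comp (measurable_step_data hA hU _ s i i))
    -- w is not projected, so there is no constraint set.
    (fun k => Set.univ) (fun k => Set.mem_univ _)
    (fun k => Set.mem_univ _) (fun k ω c hc => ?_)
    (fun k i hik ω c hc => ?_)).1
  · rw [step_w, if_pos rfl]; rfl
  · rw [step_w, if_neg hik.symm]; rfl

end OneStep

end Bilevel

namespace Bilevel

variable {m d : ℕ} {e : Fin m → ℕ} {Ξ Z : Type*} [MeasurableSpace Ξ] [MeasurableSpace Z]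
  {pb : Problem m d e Ξ Z} {X : Set (Vec d)} {lam B κ : ℝ} {D : ℕ}

/-! ### Measurability of the error functionals. -/

section ErrorMeasurability

theorem measurable_mean_norm_sq {α : Type*} [MeasurableSpace α] {E : Fin m → Type*}
    [∀ k, NormedAddCommGroup (E k)] [∀ k, MeasurableSpace (E k)] [∀ k, OpensMeasurableSpace (E k)]
    {φ : ∀ k, α → E k} (h : ∀ k, Measurable (φ k)) :
    Measurable fun s => (1 / (m : ℝ)) * ∑ k, ‖φ k s‖ ^ 2 :=
  (Finset.measurable_sum _ fun k _ => ((h k).norm.pow_const 2)).const_mul _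

variable (hA : Assumptions pb X) (hU : UniformBounds pb lam B κ D)

theorem JointLipschitz.measurable_comp {a b : ℕ} {E : Type*} [NormedAddCommGroup E]
    [MeasurableSpace E] [BorelSpace E] {h : Vec a → Vec b → E} {L : ℝ}
    (hl : JointLipschitz norm h L) {α : Type*} [MeasurableSpace α] {fx : α → Vec a}
    {fy : α → Vec b} (hx : Measurable fx) (hy : Measurable fy) :
    Measurable fun s => h (fx s) (fy s) :=
  hl.continuous.measurable.comp (hx.prodMk hy)

include hA hU

theorem measurable_errFx : Measurable (errFx pb) :=
  have := hA.prob_P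
  measurable_mean_norm_sq (E := fun _ => Vec d) fun k => (State.measurable_u k).sub
    ((oracle_fx hA hU k).lip_mean.measurable_comp State.measurable_xprev (State.measurable_yprev k))

theorem measurable_errFy : Measurable (errFy pb) :=
  have := hA.prob_P
  measurable_mean_norm_sq (E := fun k => Vec (e k)) fun k => (State.measurable_v k).sub
    ((oracle_fy hA hU k).lip_mean.measurable_comp State.measurable_xprev (State.measurable_yprev k))

theorem measurable_errGxy : Measurable (errGxy pb) :=
  have := hA.prob_Q
  measurable_mean_norm_sq (E := fun k => Mat d (e k)) fun k => (State.measurable_V k).sub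
    ((oracle_gxy hA hU k).lip_mean.measurable_comp State.measurable_xprev (State.measurable_yprev k))

theorem measurable_errGyy : Measurable (errGyy pb) :=
  have := hA.prob_Q
  measurable_mean_norm_sq (E := fun k => Mat (e k) (e k)) fun k => (State.measurable_H k).sub
    ((oracle_gyy hA hU k).lip_mean.measurable_comp State.measurable_xprev (State.measurable_yprev k))

theorem measurable_errGy : Measurable (errGy pb) :=
  have := hA.prob_Q
  measurable_mean_norm_sq (E := fun k => Vec (e k)) fun k => (State.measurable_w k).sub
    ((oracle_gy hA hU k).lip_mean.measurable_comp State.measurable_xprev (State.measurable_yprev k))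

omit hA hU in
theorem measurable_errD : Measurable (errD : State m d e → ℝ) :=
  (State.measurable_d.sub ((Finset.measurable_sum _ fun k _ => State.measurable_z k).const_smul
    (1 / (m : ℝ)))).norm.pow_const 2

omit hA hU in
theorem measurable_drift : Measurable (drift : State m d e → ℝ) :=
  ((State.measurable_x.sub State.measurable_xprev).norm.pow_const 2).add
    (measurable_mean_norm_sq (E := fun k => Vec (e k)) fun k => (State.measurable_y k).sub
      (State.measurable_yprev k))

theorem measurable_errEst : Measurable (errEst pb) :=
  measurable_errD.add (((((measurable_errFx hA hU).add (measurable_errFy hA hU)).add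
    (measurable_errGxy hA hU)).add (measurable_errGyy hA hU)).add (measurable_errGy hA hU))

theorem measurable_errY (hlam : 0 < lam) : Measurable (errY pb) :=
  measurable_mean_norm_sq (E := fun k => Vec (e k)) fun k => (State.measurable_y k).sub
    ((continuous_ystar hA hU hlam k).measurable.comp State.measurable_x)

end ErrorMeasurability

/-- Squared Lipschitz factor of the hypergradient expression. -/
noncomputable def zSqLip (lam B : ℝ) : ℝ := 4 * zLip B lam ^ 2

/-- Constant in the one-step bound for the estimators. -/
noncomputable def estConst (lam B κ : ℝ) (D : ℕ) : ℝ :=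
  (5 + 16 * zSqLip lam B) * (2 * lipConst B D ^ 2 * κ + 2 * (D + 1) ^ 2)
    + κ * (20 * zSqLip lam B * lipConst B D ^ 2 + 2 * (B * zLip B lam) ^ 2)

theorem zSqLip_nonneg : 0 ≤ zSqLip lam B := by unfold zSqLip; positivity

theorem mean_norm_sq_le (hm : 0 < m) {E : Fin m → Type*} [∀ k, NormedAddCommGroup (E k)]
    {a : ∀ k, E k} {c : ℝ} (h : ∀ k, ‖a k‖ ≤ c) : (1 / (m : ℝ)) * ∑ k, ‖a k‖ ^ 2 ≤ c ^ 2 :=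
  mean_le_of_le hm fun k => pow_le_pow_left₀ (norm_nonneg _) (h k) 2

theorem le_lipConst (hB : 0 ≤ B) : B ≤ lipConst B D :=
  le_mul_of_one_le_left hB (one_le_dim_succ D)

theorem norm_sq_le_two_mul_add {E : Type*} [SeminormedAddCommGroup E] (x y : E) :
    ‖x‖ ^ 2 ≤ 2 * ‖x - y‖ ^ 2 + 2 * ‖y‖ ^ 2 := by
  have h : ‖x‖ ≤ ‖x - y‖ + ‖y‖ := by simpa using norm_add_le (x - y) y
  nlinarith [norm_nonneg x, sq_nonneg (‖x - y‖ - ‖y‖)]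

/-- Half of the contraction is given up: the bound on the movement of H contains 8·zc·β²·eH, which
β/2·eH absorbs because 16·zc·β ≤ 1. The terms β²·L2 and β²·W, which lack the factor S, acquire it
from 1 ≤ κS. -/
theorem errEst_bound_arith {zc L2 W S κ β D2 dr eD eu ev eV eH ew b1 b2 b3 b4 : ℝ} (hz : 0 ≤ zc)
    (hS0 : 0 ≤ S) (hκ : 0 ≤ κ) (hS : 1 ≤ κ * S) (hL : 0 ≤ L2) (hW : 0 ≤ W) (hD2 : 0 ≤ D2)
    (hβ0 : 0 ≤ β) (hβ : 16 * zc * β ≤ 1) (hdr : 0 ≤ dr) (hD : 0 ≤ eD) (hu : 0 ≤ eu) (hv : 0 ≤ ev)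
    (hV : 0 ≤ eV) (hH : 0 ≤ eH) (hw : 0 ≤ ew) (hb1 : b1 ≤ L2) (hb2 : b2 ≤ L2) (hb3 : b3 ≤ L2)
    (hb4 : b4 ≤ 2 * eH + 2 * L2) :
    (1 - β) * eD + 2 * zc * (2 * β ^ 2 * b1 + 2 * (2 * L2 * (κ * S) * dr + 2 * D2 * β ^ 2 * S)
      + (2 * β ^ 2 * b2 + 2 * (2 * L2 * (κ * S) * dr + 2 * D2 * β ^ 2 * S))
      + (2 * β ^ 2 * b3 + 2 * (2 * L2 * (κ * S) * dr + 2 * D2 * β ^ 2 * S))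
      + (2 * β ^ 2 * b4 + 2 * (2 * L2 * (κ * S) * dr + 2 * D2 * β ^ 2 * S)))
      + 2 * β ^ 2 * W
      + ((1 - β) * eu + (2 * L2 * (κ * S) * dr + 2 * D2 * β ^ 2 * S)
      + ((1 - β) * ev + (2 * L2 * (κ * S) * dr + 2 * D2 * β ^ 2 * S))
      + ((1 - β) * eV + (2 * L2 * (κ * S) * dr + 2 * D2 * β ^ 2 * S))
      + ((1 - β) * eH + (2 * L2 * (κ * S) * dr + 2 * D2 * β ^ 2 * S))
      + ((1 - β) * ew + (2 * L2 * (κ * S) * dr + 2 * D2 * β ^ 2 * S)))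
    ≤ (1 - β / 2) * (eD + (eu + ev + eV + eH + ew))
      + ((5 + 16 * zc) * (2 * L2 * κ + 2 * D2) + κ * (20 * zc * L2 + 2 * W)) * S * dr
      + ((5 + 16 * zc) * (2 * L2 * κ + 2 * D2) + κ * (20 * zc * L2 + 2 * W)) * β ^ 2 * S := by
  have h0 : 4 * zc * β ^ 2 * (b1 + b2 + b3 + b4) ≤ 4 * zc * β ^ 2 * (5 * L2 + 2 * eH) :=
    mul_le_mul_of_nonneg_left (by linarith) (by positivity)
  have h1 : 0 ≤ (5 + 16 * zc) * (2 * D2) * (S * dr) := by positivity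
  have h2 : 0 ≤ κ * (20 * zc * L2 + 2 * W) * (S * dr) := by positivity
  have h3 : 0 ≤ (5 + 16 * zc) * (2 * L2 * κ) * (β ^ 2 * S) := by positivity
  have h4 : 0 ≤ (κ * S - 1) * (β ^ 2 * (20 * zc * L2 + 2 * W)) :=
    mul_nonneg (by linarith) (by positivity)
  have h5 : 0 ≤ (1 - 16 * zc * β) * (β / 2 * eH) := mul_nonneg (by linarith) (by positivity)
  have k1 : 0 ≤ β / 2 * eD := by positivity
  have k2 : 0 ≤ β / 2 * eu := by positivity
  have k3 : 0 ≤ β / 2 * ev := by positivity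
  have k4 : 0 ≤ β / 2 * eV := by positivity
  have k5 : 0 ≤ β / 2 * ew := by positivity
  linarith

/-! ### The recursion for the total estimator error. -/

variable (hA : Assumptions pb X) (hU : UniformBounds pb lam B κ D) (hlam : 0 < lam)
  {η γ τ β : ℝ} {s : State m d e} (hs : Feasible pb s) (hx : s.x ∈ X)
include hA hU hlam hs

/-- The index j influences only d, x and y, so the estimators, and hence the z_k, may be taken from
the step with j = i. -/
theorem mean_zStep_le (hη : 0 ≤ η ∧ η ≤ 1) (hβ0 : 0 ≤ β) (hβ1 : β ≤ 1) (i : Fin m) (ξ : Ξ) (ζ : Z) :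
    (1 / (m : ℝ)) * ∑ j, errD (step pb (Params.uniform η γ τ β) s i j ξ ζ)
      ≤ (1 - β) * errD s + 2 * zSqLip lam B *
        ((1 / (m : ℝ)) * ∑ k, ‖(step pb (Params.uniform η γ τ β) s i i ξ ζ).u k - s.u k‖ ^ 2
        + (1 / (m : ℝ)) * ∑ k, ‖(step pb (Params.uniform η γ τ β) s i i ξ ζ).v k - s.v k‖ ^ 2
        + (1 / (m : ℝ)) * ∑ k, ‖(step pb (Params.uniform η γ τ β) s i i ξ ζ).V k - s.V k‖ ^ 2
        + (1 / (m : ℝ)) * ∑ k, ‖(step pb (Params.uniform η γ τ β) s i i ξ ζ).H k - s.H k‖ ^ 2)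
        + 2 * β ^ 2 * (B * zLip B lam) ^ 2 := by
  set t := step pb (Params.uniform η γ τ β) s i i ξ ζ with ht
  have hB := hU.B_nonneg hA i
  have htf : Feasible pb t := hs.step hA hη ⟨hβ0, hβ1⟩ ⟨hβ0, hβ1⟩ ⟨hβ0, hβ1⟩ i i ξ ζ
  have h1 : ∀ j, errD (step pb (Params.uniform η γ τ β) s i j ξ ζ)
      = ‖(1 - β) • (s.d - s.z j) + t.z j - (1 / (m : ℝ)) • ∑ k, t.z k‖ ^ 2 := fun j => rfl
  simp only [h1]
  refine (mean_norm_sq_storm_le hA.m_pos hβ0 hβ1 s.d s.z t.z).trans ?_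
  have h2 : (1 / (m : ℝ)) * ∑ k, ‖t.z k - s.z k‖ ^ 2 ≤ zSqLip lam B *
        ((1 / (m : ℝ)) * ∑ k, ‖t.u k - s.u k‖ ^ 2 + (1 / (m : ℝ)) * ∑ k, ‖t.v k - s.v k‖ ^ 2
        + (1 / (m : ℝ)) * ∑ k, ‖t.V k - s.V k‖ ^ 2 + (1 / (m : ℝ)) * ∑ k, ‖t.H k - s.H k‖ ^ 2) := by
    refine (mean_mono fun k => norm_zmap_sub_sq_le hB hlam (htf.zBounds hU k)
      (hs.zBounds hU k)).trans (le_of_eq ?_)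
    rw [← Finset.mul_sum]
    simp only [Finset.sum_add_distrib]
    unfold zSqLip
    ring
  have h3 : (1 / (m : ℝ)) * ∑ k, ‖t.z k‖ ^ 2 ≤ (B * zLip B lam) ^ 2 :=
    mean_norm_sq_le hA.m_pos (E := fun _ => Vec d) fun k => norm_zmap_le hB hlam (htf.zBounds hU k)
  have h4 := mul_le_mul_of_nonneg_left h3 (show 0 ≤ 2 * β ^ 2 by positivity)
  have h5 : ‖s.d - (1 / (m : ℝ)) • ∑ i, s.z i‖ ^ 2 = errD s := rfl
  rw [h5]
  linarith

include hx

theorem step_errEst (hη : 0 ≤ η ∧ η ≤ 1) (hβ0 : 0 ≤ β) (hβ1 : β ≤ 1)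
    (hβ : 16 * zSqLip lam B * β ≤ 1) :
    AvgLE pb.p pb.dataLaw
      (fun i ω => (1 / (m : ℝ)) * ∑ j, errEst pb (step pb (Params.uniform η γ τ β) s i j ω.1 ω.2))
      ((1 - β / 2) * errEst pb s + estConst lam B κ D * (pb.Cp / m) * drift s
        + estConst lam B κ D * β ^ 2 * (pb.Cp / m)) := by
  have hM := dataLaw_prob hA
  have hm : (0 : ℝ) < m := by exact_mod_cast hA.m_pos
  have i₀ : Fin m := ⟨0, hA.m_pos⟩
  have hB := hU.B_nonneg hA i₀
  have hS := one_le_scale hA hU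
  have hS0 : 0 ≤ pb.Cp / m := div_nonneg (Cp_nonneg hA) hm.le
  have hz := zSqLip_nonneg (lam := lam) (B := B)
  obtain ⟨eu, mu⟩ := step_errFx (η := η) (γ := γ) (τ := τ) hA hU hβ0 hβ1 hs hx
  obtain ⟨ev, mv⟩ := step_errFy (η := η) (γ := γ) (τ := τ) hA hU hβ0 hβ1 hs hx
  obtain ⟨eV, mV⟩ := step_errGxy (η := η) (γ := γ) (τ := τ) hA hU hβ0 hβ1 hs hx
  obtain ⟨eH, mH⟩ := step_errGyy (η := η) (γ := γ) (τ := τ) hA hU hβ0 hβ1 hs hx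
  have ew := step_errGy (η := η) (γ := γ) (τ := τ) hA hU hβ0 hβ1 hs hx
  have hD := ((AvgLE.const (M := pb.dataLaw) hA.p_sum ((1 - β) * errD s)).add
    ((((mu.add mv).add mV).add mH).const_mul (show 0 ≤ 2 * zSqLip lam B by positivity))).add
    (AvgLE.const (M := pb.dataLaw) hA.p_sum (2 * β ^ 2 * (B * zLip B lam) ^ 2))
  have hall := hD.add ((((eu.add ev).add eV).add eH).add ew)
  refine (AvgLE.of_le (fun i => (hA.p_pos i).le) hall (fun i => ?_) (fun i ω => ?_)
    (fun i ω => ?_)).mono ?_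
  · exact (Finset.measurable_sum _ fun j _ => (measurable_errEst hA hU).comp
      (measurable_step_data hA hU _ s i j)).const_mul _
  · exact mul_nonneg (by positivity) (Finset.sum_nonneg fun j _ => errEst_nonneg _ _)
  · have h1 : ∀ j, errEst pb (step pb (Params.uniform η γ τ β) s i j ω.1 ω.2)
        = errD (step pb (Params.uniform η γ τ β) s i j ω.1 ω.2)
          + (errFx pb (step pb (Params.uniform η γ τ β) s i i ω.1 ω.2)
          + errFy pb (step pb (Params.uniform η γ τ β) s i i ω.1 ω.2)
          + errGxy pb (step pb (Params.uniform η γ τ β) s i i ω.1 ω.2)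
          + errGyy pb (step pb (Params.uniform η γ τ β) s i i ω.1 ω.2)
          + errGy pb (step pb (Params.uniform η γ τ β) s i i ω.1 ω.2)) := fun j => rfl
    have h2 := mean_zStep_le (γ := γ) (τ := τ) hA hU hlam hs hη hβ0 hβ1 i ω.1 ω.2
    simp only [h1, Finset.sum_add_distrib, Finset.sum_const, Finset.card_univ, Fintype.card_fin,
      nsmul_eq_mul, mul_add, one_div, inv_mul_cancel_left₀ hm.ne']
    simp only [one_div, mul_add] at h2
    linarith
  · have hΛ := le_lipConst (D := D) hB
    have b1 : (1 / (m : ℝ)) * ∑ k, ‖s.u k‖ ^ 2 ≤ lipConst B D ^ 2 :=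
      mean_norm_sq_le hA.m_pos (E := fun _ => Vec d) fun k => (hs.zBounds hU k).u_le.trans hΛ
    have b2 : (1 / (m : ℝ)) * ∑ k, ‖s.v k‖ ^ 2 ≤ lipConst B D ^ 2 :=
      mean_norm_sq_le hA.m_pos (E := fun k => Vec (e k)) fun k => (hs.zBounds hU k).v_le.trans hΛ
    have b3 : (1 / (m : ℝ)) * ∑ k, ‖s.V k‖ ^ 2 ≤ lipConst B D ^ 2 :=
      mean_norm_sq_le hA.m_pos (E := fun k => Mat d (e k)) fun k =>
        (norm_le_spec (hU.dim_le k) _).trans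
          (mul_le_mul_of_nonneg_left (hs.zBounds hU k).V_le (by positivity))
    -- H has no a priori upper bound; its size is bounded by its own error plus the size of the true
    -- Hessian.
    have b4 : (1 / (m : ℝ)) * ∑ k, ‖s.H k‖ ^ 2 ≤ 2 * errGyy pb s + 2 * lipConst B D ^ 2 := by
      have h1 : (1 / (m : ℝ)) * ∑ k, ‖hessYY (pb.gbar k) s.xprev (s.yprev k)‖ ^ 2 ≤ lipConst B D ^ 2 :=
        mean_norm_sq_le hA.m_pos (E := fun k => Mat (e k) (e k)) fun k =>
          norm_hessYY_gbar_le hA hU k _ _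
      refine (mean_mono fun k => norm_sq_le_two_mul_add (s.H k)
        (hessYY (pb.gbar k) s.xprev (s.yprev k))).trans ?_
      rw [Finset.sum_add_distrib, ← Finset.mul_sum, ← Finset.mul_sum]
      unfold errGyy
      linarith
    have hdr := drift_nonneg s
    have hκ : 0 ≤ κ := by
      by_contra! h
      nlinarith
    exact errEst_bound_arith hz hS0 hκ hS (sq_nonneg (lipConst B D)) (sq_nonneg (B * zLip B lam))
      (sq_nonneg ((D : ℝ) + 1)) hβ0 hβ hdr (errD_nonneg s) (errFx_nonneg pb s) (errFy_nonneg pb s)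
      (errGxy_nonneg pb s) (errGyy_nonneg pb s) (errGy_nonneg pb s) b1 b2 b3 b4

end Bilevel

namespace Bilevel

/-! ### Projected gradient steps for the lower variables. -/

section ProjectedGradient

variable {n : ℕ}

/-- With q the projected displacement, r = y − ys and ε = w − g, the variational inequality reads
⟨τ(g + ε) + q, q + r⟩ ≤ 0. Monotonicity gives −λ‖r‖², half of which is spent on Young's inequality
for ⟨g, q⟩ and ⟨ε, r⟩. The resulting ‖q‖² terms cost at most half of ‖q‖² by the bound on τ, and the
other half pays for η²‖q‖². -/
theorem projected_gradient_step {K : Set (Vec n)} (hne : K.Nonempty) (hcl : IsClosed K)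
    (hcv : Convex ℝ K) {y ys w g : Vec n} (hys : ys ∈ K) {lam B η τ : ℝ} (hlam : 0 < lam)
    (hmono : lam * ‖y - ys‖ ^ 2 ≤ inner ℝ g (y - ys)) (hg : ‖g‖ ≤ B * ‖y - ys‖)
    (hη0 : 0 ≤ η) (hη1 : η ≤ 1) (hτ0 : 0 ≤ τ) (hτ : τ * (B ^ 2 / lam + lam) ≤ 1 / 2) :
    ‖(1 - η) • y + η • proj K (y - τ • w) - ys‖ ^ 2
      ≤ (1 - η * τ * lam) * ‖y - ys‖ ^ 2 + 4 * η * τ / lam * ‖w - g‖ ^ 2 := by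
  have hpr := inner_proj_nonpos hne hcl hcv (y - τ • w) hys
  set q := proj K (y - τ • w) - y with hq
  set r := y - ys with hr
  set ε := w - g with hε
  have e1 : (1 - η) • y + η • proj K (y - τ • w) - ys = r + η • q := by rw [hq, hr]; module
  have e2 : y - τ • w - proj K (y - τ • w) = -(τ • (g + ε) + q) := by rw [hq, hε]; module
  have e3 : ys - proj K (y - τ • w) = -(q + r) := by rw [hq, hr]; module
  rw [e2, e3, inner_neg_neg, inner_add_left, real_inner_smul_left, inner_add_left, inner_add_right,
    inner_add_right, inner_add_right, real_inner_self_eq_norm_sq] at hpr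
  rw [e1, norm_add_sq_real, inner_smul_right, norm_smul, mul_pow, Real.norm_of_nonneg hη0,
    real_inner_comm]
  have c1 := abs_le.1 (abs_real_inner_le_norm g q)
  have c2 := abs_le.1 (abs_real_inner_le_norm ε q)
  have c3 := abs_le.1 (abs_real_inner_le_norm ε r)
  have c1' : ‖g‖ * ‖q‖ ≤ lam / 4 * ‖r‖ ^ 2 + B ^ 2 / lam * ‖q‖ ^ 2 := by
    have h1 : ‖g‖ * ‖q‖ ≤ B * ‖r‖ * ‖q‖ := mul_le_mul_of_nonneg_right hg (norm_nonneg _)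
    have h2 : lam / 4 * ‖r‖ ^ 2 + B ^ 2 / lam * ‖q‖ ^ 2 - B * ‖r‖ * ‖q‖
        = (lam / 2 * ‖r‖ - B * ‖q‖) ^ 2 / lam := by field_simp; ring
    have h3 : 0 ≤ (lam / 2 * ‖r‖ - B * ‖q‖) ^ 2 / lam := by positivity
    linarith
  have c2' : ‖ε‖ * ‖q‖ ≤ 1 / 4 * (‖ε‖ ^ 2 / lam) + lam * ‖q‖ ^ 2 := by
    have h2 : 1 / 4 * (‖ε‖ ^ 2 / lam) + lam * ‖q‖ ^ 2 - ‖ε‖ * ‖q‖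
        = (‖ε‖ / 2 - lam * ‖q‖) ^ 2 / lam := by field_simp; ring
    have h3 : 0 ≤ (‖ε‖ / 2 - lam * ‖q‖) ^ 2 / lam := by positivity
    linarith
  have c3' : ‖ε‖ * ‖r‖ ≤ lam / 4 * ‖r‖ ^ 2 + ‖ε‖ ^ 2 / lam := by
    have h2 : lam / 4 * ‖r‖ ^ 2 + ‖ε‖ ^ 2 / lam - ‖ε‖ * ‖r‖
        = (lam / 2 * ‖r‖ - ‖ε‖) ^ 2 / lam := by field_simp; ring
    have h3 : 0 ≤ (lam / 2 * ‖r‖ - ‖ε‖) ^ 2 / lam := by positivity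
    linarith
  set E := ‖ε‖ ^ 2 / lam with hE
  have hE0 : 0 ≤ E := by positivity
  have e5 : 4 * η * τ / lam * ‖ε‖ ^ 2 = 4 * η * τ * E := by rw [hE]; ring
  rw [e5]
  set A := B ^ 2 / lam
  have key : -(inner ℝ g q + inner ℝ g r + (inner ℝ ε q + inner ℝ ε r))
      ≤ -(lam / 2) * ‖r‖ ^ 2 + 5 / 4 * E + (A + lam) * ‖q‖ ^ 2 := by linarith [c1.1, c2.1, c3.1]
  have key2 := mul_le_mul_of_nonneg_left key hτ0
  have key3 : τ * (A + lam) * ‖q‖ ^ 2 ≤ 1 / 2 * ‖q‖ ^ 2 :=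
    mul_le_mul_of_nonneg_right hτ (sq_nonneg _)
  have key4 : inner ℝ q r ≤ -(1 / 2) * ‖q‖ ^ 2 - τ * lam / 2 * ‖r‖ ^ 2 + 5 / 4 * τ * E := by
    linarith
  have key5 := mul_le_mul_of_nonneg_left key4 hη0
  have key6 : η ^ 2 * ‖q‖ ^ 2 ≤ η * ‖q‖ ^ 2 := mul_le_mul_of_nonneg_right (by nlinarith) (sq_nonneg _)
  have key7 : 0 ≤ η * τ * E := by positivity
  linarith

theorem norm_sq_sub_le_weighted {E : Type*} [NormedAddCommGroup E] (a b c : E) {t : ℝ} (ht : 0 < t) :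
    ‖a - c‖ ^ 2 ≤ (1 + t) * ‖a - b‖ ^ 2 + (1 + 1 / t) * ‖b - c‖ ^ 2 := by
  have h1 := pow_le_pow_left₀ (norm_nonneg _) (norm_sub_le_norm_sub_add_norm_sub a b c) 2
  have h2 : (1 + t) * ‖a - b‖ ^ 2 + (1 + 1 / t) * ‖b - c‖ ^ 2 - (‖a - b‖ + ‖b - c‖) ^ 2
      = (t * ‖a - b‖ - ‖b - c‖) ^ 2 / t := by field_simp; ring
  have h3 : 0 ≤ (t * ‖a - b‖ - ‖b - c‖) ^ 2 / t := by positivity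
  linarith

end ProjectedGradient

variable {m d : ℕ} {e : Fin m → ℕ} {Ξ Z : Type*} [MeasurableSpace Ξ] [MeasurableSpace Z]
  {pb : Problem m d e Ξ Z} {X : Set (Vec d)} {lam B κ : ℝ} {D : ℕ}

theorem norm_x_move (pb : Problem m d e Ξ Z) {η γ τ β : ℝ} (hη : 0 ≤ η) (hγ : 0 ≤ γ)
    (s : State m d e) (i j : Fin m) (ξ : Ξ) (ζ : Z) :
    ‖(step pb (Params.uniform η γ τ β) s i j ξ ζ).x - s.x‖
      = η * γ * ‖(step pb (Params.uniform η γ τ β) s i j ξ ζ).d‖ := by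
  rw [step_x, sub_sub_cancel_left, norm_neg, norm_smul, Real.norm_of_nonneg]
  · rfl
  · exact mul_nonneg hη hγ

/-! ### Pathwise inequalities for the lower error, the drift and F. -/

variable (hA : Assumptions pb X) (hU : UniformBounds pb lam B κ D) (hlam : 0 < lam)
  {η γ τ β : ℝ} (hη0 : 0 < η) (hη1 : η ≤ 1) (hγ0 : 0 < γ) (hτ0 : 0 < τ)
  {s : State m d e} (hs : Feasible pb s) (hx : s.x ∈ X) (i j : Fin m) (ξ : Ξ) (ζ : Z)

include hA hU hlam hη0 hη1 hγ0 hτ0 hs hx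

omit hs in
-- The projected step contracts towards y* at the old x with rate ητλ = 2·sg. Half of this rate is
-- kept, the other half pays for the move of y* via Young's inequality with weight sg. `errGy` of
-- the new state refers to the point where the step was taken, as required.
theorem step_errY_le (hτ : τ * (B ^ 2 / lam + lam) ≤ 1 / 2) :
    errY pb (step pb (Params.uniform η γ τ β) s i j ξ ζ)
      ≤ (1 - η * τ * lam / 2) * errY pb s
        + 8 / lam * (η * τ) * errGy pb (step pb (Params.uniform η γ τ β) s i j ξ ζ)
        + 4 * B ^ 2 / lam ^ 3 * (η * γ ^ 2 / τ)
          * ‖(step pb (Params.uniform η γ τ β) s i j ξ ζ).d‖ ^ 2 := by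
  have hB := hU.B_nonneg hA i
  have hmv := norm_x_move pb (τ := τ) (β := β) hη0.le hγ0.le s i j ξ ζ
  set t := step pb (Params.uniform η γ τ β) s i j ξ ζ with ht
  set sg := η * τ * lam / 2 with hsg
  have hsg0 : 0 < sg := by positivity
  have hsg1 : sg ≤ 1 := by
    have h1 : τ * lam ≤ 1 / 2 := by
      have : 0 ≤ τ * (B ^ 2 / lam) := by positivity
      linarith
    have : η * (τ * lam) ≤ 1 * (1 / 2) := mul_le_mul hη1 h1 (by positivity) zero_le_one
    rw [hsg]; linarith
  have hk : ∀ k, ‖t.y k - pb.ystar k t.x‖ ^ 2 ≤ (1 - sg) * ‖s.y k - pb.ystar k s.x‖ ^ 2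
      + 8 / lam * (η * τ) * ‖t.w k - gradY (pb.gbar k) s.x (s.y k)‖ ^ 2
      + 4 * B ^ 2 / lam ^ 3 * (η * γ ^ 2 / τ) * ‖t.d‖ ^ 2 := by
    intro k
    have hR := (hA.const_nonneg k).2.2.2.2.2.2.2.2.2.2
    have hmono := gradY_gbar_strongMono hA hU k s.x (s.y k) (pb.ystar k s.x)
    have hl := (lip_gradY_gbar hA hU k).snd s.x (s.y k) (pb.ystar k s.x)
    rw [gradY_gbar_ystar hA hU, sub_zero] at hmono hl
    have h1 := projected_gradient_step (closedBall_props hR).1 (closedBall_props hR).2.1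
      (closedBall_props hR).2.2 (y := s.y k) (ys := pb.ystar k s.x) (w := t.w k)
      (by simpa using hA.ystar_le k s.x hx) hlam hmono hl hη0.le hη1 hτ0.le hτ
    have h2 : (1 - η) • s.y k + η • proj (Metric.closedBall 0 (pb.R k)) (s.y k - τ • t.w k)
        = t.y k := rfl
    rw [h2] at h1
    have h3 := norm_sq_sub_le_weighted (t.y k) (pb.ystar k s.x) (pb.ystar k t.x) hsg0
    have h4 : ‖pb.ystar k s.x - pb.ystar k t.x‖ ^ 2 ≤ (B / lam) ^ 2 * (η * γ) ^ 2 * ‖t.d‖ ^ 2 := by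
      have := norm_ystar_sub_le hA hU hlam k s.x t.x
      rw [norm_sub_rev s.x, hmv] at this
      refine (pow_le_pow_left₀ (norm_nonneg _) this 2).trans_eq (by ring)
    have h5 : (1 + 1 / sg) * ‖pb.ystar k s.x - pb.ystar k t.x‖ ^ 2
        ≤ (2 / sg) * ((B / lam) ^ 2 * (η * γ) ^ 2 * ‖t.d‖ ^ 2) := by
      refine mul_le_mul ?_ h4 (sq_nonneg _) (by positivity)
      rw [show 2 / sg = 1 / sg + 1 / sg by ring]
      gcongr
      rwa [le_div_iff₀ hsg0, one_mul]
    have h6 : (2 / sg) * ((B / lam) ^ 2 * (η * γ) ^ 2 * ‖t.d‖ ^ 2)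
        = 4 * B ^ 2 / lam ^ 3 * (η * γ ^ 2 / τ) * ‖t.d‖ ^ 2 := by
      rw [hsg]; field_simp; ring
    have h7 := mul_le_mul_of_nonneg_left h1 (show 0 ≤ 1 + sg by linarith)
    rw [show η * τ * lam = 2 * sg by rw [hsg]; ring] at h7
    set ry := ‖s.y k - pb.ystar k s.x‖ ^ 2 with hry
    set ew := ‖t.w k - gradY (pb.gbar k) s.x (s.y k)‖ ^ 2 with hew
    have hry0 : 0 ≤ ry := sq_nonneg _
    have hew0 : 0 ≤ ew := sq_nonneg _
    have h8 : (1 + sg) * ((1 - 2 * sg) * ry) ≤ (1 - sg) * ry := by nlinarith [mul_nonneg (sq_nonneg sg) hry0]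
    have h9 : (1 + sg) * (4 * η * τ / lam * ew) ≤ 2 * (4 * η * τ / lam * ew) :=
      mul_le_mul_of_nonneg_right (by linarith) (by positivity)
    have h10 : 2 * (4 * η * τ / lam * ew) = 8 / lam * (η * τ) * ew := by ring
    linarith
  have hm : (0 : ℝ) < m := by exact_mod_cast hA.m_pos
  have e1 : errGy pb t = (1 / (m : ℝ)) * ∑ k, ‖t.w k - gradY (pb.gbar k) s.x (s.y k)‖ ^ 2 := rfl
  have e2 : errY pb t = (1 / (m : ℝ)) * ∑ k, ‖t.y k - pb.ystar k t.x‖ ^ 2 := rfl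
  have e3 : errY pb s = (1 / (m : ℝ)) * ∑ k, ‖s.y k - pb.ystar k s.x‖ ^ 2 := rfl
  rw [e1, e2, e3]
  refine (mean_mono hk).trans (le_of_eq ?_)
  rw [Finset.sum_add_distrib, Finset.sum_add_distrib, ← Finset.mul_sum, ← Finset.mul_sum]
  simp only [Finset.sum_const, Finset.card_univ, Fintype.card_fin, nsmul_eq_mul]
  have : (1 / (m : ℝ)) * (m * (4 * B ^ 2 / lam ^ 3 * (η * γ ^ 2 / τ) * ‖t.d‖ ^ 2))
      = 4 * B ^ 2 / lam ^ 3 * (η * γ ^ 2 / τ) * ‖t.d‖ ^ 2 := by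
    rw [← mul_assoc, one_div, inv_mul_cancel₀ hm.ne', one_mul]
  rw [mul_add, mul_add, this]
  ring

omit hlam hη1 hx in
-- As y_k lies in its ball, nonexpansiveness bounds its move by ητ‖w_k‖; and ‖w_k‖ is at most its
-- error plus ‖∇_y g‖ ≤ B‖y_k − y_k*‖.
theorem step_drift_le :
    drift (step pb (Params.uniform η γ τ β) s i j ξ ζ)
      ≤ η ^ 2 * γ ^ 2 * ‖(step pb (Params.uniform η γ τ β) s i j ξ ζ).d‖ ^ 2
        + η ^ 2 * τ ^ 2 * (2 * errGy pb (step pb (Params.uniform η γ τ β) s i j ξ ζ)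
          + 2 * B ^ 2 * errY pb s) := by
  have hmv := norm_x_move pb (τ := τ) (β := β) hη0.le hγ0.le s i j ξ ζ
  set t := step pb (Params.uniform η γ τ β) s i j ξ ζ with ht
  have hk : ∀ k, ‖t.y k - s.y k‖ ^ 2 ≤ η ^ 2 * τ ^ 2
      * (2 * ‖t.w k - gradY (pb.gbar k) s.x (s.y k)‖ ^ 2
        + 2 * B ^ 2 * ‖s.y k - pb.ystar k s.x‖ ^ 2) := by
    intro k
    have hyk : s.y k ∈ Metric.closedBall (0 : Vec (e k)) (pb.R k) := by simpa using (hs k).1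
    have h1 := norm_proj_sub_le Metric.isClosed_closedBall (convex_closedBall (0 : Vec (e k)) (pb.R k))
      (s.y k - τ • t.w k) hyk
    have h2 : t.y k - s.y k = η • (proj (Metric.closedBall 0 (pb.R k)) (s.y k - τ • t.w k) - s.y k) := by
      have : t.y k = (1 - η) • s.y k + η • proj (Metric.closedBall 0 (pb.R k)) (s.y k - τ • t.w k) := rfl
      rw [this]; module
    rw [sub_sub_cancel_left, norm_neg, norm_smul, Real.norm_of_nonneg hτ0.le] at h1
    have h3 : ‖t.y k - s.y k‖ ≤ η * (τ * ‖t.w k‖) := by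
      rw [h2, norm_smul, Real.norm_of_nonneg hη0.le]
      exact mul_le_mul_of_nonneg_left h1 hη0.le
    have h4 := norm_sq_le_two_mul_add (t.w k) (gradY (pb.gbar k) s.x (s.y k))
    have hl := (lip_gradY_gbar hA hU k).snd s.x (s.y k) (pb.ystar k s.x)
    rw [gradY_gbar_ystar hA hU, sub_zero] at hl
    have h5 := pow_le_pow_left₀ (norm_nonneg _) hl 2
    calc ‖t.y k - s.y k‖ ^ 2 ≤ (η * (τ * ‖t.w k‖)) ^ 2 := pow_le_pow_left₀ (norm_nonneg _) h3 2
      _ = η ^ 2 * τ ^ 2 * ‖t.w k‖ ^ 2 := by ring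
      _ ≤ _ := mul_le_mul_of_nonneg_left (by rw [mul_pow] at h5; linarith) (by positivity)
  have h0 : drift t = ‖t.x - s.x‖ ^ 2 + (1 / (m : ℝ)) * ∑ k, ‖t.y k - s.y k‖ ^ 2 := rfl
  have e1 : errGy pb t = (1 / (m : ℝ)) * ∑ k, ‖t.w k - gradY (pb.gbar k) s.x (s.y k)‖ ^ 2 := rfl
  have e3 : errY pb s = (1 / (m : ℝ)) * ∑ k, ‖s.y k - pb.ystar k s.x‖ ^ 2 := rfl
  rw [h0, hmv, mul_pow, mul_pow, e1, e3]
  refine add_le_add le_rfl ((mean_mono hk).trans (le_of_eq ?_))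
  rw [← Finset.mul_sum, Finset.sum_add_distrib, ← Finset.mul_sum, ← Finset.mul_sum]
  ring

omit hτ0 in
-- Polarisation −⟨∇F, d⟩ = (‖∇F − d‖² − ‖∇F‖² − ‖d‖²)/2. Half of the resulting ‖d‖² term pays for
-- the quadratic remainder, the other half is kept to pay for the drift and the motion of y*. ‖∇F −
-- d‖² splits into the error of d and the error of the mean of the z_k.
theorem step_F_le (hβ0 : 0 ≤ β) (hβ1 : β ≤ 1) (hsm : 4 * (η * γ) * smoothConst lam B D ≤ 1) :
    pb.F (step pb (Params.uniform η γ τ β) s i j ξ ζ).x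
      ≤ pb.F s.x - η * γ / 2 * ‖gradient pb.F s.x‖ ^ 2
        - η * γ / 4 * ‖(step pb (Params.uniform η γ τ β) s i j ξ ζ).d‖ ^ 2
        + η * γ * ((1 + 2 * zSqLip lam B)
            * errEst pb (step pb (Params.uniform η γ τ β) s i j ξ ζ)
          + 8 * zSqLip lam B * lipConst B D ^ 2 * errY pb s) := by
  have hB := hU.B_nonneg hA i
  have hmv := norm_x_move pb (τ := τ) (β := β) hη0.le hγ0.le s i j ξ ζ
  have htf : Feasible pb (step pb (Params.uniform η γ τ β) s i j ξ ζ) :=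
    hs.step hA ⟨hη0.le, hη1⟩ ⟨hβ0, hβ1⟩ ⟨hβ0, hβ1⟩ ⟨hβ0, hβ1⟩ i j ξ ζ
  set t := step pb (Params.uniform η γ τ β) s i j ξ ζ with ht
  have hdesc := F_descent hA hU hlam hx t.x
  have e1 : t.x - s.x = -((η * γ) • t.d) := by
    have : t.x = s.x - (η * γ) • t.d := rfl
    rw [this]; module
  rw [hmv, e1, inner_neg_right, inner_smul_right] at hdesc
  set g := gradient pb.F s.x with hg
  have e2 : ‖g - t.d‖ ^ 2 = ‖g‖ ^ 2 - 2 * inner ℝ g t.d + ‖t.d‖ ^ 2 := norm_sub_sq_real _ _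
  set zb := (1 / (m : ℝ)) • ∑ k, t.z k with hzb
  have e3 : ‖g - t.d‖ ^ 2 ≤ 2 * errD t + 2 * ‖zb - g‖ ^ 2 := by
    have h := norm_sq_le_two_mul_add (t.d - g) (zb - g)
    rw [norm_sub_rev g]
    have h2 : t.d - g - (zb - g) = t.d - zb := by abel
    rw [h2] at h
    exact h
  have e4 : ‖zb - g‖ ^ 2 ≤ zSqLip lam B * (2 * (errFx pb t + errFy pb t + errGxy pb t + errGyy pb t)
      + 8 * lipConst B D ^ 2 * errY pb s) := by
    rw [hzb, hg, (hasGradientAt_F hA hU hlam s.x).gradient, ← smul_sub, ← Finset.sum_sub_distrib]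
    refine (norm_mean_sq_le hA.m_pos _).trans ?_
    have hk : ∀ k, ‖t.z k - pb.zstar k s.x‖ ^ 2 ≤ zSqLip lam B *
        (2 * (‖t.u k - gradX (pb.fbar k) s.x (s.y k)‖ ^ 2
          + ‖t.v k - gradY (pb.fbar k) s.x (s.y k)‖ ^ 2
          + ‖t.V k - hessXY (pb.gbar k) s.x (s.y k)‖ ^ 2
          + ‖t.H k - hessYY (pb.gbar k) s.x (s.y k)‖ ^ 2)
        + 8 * lipConst B D ^ 2 * ‖s.y k - pb.ystar k s.x‖ ^ 2) := by
      intro k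
      have hP := hA.prob_P k
      have hQ := hA.prob_Q k
      refine (norm_zmap_sub_sq_le hB hlam (htf.zBounds hU k)
        (zBounds_mean hA hU k hx (hA.ystar_le k s.x hx))).trans ?_
      refine mul_le_mul_of_nonneg_left ?_ (by positivity)
      have tri : ∀ {E : Type} [NormedAddCommGroup E] (a : E) {b c : E} {L : ℝ}
          (_ : ‖b - c‖ ^ 2 ≤ L), ‖a - c‖ ^ 2 ≤ 2 * ‖a - b‖ ^ 2 + 2 * L := by
        intro E _ a b c L h
        have h1 := norm_sq_le_two_mul_add (a - c) (b - c)
        rw [sub_sub_sub_cancel_right] at h1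
        linarith
      have k1 := tri (t.u k) ((oracle_fx hA hU k).lip_mean.norm_sq_le s.x s.x (s.y k) (pb.ystar k s.x))
      have k2 := tri (t.v k) ((oracle_fy hA hU k).lip_mean.norm_sq_le s.x s.x (s.y k) (pb.ystar k s.x))
      have k3 := tri (t.V k) ((oracle_gxy hA hU k).lip_mean.norm_sq_le s.x s.x (s.y k) (pb.ystar k s.x))
      have k4 := tri (t.H k) ((oracle_gyy hA hU k).lip_mean.norm_sq_le s.x s.x (s.y k) (pb.ystar k s.x))
      simp only [sub_self, norm_zero, ne_eq, OfNat.ofNat_ne_zero, not_false_eq_true, zero_pow,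
        zero_add] at k1 k2 k3 k4
      linarith
    refine (mean_mono hk).trans (le_of_eq ?_)
    have f1 : errFx pb t = (1 / (m : ℝ)) * ∑ k, ‖t.u k - gradX (pb.fbar k) s.x (s.y k)‖ ^ 2 := rfl
    have f2 : errFy pb t = (1 / (m : ℝ)) * ∑ k, ‖t.v k - gradY (pb.fbar k) s.x (s.y k)‖ ^ 2 := rfl
    have f3 : errGxy pb t = (1 / (m : ℝ)) * ∑ k, ‖t.V k - hessXY (pb.gbar k) s.x (s.y k)‖ ^ 2 := rfl
    have f4 : errGyy pb t = (1 / (m : ℝ)) * ∑ k, ‖t.H k - hessYY (pb.gbar k) s.x (s.y k)‖ ^ 2 := rfl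
    have f5 : errY pb s = (1 / (m : ℝ)) * ∑ k, ‖s.y k - pb.ystar k s.x‖ ^ 2 := rfl
    rw [f1, f2, f3, f4, f5]
    simp only [← Finset.mul_sum, Finset.sum_add_distrib]
    ring
  have hz := zSqLip_nonneg (lam := lam) (B := B)
  have e5 : errD t + zSqLip lam B * (2 * (errFx pb t + errFy pb t + errGxy pb t + errGyy pb t))
      ≤ (1 + 2 * zSqLip lam B) * errEst pb t := by
    have q1 := errFx_nonneg pb t
    have q2 := errFy_nonneg pb t
    have q3 := errGxy_nonneg pb t
    have q4 := errGyy_nonneg pb t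
    have q5 := errGy_nonneg pb t
    have q6 := errD_nonneg t
    have h1 : errEst pb t = errD t + (errFx pb t + errFy pb t + errGxy pb t + errGyy pb t
      + errGy pb t) := rfl
    have h2 : 0 ≤ zSqLip lam B * (errD t + errGy pb t) := by positivity
    rw [h1]
    linarith
  have hηγ : 0 < η * γ := mul_pos hη0 hγ0
  have e6 : smoothConst lam B D * (η * γ * ‖t.d‖) ^ 2 ≤ η * γ / 4 * ‖t.d‖ ^ 2 := by
    have h1 : 0 ≤ η * γ * ‖t.d‖ ^ 2 := by positivity
    have h2 := mul_le_mul_of_nonneg_right hsm h1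
    linarith
  have e7 : η * γ / 2 * ‖g - t.d‖ ^ 2 ≤ η * γ * ((1 + 2 * zSqLip lam B) * errEst pb t
      + 8 * zSqLip lam B * lipConst B D ^ 2 * errY pb s) := by
    calc η * γ / 2 * ‖g - t.d‖ ^ 2 ≤ η * γ / 2 * (2 * errD t + 2 * ‖zb - g‖ ^ 2) := by gcongr
      _ = η * γ * (errD t + ‖zb - g‖ ^ 2) := by ring
      _ ≤ _ := by
        refine mul_le_mul_of_nonneg_left ?_ hηγ.le
        linarith
  rw [e2] at e7
  linarith

end Bilevel

namespace Bilevel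

/-! ### Arithmetic of the Lyapunov function. -/

section Arithmetic

variable {lam C₀ S η γ τ b r A C₁ : ℝ}

/-- The weight 8C₀r/λ makes the contraction of y worth 4C₀ηγy; the F-inequality and the drift term
each consume at most C₀ηγy. The terms in n = ‖d‖² cancel: ηγ/4 is available, and the motion of y*
(by the choice of r = γ/τ) and the drift (by `hbγ`) cost ηγ/8 each. The new estimator error E' is
kept for the averaging step, with total surcharge ηγC₁. -/
theorem potential_pointwise_arith (hlam : 0 < lam) (hC₀ : 0 ≤ C₀) (hη : 0 < η) (hτ : 0 < τ)
    (hr : 0 < r) (hb : 0 < b) (hS : 0 ≤ S) (hA0 : 0 ≤ A)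
    (hγ : γ = r * τ) (hr2 : 64 * C₀ ^ 2 * r ^ 2 ≤ lam) (hC₁ : C₁ = 2 * C₀ + 8 * C₀ ^ 2 / lam)
    (hA : A * (b * η) = 4 * C₁) (hbγ : 96 * C₁ * C₀ * (γ * S) ≤ b)
    (hbτ : 12 * C₁ * C₀ * (τ * S) ≤ b * r) {Φ Φ' y y' E' G' g n : ℝ} (hn : 0 ≤ n) (hy : 0 ≤ y)
    (hE : 0 ≤ E')
    (h1 : Φ' ≤ Φ - η * γ / 2 * g - η * γ / 4 * n + η * γ * (C₀ * E' + C₀ * y))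
    (h2 : y' ≤ (1 - η * τ * lam / 2) * y + C₀ * (η * τ) * E' + C₀ * (η * γ ^ 2 / τ) * n)
    (h3 : G' ≤ η ^ 2 * γ ^ 2 * n + η ^ 2 * τ ^ 2 * (C₀ * E' + C₀ * y)) :
    Φ' + 8 * C₀ * r / lam * y' + A * (E' + 3 * C₀ * S * G')
      ≤ Φ + 8 * C₀ * r / lam * y - η * γ * (g / 2 + 2 * C₀ * y) + (A + η * γ * C₁) * E' := by
  have hγ0 : 0 < γ := by rw [hγ]; positivity
  have hηγ : 0 < η * γ := by positivity
  have k2 := mul_le_mul_of_nonneg_left h2 (show 0 ≤ 8 * C₀ * r / lam by positivity)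
  have k3 := mul_le_mul_of_nonneg_left h3 (show 0 ≤ A * (3 * C₀ * S) by positivity)
  have e1 : 8 * C₀ * r / lam * ((1 - η * τ * lam / 2) * y + C₀ * (η * τ) * E'
      + C₀ * (η * γ ^ 2 / τ) * n) = 8 * C₀ * r / lam * y - η * γ * (4 * C₀) * y
      + η * γ * (8 * C₀ ^ 2 / lam) * E' + η * γ * (8 * C₀ ^ 2 * r ^ 2 / lam) * n := by
    rw [hγ]; field_simp; ring
  have c1 : 8 * C₀ ^ 2 * r ^ 2 / lam ≤ 1 / 8 := by
    rw [div_le_iff₀ hlam]; linarith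
  have c1' := mul_le_mul_of_nonneg_right (mul_le_mul_of_nonneg_left c1 hηγ.le) hn
  have c2 : A * (3 * C₀ * S) * (η ^ 2 * γ ^ 2) ≤ η * γ * (1 / 8) := by
    have : A * (3 * C₀ * S) * (η ^ 2 * γ ^ 2) * b = η * γ * (12 * C₁ * C₀ * (γ * S)) := by
      linear_combination (3 * C₀ * S * η * γ ^ 2) * hA
    refine le_of_mul_le_mul_right ?_ hb
    rw [this]
    have := mul_le_mul_of_nonneg_left hbγ hηγ.le
    linarith
  have c2' := mul_le_mul_of_nonneg_right c2 hn
  have c3 : A * (3 * C₀ * S) * (η ^ 2 * τ ^ 2) ≤ η * γ := by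
    have : A * (3 * C₀ * S) * (η ^ 2 * τ ^ 2) * b = η * τ * (12 * C₁ * C₀ * (τ * S)) := by
      linear_combination (3 * C₀ * S * η * τ ^ 2) * hA
    refine le_of_mul_le_mul_right ?_ hb
    rw [this]
    calc _ ≤ η * τ * (b * r) := mul_le_mul_of_nonneg_left hbτ (by positivity)
      _ = _ := by rw [hγ]; ring
  have c3' := mul_le_mul_of_nonneg_right c3 (show 0 ≤ C₀ * E' + C₀ * y by positivity)
  rw [e1] at k2
  have hE' : η * γ * C₁ * E' = η * γ * (8 * C₀ ^ 2 / lam) * E' + 2 * (η * γ * (C₀ * E')) := by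
    rw [hC₁]; ring
  linarith

/-- With β = bγη² one has Aβ = 4C₁ηγ, so the contraction β/2 yields 2C₁ηγE: half pays the surcharge
ηγC₁, the rest exceeds ηγE. As ηγC₁ ≤ A, two of the three units of AC₀S·G pay for the old drift, and
the third exceeds ηγG because C₀S ≥ 1. The noise is 2A·C₀β²S, of order ηγ·η². -/
theorem potential_mean_arith (hlam : 0 < lam) (hC₀ : 1 ≤ C₀) (hη : 0 < η) (hγ0 : 0 < γ)
    (hb : 0 < b) (hS : 0 ≤ S) (hA0 : 0 ≤ A) (hCS : 1 ≤ C₀ * S)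
    (hC₁ : C₁ = 2 * C₀ + 8 * C₀ ^ 2 / lam)
    (hA : A * (b * η) = 4 * C₁) (hβ : b * γ * η ^ 2 ≤ 1) {Φ y E G g c : ℝ} (hE : 0 ≤ E)
    (hG : 0 ≤ G) (hy : 0 ≤ y)
    (hc : c ≤ (1 - b * γ * η ^ 2 / 2) * E + C₀ * S * G + C₀ * (b * γ * η ^ 2) ^ 2 * S) :
    Φ + 8 * C₀ * r / lam * y - η * γ * (g / 2 + 2 * C₀ * y) + (A + η * γ * C₁) * c
      ≤ Φ + 8 * C₀ * r / lam * y + A * (E + 3 * C₀ * S * G)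
        - η * γ * (g / 2 + y + E + G) + η * γ * (8 * C₁ * C₀ * b * (γ * S)) * η ^ 2 := by
  have hηγ : 0 < η * γ := by positivity
  have hC₁2 : 2 ≤ C₁ := by
    have : 0 ≤ 8 * C₀ ^ 2 / lam := by positivity
    linarith
  set β := b * γ * η ^ 2 with hβd
  have hβ0 : 0 < β := by positivity
  have hAβ : A * β = 4 * C₁ * (η * γ) := by rw [hβd]; linear_combination η * γ * hA
  have hsmall : η * γ * C₁ ≤ A := by
    have : A * β ≤ A * 1 := mul_le_mul_of_nonneg_left hβ hA0
    have : 0 ≤ C₁ * (η * γ) := by positivity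
    linarith
  have k := mul_le_mul_of_nonneg_left hc (show 0 ≤ A + η * γ * C₁ by positivity)
  have t1 : (A + η * γ * C₁) * ((1 - β / 2) * E) ≤ A * E - η * γ * E := by
    have e : (A + η * γ * C₁) * ((1 - β / 2) * E)
      = A * E - A * β / 2 * E + η * γ * C₁ * E - η * γ * C₁ * β / 2 * E := by ring
    have : 0 ≤ η * γ * C₁ * β / 2 * E := by positivity
    have : η * γ * E * 1 ≤ η * γ * E * C₁ := mul_le_mul_of_nonneg_left (by linarith) (by positivity)
    rw [e, hAβ]
    linarith
  have t2 : (A + η * γ * C₁) * (C₀ * S * G) ≤ A * (3 * C₀ * S * G) - η * γ * G := by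
    have a1 : (A + η * γ * C₁) * (C₀ * S * G) ≤ 2 * A * (C₀ * S * G) :=
      mul_le_mul_of_nonneg_right (by linarith) (by positivity)
    have a2 : η * γ * G ≤ A * (C₀ * S * G) := by
      have h1 : η * γ ≤ A := by
        have : η * γ * 1 ≤ η * γ * C₁ := mul_le_mul_of_nonneg_left (by linarith) hηγ.le
        linarith
      calc η * γ * G ≤ A * G := mul_le_mul_of_nonneg_right h1 hG
        _ = A * (1 * G) := by ring
        _ ≤ A * (C₀ * S * G) := by gcongr
    linarith
  have t3 : (A + η * γ * C₁) * (C₀ * β ^ 2 * S) ≤ η * γ * (8 * C₁ * C₀ * b * (γ * S)) * η ^ 2 := by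
    have a1 : (A + η * γ * C₁) * (C₀ * β ^ 2 * S) ≤ 2 * A * (C₀ * β ^ 2 * S) :=
      mul_le_mul_of_nonneg_right (by linarith) (by positivity)
    refine a1.trans (le_of_eq ?_)
    calc 2 * A * (C₀ * β ^ 2 * S) = 2 * (A * β) * (C₀ * β * S) := by ring
      _ = _ := by rw [hAβ, hβd]; ring
  have t4 : η * γ * y ≤ η * γ * (2 * C₀ * y) := by
    refine mul_le_mul_of_nonneg_left ?_ hηγ.le
    nlinarith
  linarith

end Arithmetic

variable {m d : ℕ} {e : Fin m → ℕ} {Ξ Z : Type*} [MeasurableSpace Ξ] [MeasurableSpace Z]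

/-- Decay rate of the estimator error in the Lyapunov analysis. -/
noncomputable def rateConst (lam C₀ : ℝ) : ℝ := 2 * C₀ + 8 * C₀ ^ 2 / lam

/-- The step sizes are small enough for the Lyapunov function to decrease. -/
structure Tuned (pb : Problem m d e Ξ Z) (lam B κ : ℝ) (D : ℕ) (C₀ η γ τ b r : ℝ) : Prop where
  one_le : 1 ≤ C₀
  κ_le : κ ≤ C₀
  B_le : 2 + 2 * B ^ 2 ≤ C₀
  z_le : 1 + 2 * zSqLip lam B ≤ C₀
  zlip_le : 8 * zSqLip lam B * lipConst B D ^ 2 ≤ C₀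
  lam_le : 8 / lam ≤ C₀
  Blam_le : 4 * B ^ 2 / lam ^ 3 ≤ C₀
  est_le : estConst lam B κ D ≤ C₀
  η_pos : 0 < η
  η_le : η ≤ 1
  τ_pos : 0 < τ
  r_pos : 0 < r
  b_pos : 0 < b
  γ_eq : γ = r * τ
  r_le : 64 * C₀ ^ 2 * r ^ 2 ≤ lam
  bγ_le : 96 * rateConst lam C₀ * C₀ * (γ * (pb.Cp / m)) ≤ b
  bτ_le : 12 * rateConst lam C₀ * C₀ * (τ * (pb.Cp / m)) ≤ b * r
  β_le : b * γ * η ^ 2 ≤ 1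
  zβ_le : 16 * zSqLip lam B * (b * γ * η ^ 2) ≤ 1
  τ_le : τ * (B ^ 2 / lam + lam) ≤ 1 / 2
  smooth_le : 4 * (η * γ) * smoothConst lam B D ≤ 1

/-- The Lyapunov function. -/
noncomputable def potential (pb : Problem m d e Ξ Z) (xs : Vec d) (lam C₀ η b r : ℝ)
    (s : State m d e) : ℝ :=
  pb.F s.x - pb.F xs + 8 * C₀ * r / lam * errY pb s
    + 4 * rateConst lam C₀ / (b * η) * (errEst pb s + 3 * C₀ * (pb.Cp / m) * drift s)

/-- The quantity by which the Lyapunov function decreases. -/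
noncomputable def decrease (pb : Problem m d e Ξ Z) (xs : Vec d) (μ : ℝ) (s : State m d e) : ℝ :=
  μ * (pb.F s.x - pb.F xs) / 2 + errY pb s + errEst pb s + drift s

/-- Coefficient of the noise in the Lyapunov recursion. -/
noncomputable def noiseConst (pb : Problem m d e Ξ Z) (lam C₀ γ b : ℝ) : ℝ :=
  8 * rateConst lam C₀ * C₀ * b * (γ * (pb.Cp / m))

/-! ### Mean decrease of the Lyapunov function. -/

variable {pb : Problem m d e Ξ Z} {X : Set (Vec d)} {lam B κ : ℝ} {D : ℕ} {xs : Vec d}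
  {C₀ η γ τ b r μ : ℝ}

theorem Tuned.γ_pos (hT : Tuned pb lam B κ D C₀ η γ τ b r) : 0 < γ := by
  rw [hT.γ_eq]; exact mul_pos hT.r_pos hT.τ_pos

theorem Tuned.rate_pos (hT : Tuned pb lam B κ D C₀ η γ τ b r) (hlam : 0 < lam) :
    0 < rateConst lam C₀ := by
  have := hT.one_le
  unfold rateConst; positivity

variable (hA : Assumptions pb X) (hU : UniformBounds pb lam B κ D) (hlam : 0 < lam)
  (hmin : ∀ x, pb.F xs ≤ pb.F x) (hT : Tuned pb lam B κ D C₀ η γ τ b r)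
  {s : State m d e} (hs : Feasible pb s)

include hA in
theorem scale_nonneg : 0 ≤ pb.Cp / m := div_nonneg (Cp_nonneg hA) (Nat.cast_nonneg _)

include hA hlam hmin hT in
theorem potential_nonneg (s : State m d e) : 0 ≤ potential pb xs lam C₀ η b r s := by
  have := hmin s.x
  have := errY_nonneg pb s
  have := errEst_nonneg pb s
  have := drift_nonneg s
  have := hT.one_le
  have := hT.r_pos
  have := hT.b_pos
  have := hT.η_pos
  have := hT.rate_pos hlam
  have := scale_nonneg hA
  unfold potential
  have : 0 ≤ pb.F s.x - pb.F xs := by linarith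
  positivity

include hmin in
theorem decrease_nonneg (hμ : 0 < μ) (s : State m d e) : 0 ≤ decrease pb xs μ s := by
  have := hmin s.x
  have := errY_nonneg pb s
  have := errEst_nonneg pb s
  have := drift_nonneg s
  have : 0 ≤ pb.F s.x - pb.F xs := by linarith
  unfold decrease
  positivity

include hA hU hlam in
theorem measurable_F_x : Measurable fun s : State m d e => pb.F s.x :=
  (continuous_F hA hU hlam).measurable.comp State.measurable_x

include hA hU hlam in
theorem measurable_potential : Measurable (potential pb xs lam C₀ η b r) :=
  (((measurable_F_x hA hU hlam).sub_const _).add ((measurable_errY hA hU hlam).const_mul _)).add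
    (((measurable_errEst hA hU).add (measurable_drift.const_mul _)).const_mul _)

include hA hU hlam in
theorem measurable_decrease : Measurable (decrease pb xs μ) :=
  ((((((measurable_F_x hA hU hlam).sub_const _).const_mul _).div_const _).add
    (measurable_errY hA hU hlam)).add (measurable_errEst hA hU)).add measurable_drift

include hA hU hlam hmin hT hs

/-- For each i, j and each sample the new potential is first bounded by a deterministic quantity
plus a multiple of the new estimator error; only the latter is then averaged, by `step_errEst`. -/
theorem step_potential (hx : s.x ∈ X) :
    AvgLE pb.p pb.dataLaw (fun i ω => (1 / (m : ℝ)) * ∑ j, potential pb xs lam C₀ η b r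
        (step pb (Params.uniform η γ τ (b * γ * η ^ 2)) s i j ω.1 ω.2))
      (potential pb xs lam C₀ η b r s
        - η * γ * (‖gradient pb.F s.x‖ ^ 2 / 2 + errY pb s + errEst pb s + drift s)
        + η * γ * noiseConst pb lam C₀ γ b * η ^ 2) := by
  have hM := dataLaw_prob hA
  have hm : (0 : ℝ) < m := by exact_mod_cast hA.m_pos
  have hγ := hT.γ_pos
  have hβ0 : 0 ≤ b * γ * η ^ 2 := by have := hT.b_pos; positivity
  have hS := scale_nonneg hA
  have hC0 : 0 ≤ C₀ := zero_le_one.trans hT.one_le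
  have hb := hT.b_pos
  have hη := hT.η_pos
  have hrate := hT.rate_pos hlam
  have hA0 : 0 ≤ 4 * rateConst lam C₀ / (b * η) := by positivity
  have hAeq : 4 * rateConst lam C₀ / (b * η) * (b * η) = 4 * rateConst lam C₀ := by field_simp
  have hest := step_errEst (γ := γ) (τ := τ) hA hU hlam hs hx ⟨hη.le, hT.η_le⟩ hβ0 hT.β_le hT.zβ_le
  set c := (1 - b * γ * η ^ 2 / 2) * errEst pb s + estConst lam B κ D * (pb.Cp / m) * drift s
        + estConst lam B κ D * (b * γ * η ^ 2) ^ 2 * (pb.Cp / m) with hc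
  have hup := (AvgLE.const (M := pb.dataLaw) hA.p_sum
    (pb.F s.x - pb.F xs + 8 * C₀ * r / lam * errY pb s
      - η * γ * (‖gradient pb.F s.x‖ ^ 2 / 2 + 2 * C₀ * errY pb s))).add
    (hest.const_mul (show 0 ≤ 4 * rateConst lam C₀ / (b * η) + η * γ * rateConst lam C₀ by positivity))
  refine (AvgLE.of_le (fun i => (hA.p_pos i).le) hup (fun i => ?_) (fun i ω => ?_)
    (fun i ω => ?_)).mono ?_
  · exact (Finset.measurable_sum _ fun j _ => (measurable_potential hA hU hlam).comp
      (measurable_step_data hA hU _ s i j)).const_mul _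
  · exact mul_nonneg (by positivity)
      (Finset.sum_nonneg fun j _ => potential_nonneg hA hlam hmin hT _)
  · have key : ∀ j, potential pb xs lam C₀ η b r
          (step pb (Params.uniform η γ τ (b * γ * η ^ 2)) s i j ω.1 ω.2)
        ≤ (pb.F s.x - pb.F xs + 8 * C₀ * r / lam * errY pb s
          - η * γ * (‖gradient pb.F s.x‖ ^ 2 / 2 + 2 * C₀ * errY pb s))
          + (4 * rateConst lam C₀ / (b * η) + η * γ * rateConst lam C₀)
            * errEst pb (step pb (Params.uniform η γ τ (b * γ * η ^ 2)) s i j ω.1 ω.2) := by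
      intro j
      have h1 := step_F_le hA hU hlam hT.η_pos hT.η_le hγ hs hx i j ω.1 ω.2 hβ0 hT.β_le hT.smooth_le
        (τ := τ)
      have h2 := step_errY_le hA hU hlam hT.η_pos hT.η_le hγ hT.τ_pos hx i j ω.1 ω.2 hT.τ_le
        (β := b * γ * η ^ 2)
      have h3 := step_drift_le hA hU hT.η_pos hγ hT.τ_pos hs i j ω.1 ω.2 (β := b * γ * η ^ 2)
      set t := step pb (Params.uniform η γ τ (b * γ * η ^ 2)) s i j ω.1 ω.2
      have hE := errEst_nonneg pb t
      have hy := errY_nonneg pb s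
      have hw : errGy pb t ≤ errEst pb t := by
        have := errFx_nonneg pb t
        have := errFy_nonneg pb t
        have := errGxy_nonneg pb t
        have := errGyy_nonneg pb t
        have := errD_nonneg t
        unfold errEst; linarith
      have hw0 := errGy_nonneg pb t
      have hτ := hT.τ_pos
      refine potential_pointwise_arith hlam hC0 hη hτ hT.r_pos hb hS hA0 hT.γ_eq hT.r_le
        rfl hAeq hT.bγ_le hT.bτ_le (sq_nonneg ‖t.d‖) hy hE ?_ ?_ ?_
      · have := hT.z_le
        have := hT.zlip_le
        have : η * γ * ((1 + 2 * zSqLip lam B) * errEst pb t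
            + 8 * zSqLip lam B * lipConst B D ^ 2 * errY pb s)
            ≤ η * γ * (C₀ * errEst pb t + C₀ * errY pb s) := by gcongr
        linarith
      · have := hT.lam_le
        have := hT.Blam_le
        refine h2.trans ?_
        gcongr
      · refine h3.trans ?_
        have := hT.B_le
        have : 2 ≤ C₀ := by nlinarith
        have : 2 * B ^ 2 ≤ C₀ := by linarith
        gcongr
    calc (1 / (m : ℝ)) * ∑ j, potential pb xs lam C₀ η b r
          (step pb (Params.uniform η γ τ (b * γ * η ^ 2)) s i j ω.1 ω.2)
        ≤ _ := mean_mono key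
      _ = _ := by
        rw [Finset.sum_add_distrib, ← Finset.mul_sum, Finset.sum_const, Finset.card_univ,
          Fintype.card_fin, nsmul_eq_mul]
        field_simp
  · have hCS : 1 ≤ C₀ * (pb.Cp / m) := (one_le_scale hA hU).trans
      (mul_le_mul_of_nonneg_right hT.κ_le hS)
    have hG := drift_nonneg s
    refine potential_mean_arith hlam hT.one_le hη hγ hb hS hA0 hCS rfl hAeq hT.β_le
      (errEst_nonneg pb s) (drift_nonneg s) (errY_nonneg pb s) ?_
    have := hT.est_le
    rw [hc]
    gcongr

/-- Reformulation with extended nonnegative integrals. The decrease is moved to the left, so no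
subtraction occurs and no integrability has to be carried along the run. -/
theorem lintegral_step_potential (hx : s.x ∈ X) (hμ : 0 < μ)
    (hPL : μ * (pb.F s.x - pb.F xs) ≤ ‖gradient pb.F s.x‖ ^ 2) :
    ∑ i, ∑ j, ENNReal.ofReal (pb.p i / m) * (∫⁻ ω, ENNReal.ofReal (potential pb xs lam C₀ η b r
        (step pb (Params.uniform η γ τ (b * γ * η ^ 2)) s i j ω.1 ω.2)) ∂(pb.dataLaw i))
      + ENNReal.ofReal (η * γ * decrease pb xs μ s)
      ≤ ENNReal.ofReal (potential pb xs lam C₀ η b r s)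
        + ENNReal.ofReal (η * γ * noiseConst pb lam C₀ γ b * η ^ 2) := by
  have hm : (0 : ℝ) < m := by exact_mod_cast hA.m_pos
  obtain ⟨hint, hle⟩ := step_potential hA hU hlam hmin hT hs hx
  have hP0 := potential_nonneg hA hlam hmin hT (s := s)
  have hP0' := fun t => potential_nonneg hA hlam hmin hT (s := t)
  have hγ := hT.γ_pos
  have hη := hT.η_pos
  have e : ∀ i, ∑ j, ENNReal.ofReal (pb.p i / m) * (∫⁻ ω, ENNReal.ofReal
        (potential pb xs lam C₀ η b r
        (step pb (Params.uniform η γ τ (b * γ * η ^ 2)) s i j ω.1 ω.2)) ∂(pb.dataLaw i))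
      = ENNReal.ofReal (pb.p i * ∫ ω, (1 / (m : ℝ)) * ∑ j, potential pb xs lam C₀ η b r
        (step pb (Params.uniform η γ τ (b * γ * η ^ 2)) s i j ω.1 ω.2) ∂(pb.dataLaw i)) := by
    intro i
    have hp := (hA.p_pos i).le
    have hmeas : ∀ j, Measurable fun ω : Ξ × Z => potential pb xs lam C₀ η b r
        (step pb (Params.uniform η γ τ (b * γ * η ^ 2)) s i j ω.1 ω.2) := fun j =>
      (measurable_potential hA hU hlam).comp (measurable_step_data hA hU _ s i j)
    have hsum : ∀ ω : Ξ × Z, ∑ j, ENNReal.ofReal (potential pb xs lam C₀ η b r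
        (step pb (Params.uniform η γ τ (b * γ * η ^ 2)) s i j ω.1 ω.2))
        = ENNReal.ofReal (∑ j, potential pb xs lam C₀ η b r
        (step pb (Params.uniform η γ τ (b * γ * η ^ 2)) s i j ω.1 ω.2)) := fun ω =>
      (ENNReal.ofReal_sum_of_nonneg fun j _ => hP0' _).symm
    rw [← Finset.mul_sum, ← lintegral_finsetSum _ fun j _ => (hmeas j).ennreal_ofReal]
    simp only [hsum]
    rw [ENNReal.ofReal_mul hp, ofReal_integral_eq_lintegral_ofReal (hint i)
      (Filter.Eventually.of_forall fun ω => mul_nonneg (by positivity)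
        (Finset.sum_nonneg fun j _ => hP0' _)), div_eq_mul_one_div, ENNReal.ofReal_mul hp]
    simp only [ENNReal.ofReal_mul (show 0 ≤ 1 / (m : ℝ) by positivity)]
    rw [lintegral_const_mul, mul_assoc]
    exact (Finset.measurable_sum _ fun j _ => hmeas j).ennreal_ofReal
  simp only [e]
  rw [← ENNReal.ofReal_sum_of_nonneg fun i _ => mul_nonneg (hA.p_pos i).le
    (integral_nonneg fun ω => mul_nonneg (by positivity) (Finset.sum_nonneg fun j _ => hP0' _)),
    ← ENNReal.ofReal_add (Finset.sum_nonneg fun i _ => mul_nonneg (hA.p_pos i).le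
    (integral_nonneg fun ω => mul_nonneg (by positivity) (Finset.sum_nonneg fun j _ => hP0' _)))
    (mul_nonneg (by positivity) (decrease_nonneg hmin hμ s))]
  have hN : 0 ≤ noiseConst pb lam C₀ γ b := by
    have := hT.one_le
    have := hT.b_pos
    have := hT.rate_pos hlam
    have := scale_nonneg hA
    unfold noiseConst; positivity
  rw [← ENNReal.ofReal_add hP0 (by positivity)]
  refine ENNReal.ofReal_le_ofReal ?_
  have : η * γ * decrease pb xs μ s
      ≤ η * γ * (‖gradient pb.F s.x‖ ^ 2 / 2 + errY pb s + errEst pb s + drift s) := by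
    unfold decrease
    gcongr
  linarith

end Bilevel

namespace Bilevel

/-! ### State error and restarts. -/

section Restart

variable {m d : ℕ} {e : Fin m → ℕ} {Ξ Z : Type*} [MeasurableSpace Ξ] [MeasurableSpace Z]
  {pb : Problem m d e Ξ Z} {X : Set (Vec d)} {lam B κ : ℝ} {D : ℕ}

/-- A restart makes the previous point the current one, so errors at the previous point become
errors at the current one. -/
theorem stateError_eq (pb : Problem m d e Ξ Z) (s : State m d e) :
    stateError pb s = errY pb s + errEst pb s.restart := by
  have hz : ∀ i, s.restart.z i = s.z i := fun _ => rfl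
  unfold stateError errEst errY errD errFx errFy errGxy errGyy errGy
  simp only [Finset.sum_add_distrib, mul_add, hz]
  simp only [State.restart]
  ring

theorem stateError_nonneg (pb : Problem m d e Ξ Z) (s : State m d e) : 0 ≤ stateError pb s := by
  rw [stateError_eq]
  exact add_nonneg (errY_nonneg _ _) (errEst_nonneg _ _)

theorem drift_restart (s : State m d e) : drift s.restart = 0 := by
  simp [drift, State.restart]

variable (hA : Assumptions pb X) (hU : UniformBounds pb lam B κ D)

include hA hU in
theorem measurable_stateError (hlam : 0 < lam) : Measurable (stateError pb) := by
  have h : stateError pb = fun s => errY pb s + errEst pb s.restart :=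
    funext fun s => stateError_eq pb s
  rw [h]
  exact (measurable_errY hA hU hlam).add ((measurable_errEst hA hU).comp State.measurable_restart)

include hA in
theorem mean_norm_sq_shift_le {E : Fin m → Type*} [∀ k, NormedAddCommGroup (E k)]
    {h : ∀ k, Vec d → Vec (e k) → E k} {L : ℝ}
    (hh : ∀ k, JointLipschitz norm (h k) L) (a : ∀ k, E k) (s : State m d e) :
    (1 / (m : ℝ)) * ∑ k, ‖a k - h k s.x (s.y k)‖ ^ 2
      ≤ 2 * ((1 / (m : ℝ)) * ∑ k, ‖a k - h k s.xprev (s.yprev k)‖ ^ 2) + 2 * L ^ 2 * drift s := by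
  have hm : (0 : ℝ) < m := by exact_mod_cast hA.m_pos
  have h1 : ∀ k, ‖a k - h k s.x (s.y k)‖ ^ 2 ≤ 2 * ‖a k - h k s.xprev (s.yprev k)‖ ^ 2
      + 2 * L ^ 2 * (‖s.x - s.xprev‖ ^ 2 + ‖s.y k - s.yprev k‖ ^ 2) := by
    intro k
    have h2 := norm_sq_sub_le_weighted (a k) (h k s.xprev (s.yprev k)) (h k s.x (s.y k)) one_pos
    have h3 : ‖h k s.xprev (s.yprev k) - h k s.x (s.y k)‖ ^ 2
        ≤ L ^ 2 * (‖s.x - s.xprev‖ ^ 2 + ‖s.y k - s.yprev k‖ ^ 2) := by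
      rw [norm_sub_rev]
      have := pow_le_pow_left₀ (norm_nonneg _) (hh k s.x s.xprev (s.y k) (s.yprev k)) 2
      rwa [mul_pow, Real.sq_sqrt (by positivity)] at this
    linarith
  refine (mean_mono h1).trans (le_of_eq ?_)
  rw [Finset.sum_add_distrib, ← Finset.mul_sum, ← Finset.mul_sum, Finset.sum_add_distrib,
    Finset.sum_const, Finset.card_univ, Fintype.card_fin, nsmul_eq_mul]
  unfold drift
  field_simp

include hA hU in
-- Moving the reference point from the previous to the current one costs 2Λ²·drift for each of the
-- five families. This is why the drift is part of `decrease`.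
theorem stateError_le (s : State m d e) :
    stateError pb s ≤ (2 + 10 * lipConst B D ^ 2) * (errY pb s + errEst pb s + drift s) := by
  have hP := hA.prob_P
  have hQ := hA.prob_Q
  have h1 := mean_norm_sq_shift_le hA (E := fun _ => Vec d)
    (fun k => (oracle_fx hA hU k).lip_mean) s.u s
  have h2 := mean_norm_sq_shift_le hA (E := fun k => Vec (e k))
    (fun k => (oracle_fy hA hU k).lip_mean) s.v s
  have h3 := mean_norm_sq_shift_le hA (E := fun k => Mat d (e k))
    (fun k => (oracle_gxy hA hU k).lip_mean) s.V s
  have h4 := mean_norm_sq_shift_le hA (E := fun k => Mat (e k) (e k))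
    (fun k => (oracle_gyy hA hU k).lip_mean) s.H s
  have h5 := mean_norm_sq_shift_le hA (E := fun k => Vec (e k))
    (fun k => (oracle_gy hA hU k).lip_mean) s.w s
  have e1 : errEst pb s.restart
      = errD s + ((1 / (m : ℝ)) * ∑ k, ‖s.u k - gradX (pb.fbar k) s.x (s.y k)‖ ^ 2
        + (1 / (m : ℝ)) * ∑ k, ‖s.v k - gradY (pb.fbar k) s.x (s.y k)‖ ^ 2
        + (1 / (m : ℝ)) * ∑ k, ‖s.V k - hessXY (pb.gbar k) s.x (s.y k)‖ ^ 2
        + (1 / (m : ℝ)) * ∑ k, ‖s.H k - hessYY (pb.gbar k) s.x (s.y k)‖ ^ 2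
        + (1 / (m : ℝ)) * ∑ k, ‖s.w k - gradY (pb.gbar k) s.x (s.y k)‖ ^ 2) := rfl
  have e2 : errEst pb s = errD s + (errFx pb s + errFy pb s + errGxy pb s + errGyy pb s
      + errGy pb s) := rfl
  have hD := errD_nonneg s
  have hY := errY_nonneg pb s
  have hG := drift_nonneg s
  have hE := errEst_nonneg pb s
  have h6 : errEst pb s.restart ≤ 2 * errEst pb s + 10 * lipConst B D ^ 2 * drift s := by
    rw [e1, e2]
    unfold errFx errFy errGxy errGyy errGy
    linarith
  rw [stateError_eq]
  nlinarith [sq_nonneg (lipConst B D), mul_nonneg (sq_nonneg (lipConst B D)) hY,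
    mul_nonneg (sq_nonneg (lipConst B D)) hE]

end Restart

/-! ### Laws of the iterates: integration, total mass, feasibility. -/

section Laws

variable {m d : ℕ} {e : Fin m → ℕ} {Ξ Z : Type*} [MeasurableSpace Ξ] [MeasurableSpace Z]
  {pb : Problem m d e Ξ Z} {X : Set (Vec d)} {lam B κ : ℝ} {D : ℕ}
  (hA : Assumptions pb X) (hU : UniformBounds pb lam B κ D)

include hA hU in
theorem lintegral_stepLaw (θ : Params) (ν : Measure (State m d e)) [SFinite ν]
    {f : State m d e → ENNReal} (hf : Measurable f) :
    ∫⁻ s, f s ∂(stepLaw pb θ ν) = ∫⁻ s, ∑ i, ∑ j, ENNReal.ofReal (pb.p i / m)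
      * ∫⁻ ω, f (step pb θ s i j ω.1 ω.2) ∂(pb.dataLaw i) ∂ν := by
  have hM := dataLaw_prob hA
  have hm : ∀ i j, Measurable fun q : State m d e × (Ξ × Z) => f (step pb θ q.1 i j q.2.1 q.2.2) :=
    fun i j => hf.comp (measurable_step hA hU θ i j)
  have hm' : ∀ i j, Measurable fun s => ∫⁻ ω, f (step pb θ s i j ω.1 ω.2) ∂(pb.dataLaw i) :=
    fun i j => (hm i j).lintegral_prod_right'
  rw [lintegral_finsetSum _ fun i _ => Finset.measurable_sum _ fun j _ => (hm' i j).const_mul _]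
  unfold stepLaw
  rw [lintegral_finsetSum_measure]
  refine Finset.sum_congr rfl fun i _ => ?_
  rw [lintegral_finsetSum _ fun j _ => (hm' i j).const_mul _, lintegral_finsetSum_measure]
  refine Finset.sum_congr rfl fun j _ => ?_
  rw [lintegral_smul_measure, lintegral_map hf (measurable_step hA hU θ i j),
    lintegral_const_mul _ (hm' i j), smul_eq_mul]
  congr 1
  exact lintegral_prod (μ := ν) (ν := pb.dataLaw i) _ (hm i j).aemeasurable

include hA in
theorem sum_weights : ∑ i, ∑ _j : Fin m, ENNReal.ofReal (pb.p i / m) = 1 := by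
  have hm : (0 : ℝ) < m := by exact_mod_cast hA.m_pos
  have h : ∀ i, ∑ _j : Fin m, ENNReal.ofReal (pb.p i / m) = ENNReal.ofReal (pb.p i) := by
    intro i
    rw [Finset.sum_const, Finset.card_univ, Fintype.card_fin, nsmul_eq_mul,
      ← ENNReal.ofReal_natCast, ← ENNReal.ofReal_mul hm.le, mul_div_cancel₀ _ hm.ne']
  simp only [h]
  rw [← ENNReal.ofReal_sum_of_nonneg fun i _ => (hA.p_pos i).le, hA.p_sum, ENNReal.ofReal_one]

include hA hU in
theorem isProbabilityMeasure_stepLaw (θ : Params) (ν : Measure (State m d e))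
    [IsProbabilityMeasure ν] : IsProbabilityMeasure (stepLaw pb θ ν) := by
  have hM := dataLaw_prob hA
  constructor
  rw [← lintegral_one, lintegral_stepLaw hA hU θ ν measurable_const]
  simp only [lintegral_const, measure_univ, mul_one, sum_weights hA]

include hA hU in
theorem isProbabilityMeasure_iterLaw (θ : Params) (ν : Measure (State m d e))
    [IsProbabilityMeasure ν] (t : ℕ) : IsProbabilityMeasure (iterLaw pb θ ν t) := by
  induction t with
  | zero => exact Measure.isProbabilityMeasure_map State.measurable_restart.aemeasurable
  | succ t ih => exact isProbabilityMeasure_stepLaw hA hU θ _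

theorem lintegral_rsvrbLaw (θ : Params) (T : ℕ) (ν : Measure (State m d e))
    (f : State m d e → ENNReal) : ∫⁻ s, f s ∂(rsvrbLaw pb θ T ν)
      = ((T : ENNReal) + 1)⁻¹ * ∑ t ∈ Finset.range (T + 1), ∫⁻ s, f s ∂(iterLaw pb θ ν t) := by
  unfold rsvrbLaw
  rw [lintegral_smul_measure, lintegral_finsetSum_measure, smul_eq_mul]

include hA hU in
theorem isProbabilityMeasure_rsvrbLaw (θ : Params) (T : ℕ) (ν : Measure (State m d e))
    [IsProbabilityMeasure ν] : IsProbabilityMeasure (rsvrbLaw pb θ T ν) := by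
  have := isProbabilityMeasure_iterLaw hA hU θ ν
  constructor
  rw [← lintegral_one, lintegral_rsvrbLaw]
  simp only [lintegral_one, measure_univ, Finset.sum_const, Finset.card_range, nsmul_eq_mul, mul_one,
    Nat.cast_add, Nat.cast_one]
  exact ENNReal.inv_mul_cancel (by simp) (by finiteness)

variable {θ : Params} (hη : 0 ≤ θ.η ∧ θ.η ≤ 1) (hfx : 0 ≤ θ.βfx ∧ θ.βfx ≤ 1)
  (hfy : 0 ≤ θ.βfy ∧ θ.βfy ≤ 1) (hgxy : 0 ≤ θ.βgxy ∧ θ.βgxy ≤ 1)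

include hA hU hη hfx hfy hgxy

theorem ae_feasible_stepLaw (ν : Measure (State m d e)) [IsProbabilityMeasure ν]
    (h : ∀ᵐ s ∂ν, Feasible pb s) : ∀ᵐ s ∂(stepLaw pb θ ν), Feasible pb s := by
  have hM := dataLaw_prob hA
  rw [ae_iff]
  unfold stepLaw
  rw [Measure.finsetSum_apply]
  refine Finset.sum_eq_zero fun i _ => ?_
  rw [Measure.finsetSum_apply]
  refine Finset.sum_eq_zero fun j _ => ?_
  rw [Measure.smul_apply, smul_eq_mul]
  refine mul_eq_zero_of_right _ ?_
  rw [← ae_iff, ae_map_iff (measurable_step hA hU θ i j).aemeasurable (measurableSet_feasible pb)]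
  have h' : ∀ᵐ q ∂(ν.prod (pb.dataLaw i)), Feasible pb q.1 :=
    Measure.quasiMeasurePreserving_fst.ae h
  filter_upwards [h'] with q hq
  exact hq.step hA hη hfx hfy hgxy i j q.2.1 q.2.2

theorem ae_feasible_iterLaw (ν : Measure (State m d e)) [IsProbabilityMeasure ν]
    (h : ∀ᵐ s ∂ν, Feasible pb s) (t : ℕ) : ∀ᵐ s ∂(iterLaw pb θ ν t), Feasible pb s := by
  have hpr := isProbabilityMeasure_iterLaw hA hU θ ν
  induction t with
  | zero =>
    unfold iterLaw
    rw [ae_map_iff State.measurable_restart.aemeasurable (measurableSet_feasible pb)]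
    exact h
  | succ t ih =>
    have := hpr t
    exact ae_feasible_stepLaw hA hU hη hfx hfy hgxy _ ih

theorem ae_feasible_rsvrbLaw (ν : Measure (State m d e)) [IsProbabilityMeasure ν]
    (h : ∀ᵐ s ∂ν, Feasible pb s) (T : ℕ) : ∀ᵐ s ∂(rsvrbLaw pb θ T ν), Feasible pb s := by
  rw [ae_iff]
  unfold rsvrbLaw
  rw [Measure.smul_apply, Measure.finsetSum_apply, smul_eq_mul]
  refine mul_eq_zero_of_right _ (Finset.sum_eq_zero fun t _ => ?_)
  exact ae_iff.1 (ae_feasible_iterLaw hA hU hη hfx hfy hgxy ν h t)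

end Laws

/-! ### Analysis of one stage. -/

section Stage

variable {m d : ℕ} {e : Fin m → ℕ} {Ξ Z : Type*} [MeasurableSpace Ξ] [MeasurableSpace Z]
  {pb : Problem m d e Ξ Z} {X : Set (Vec d)} {lam B κ : ℝ} {D : ℕ} {xs : Vec d}
  {C₀ η γ τ b r μ : ℝ}
  (hA : Assumptions pb X) (hU : UniformBounds pb lam B κ D) (hlam : 0 < lam)
  (hmin : ∀ x, pb.F xs ≤ pb.F x) (hT : Tuned pb lam B κ D C₀ η γ τ b r) (hμ : 0 < μ)
  (hPL : ∀ x ∈ X, μ * (pb.F x - pb.F xs) ≤ ‖gradient pb.F x‖ ^ 2)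
  {ν : Measure (State m d e)} [IsProbabilityMeasure ν]

include hA hU hlam hmin hT hμ hPL in
theorem lintegral_potential_stepLaw (hf : ∀ᵐ s ∂ν, Feasible pb s) (hx : ∀ᵐ s ∂ν, s.x ∈ X) :
    ∫⁻ s, ENNReal.ofReal (potential pb xs lam C₀ η b r s)
        ∂(stepLaw pb (Params.uniform η γ τ (b * γ * η ^ 2)) ν)
      + ENNReal.ofReal (η * γ) * ∫⁻ s, ENNReal.ofReal (decrease pb xs μ s) ∂ν
      ≤ ∫⁻ s, ENNReal.ofReal (potential pb xs lam C₀ η b r s) ∂ν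
        + ENNReal.ofReal (η * γ * noiseConst pb lam C₀ γ b * η ^ 2) := by
  have hηγ : 0 ≤ η * γ := mul_nonneg hT.η_pos.le hT.γ_pos.le
  have hmd := (measurable_decrease (xs := xs) (μ := μ) hA hU hlam).ennreal_ofReal
  rw [lintegral_stepLaw hA hU _ _ (measurable_potential hA hU hlam).ennreal_ofReal,
    ← lintegral_const_mul _ hmd, ← lintegral_add_right _ (hmd.const_mul _)]
  refine (lintegral_mono_ae (g := fun s => ENNReal.ofReal (potential pb xs lam C₀ η b r s)
    + ENNReal.ofReal (η * γ * noiseConst pb lam C₀ γ b * η ^ 2)) ?_).trans ?_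
  · filter_upwards [hf, hx] with s hs hxs
    rw [← ENNReal.ofReal_mul hηγ]
    exact lintegral_step_potential hA hU hlam hmin hT hs hxs hμ (hPL _ hxs)
  · rw [lintegral_add_right _ measurable_const]
    simp

include hA hU hlam hmin hT hμ hPL in
-- Telescoping. Membership in X is used only at the times from which a step is made.
theorem sum_lintegral_decrease_le (hf : ∀ᵐ s ∂ν, Feasible pb s) (T : ℕ)
    (hx : ∀ t < T, ∀ᵐ s ∂(iterLaw pb (Params.uniform η γ τ (b * γ * η ^ 2)) ν t), s.x ∈ X) :
    ∫⁻ s, ENNReal.ofReal (potential pb xs lam C₀ η b r s)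
        ∂(iterLaw pb (Params.uniform η γ τ (b * γ * η ^ 2)) ν T)
      + ENNReal.ofReal (η * γ) * ∑ t ∈ Finset.range T, ∫⁻ s, ENNReal.ofReal (decrease pb xs μ s)
        ∂(iterLaw pb (Params.uniform η γ τ (b * γ * η ^ 2)) ν t)
      ≤ ∫⁻ s, ENNReal.ofReal (potential pb xs lam C₀ η b r s.restart) ∂ν
        + T * ENNReal.ofReal (η * γ * noiseConst pb lam C₀ γ b * η ^ 2) := by
  have hβ : 0 ≤ b * γ * η ^ 2 ∧ b * γ * η ^ 2 ≤ 1 :=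
    ⟨by have := hT.b_pos; have := hT.γ_pos; positivity, hT.β_le⟩
  induction T with
  | zero =>
    simp only [Finset.range_zero, Finset.sum_empty, mul_zero, add_zero, CharP.cast_eq_zero, zero_mul]
    unfold iterLaw
    rw [lintegral_map (measurable_potential hA hU hlam).ennreal_ofReal State.measurable_restart]
  | succ T ih =>
    have ih' := ih fun t ht => hx t (ht.trans (Nat.lt_succ_self T))
    have hpr := isProbabilityMeasure_iterLaw hA hU
      (Params.uniform η γ τ (b * γ * η ^ 2)) ν T
    have h1 := lintegral_potential_stepLaw hA hU hlam hmin hT hμ hPL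
      (ae_feasible_iterLaw hA hU (θ := Params.uniform η γ τ (b * γ * η ^ 2))
        ⟨hT.η_pos.le, hT.η_le⟩ hβ hβ hβ ν hf T) (hx T (Nat.lt_succ_self T))
    rw [Finset.sum_range_succ, mul_add, Nat.cast_succ, add_mul, one_mul]
    change ∫⁻ s, ENNReal.ofReal (potential pb xs lam C₀ η b r s)
        ∂(stepLaw pb (Params.uniform η γ τ (b * γ * η ^ 2))
          (iterLaw pb (Params.uniform η γ τ (b * γ * η ^ 2)) ν T)) + _ ≤ _
    rw [add_comm (ENNReal.ofReal (η * γ) * _), ← add_assoc, ← add_assoc]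
    refine (add_le_add_left h1 _).trans ?_
    rw [add_right_comm]
    exact add_le_add_left ih' _

include hlam hT in
-- The drift vanishes after a restart; the factor 1/η in front of the state error survives and is
-- responsible for the term 1/(η²γ) in the stage lengths.
theorem potential_restart_le (s : State m d e) :
    potential pb xs lam C₀ η b r s.restart ≤ (pb.F s.x - pb.F xs)
      + (8 * C₀ * r / lam + 4 * rateConst lam C₀ / (b * η)) * stateError pb s := by
  have hy := errY_nonneg pb s
  have hE := errEst_nonneg pb s.restart
  have := hT.one_le
  have := hT.r_pos
  have := hT.b_pos
  have := hT.η_pos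
  have := hT.rate_pos hlam
  have h1 : 0 ≤ 8 * C₀ * r / lam * errEst pb s.restart := by positivity
  have h2 : 0 ≤ 4 * rateConst lam C₀ / (b * η) * errY pb s := by positivity
  rw [stateError_eq]
  unfold potential
  rw [drift_restart]
  have e1 : errY pb s.restart = errY pb s := rfl
  have e2 : s.restart.x = s.x := rfl
  rw [e1, e2]
  linarith

/-- Laws of feasible states with given bounds on the expected suboptimality and on the expected
error of the state. -/
structure Controlled (pb : Problem m d e Ξ Z) (xs : Vec d) (φ σ : ℝ) (ν : Measure (State m d e)) :
    Prop where
  prob : IsProbabilityMeasure ν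
  feasible : ∀ᵐ s ∂ν, Feasible pb s
  gap : ∫⁻ s, ENNReal.ofReal (pb.F s.x - pb.F xs) ∂ν ≤ ENNReal.ofReal φ
  error : ∫⁻ s, ENNReal.ofReal (stateError pb s) ∂ν ≤ ENNReal.ofReal σ

omit [IsProbabilityMeasure ν] in
include hA hU hlam hmin hT hμ hPL in
-- The mean of `decrease` under the output law is the average over the T + 1 possible output times.
-- It controls both the gap, with factor 2/μ, and the state error, with a factor free of μ; the
-- latter is what the next stage needs.
theorem Controlled.rsvrbLaw {φ σ : ℝ} (hν : Controlled pb xs φ σ ν) (hφ : 0 ≤ φ) (hσ : 0 ≤ σ)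
    (T : ℕ)
    (hx : ∀ t ≤ T, ∀ᵐ s ∂(iterLaw pb (Params.uniform η γ τ (b * γ * η ^ 2)) ν t), s.x ∈ X)
    {ρ : ℝ} (hρ : (φ + (8 * C₀ * r / lam + 4 * rateConst lam C₀ / (b * η)) * σ) / (η * γ * (T + 1))
      + noiseConst pb lam C₀ γ b * η ^ 2 ≤ ρ) :
    Controlled pb xs (2 / μ * ρ) ((2 + 10 * lipConst B D ^ 2) * ρ)
      (rsvrbLaw pb (Params.uniform η γ τ (b * γ * η ^ 2)) T ν) := by
  have hpr := hν.prob
  have hγ := hT.γ_pos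
  have hη := hT.η_pos
  have hηγ : 0 < η * γ := by positivity
  have hA1 : 0 ≤ 8 * C₀ * r / lam + 4 * rateConst lam C₀ / (b * η) := by
    have := hT.one_le
    have := hT.r_pos
    have := hT.b_pos
    have := hT.rate_pos hlam
    positivity
  have hN : 0 ≤ noiseConst pb lam C₀ γ b := by
    have := hT.one_le
    have := hT.b_pos
    have := hT.rate_pos hlam
    have := scale_nonneg hA
    unfold noiseConst; positivity
  have hβ : 0 ≤ b * γ * η ^ 2 ∧ b * γ * η ^ 2 ≤ 1 :=
    ⟨by have := hT.b_pos; positivity, hT.β_le⟩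
  have hmΦ : Measurable fun s : State m d e => ENNReal.ofReal (pb.F s.x - pb.F xs) :=
    ((measurable_F_x hA hU hlam).sub_const _).ennreal_ofReal
  have hmS := (measurable_stateError hA hU hlam).ennreal_ofReal
  have h0 : ∫⁻ s, ENNReal.ofReal (potential pb xs lam C₀ η b r s.restart) ∂ν
      ≤ ENNReal.ofReal (φ + (8 * C₀ * r / lam + 4 * rateConst lam C₀ / (b * η)) * σ) := by
    calc ∫⁻ s, ENNReal.ofReal (potential pb xs lam C₀ η b r s.restart) ∂ν
        ≤ ∫⁻ s, (ENNReal.ofReal (pb.F s.x - pb.F xs)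
          + ENNReal.ofReal (8 * C₀ * r / lam + 4 * rateConst lam C₀ / (b * η))
            * ENNReal.ofReal (stateError pb s)) ∂ν := by
          refine lintegral_mono fun s => ?_
          rw [← ENNReal.ofReal_mul hA1, ← ENNReal.ofReal_add (sub_nonneg.2 (hmin _))
            (mul_nonneg hA1 (stateError_nonneg pb s))]
          exact ENNReal.ofReal_le_ofReal (potential_restart_le hlam hT s)
      _ ≤ _ := by
          rw [lintegral_add_left hmΦ, lintegral_const_mul _ hmS,
            ENNReal.ofReal_add hφ (mul_nonneg hA1 hσ), ENNReal.ofReal_mul hA1]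
          exact add_le_add hν.gap (mul_le_mul_right hν.error _)
  -- One step beyond the run is used in the analysis, since the decrease at time T is charged to the
  -- step from T to T + 1.
  have h1 := sum_lintegral_decrease_le hA hU hlam hmin hT hμ hPL hν.feasible (T + 1)
    fun t ht => hx t (Nat.lt_succ_iff.1 ht)
  have h2 : ∫⁻ s, ENNReal.ofReal (decrease pb xs μ s)
      ∂(Bilevel.rsvrbLaw pb (Params.uniform η γ τ (b * γ * η ^ 2)) T ν) ≤ ENNReal.ofReal ρ := by
    rw [lintegral_rsvrbLaw]
    set q := ∑ t ∈ Finset.range (T + 1), ∫⁻ s, ENNReal.ofReal (decrease pb xs μ s)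
        ∂(iterLaw pb (Params.uniform η γ τ (b * γ * η ^ 2)) ν t) with hq
    have h3 : ENNReal.ofReal (η * γ) * q
        ≤ ENNReal.ofReal (η * γ * ((T : ℝ) + 1) * ρ) := by
      refine (le_trans le_add_self h1).trans ((add_le_add_left h0 _).trans ?_)
      rw [← ENNReal.ofReal_natCast, ← ENNReal.ofReal_mul (Nat.cast_nonneg _),
        ← ENNReal.ofReal_add (by positivity) (by positivity)]
      refine ENNReal.ofReal_le_ofReal ?_
      have := mul_le_mul_of_nonneg_left hρ (show 0 ≤ η * γ * ((T : ℝ) + 1) by positivity)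
      refine le_trans (le_of_eq ?_) this
      push_cast
      field_simp
    rw [mul_assoc, ENNReal.ofReal_mul hηγ.le] at h3
    have h4 : q ≤ ENNReal.ofReal (((T : ℝ) + 1) * ρ) :=
      (ENNReal.mul_le_mul_iff_right (by simpa using hηγ) ENNReal.ofReal_ne_top).1 h3
    rw [ENNReal.ofReal_mul (by positivity)] at h4
    have h5 : ENNReal.ofReal ((T : ℝ) + 1) = (T : ENNReal) + 1 := by
      rw [ENNReal.ofReal_add (Nat.cast_nonneg _) zero_le_one]; simp
    rw [h5] at h4
    calc ((T : ENNReal) + 1)⁻¹ * q ≤ ((T : ENNReal) + 1)⁻¹ * (((T : ENNReal) + 1)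
          * ENNReal.ofReal ρ) := by gcongr
      _ = ENNReal.ofReal ρ := by
          rw [← mul_assoc, ENNReal.inv_mul_cancel (by simp) (by finiteness), one_mul]
  refine ⟨isProbabilityMeasure_rsvrbLaw hA hU _ _ _,
    ae_feasible_rsvrbLaw hA hU (θ := Params.uniform η γ τ (b * γ * η ^ 2))
      ⟨hη.le, hT.η_le⟩ hβ hβ hβ ν hν.feasible T, ?_, ?_⟩
  · rw [ENNReal.ofReal_mul (by positivity)]
    refine le_trans ?_ (mul_le_mul_right h2 _)
    rw [← lintegral_const_mul _ (measurable_decrease hA hU hlam).ennreal_ofReal]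
    refine lintegral_mono fun s => ?_
    rw [← ENNReal.ofReal_mul (by positivity)]
    refine ENNReal.ofReal_le_ofReal ?_
    have hy := errY_nonneg pb s
    have hE := errEst_nonneg pb s
    have hG := drift_nonneg s
    have : 2 / μ * decrease pb xs μ s = (pb.F s.x - pb.F xs)
        + 2 / μ * (errY pb s + errEst pb s + drift s) := by
      unfold decrease; field_simp; ring
    rw [this]
    have : 0 ≤ 2 / μ * (errY pb s + errEst pb s + drift s) := by positivity
    linarith
  · have hM : 0 ≤ 2 + 10 * lipConst B D ^ 2 := by positivity
    rw [ENNReal.ofReal_mul hM]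
    refine le_trans ?_ (mul_le_mul_right h2 _)
    rw [← lintegral_const_mul _ (measurable_decrease hA hU hlam).ennreal_ofReal]
    refine lintegral_mono fun s => ?_
    rw [← ENNReal.ofReal_mul hM]
    refine ENNReal.ofReal_le_ofReal ((stateError_le hA hU s).trans ?_)
    refine mul_le_mul_of_nonneg_left ?_ hM
    have : 0 ≤ μ * (pb.F s.x - pb.F xs) / 2 := by
      have : 0 ≤ pb.F s.x - pb.F xs := sub_nonneg.2 (hmin _)
      positivity
    unfold decrease
    linarith

end Stage

end Bilevel

namespace Bilevel

/-! ### Choice of the numerical constants. -/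

section ConstantChoice

/-- Coefficient of the initial error in the stage recursion. -/
noncomputable def startConst (lam C₀ b r : ℝ) : ℝ := 8 * C₀ * r / lam + 4 * rateConst lam C₀ / b

/-- Numerical constants for which the stage recursion closes. -/
structure GoodConstants (lam B κ Δ E₀ : ℝ) (D : ℕ) (c : Constants) (C₀ b r : ℝ) : Prop where
  one_le : 1 ≤ C₀
  κ_le : κ ≤ C₀
  B_le : 2 + 2 * B ^ 2 ≤ C₀
  z_le : 1 + 2 * zSqLip lam B ≤ C₀
  zlip_le : 8 * zSqLip lam B * lipConst B D ^ 2 ≤ C₀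
  lam_le : 8 / lam ≤ C₀
  Blam_le : 4 * B ^ 2 / lam ^ 3 ≤ C₀
  est_le : estConst lam B κ D ≤ C₀
  γ_pos : 0 < c.cγ
  τ_pos : 0 < c.cτ
  η_pos : 0 < c.η₀
  T_pos : 0 < c.cT
  r_pos : 0 < r
  b_pos : 0 < b
  bfx_eq : c.bfx = b
  bfy_eq : c.bfy = b
  bgxy_eq : c.bgxy = b
  bgyy_eq : c.bgyy = b
  bgy_eq : c.bgy = b
  bd_eq : c.bd = b
  γ_eq : c.cγ = r * c.cτ
  r_le : 64 * C₀ ^ 2 * r ^ 2 ≤ lam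
  bγ_le : 96 * rateConst lam C₀ * C₀ * c.cγ ≤ b
  bτ_le : 12 * rateConst lam C₀ * C₀ * c.cτ ≤ b * r
  η_le : c.η₀ ≤ 1
  β_le : b * (c.cγ * κ) * c.η₀ ^ 2 ≤ 1
  zβ_le : 16 * zSqLip lam B * (b * (c.cγ * κ) * c.η₀ ^ 2) ≤ 1
  τ_le : c.cτ * κ * (B ^ 2 / lam + lam) ≤ 1 / 2
  Lg_le : 3 * B * (c.cτ * κ) ≤ 1
  smooth_le : 4 * (c.cγ * κ) * smoothConst lam B D ≤ 1
  grad_le : 2 * (c.cγ * κ) * (4 * zLip B lam * lipConst B D * (1 + B / lam)) ≤ 1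
  Lp_le : 120 * B ^ 2 * κ * c.cγ ≤ 1
  ε_eq : c.cε = 32 * rateConst lam C₀ * C₀ * b
  T_first : B * (Δ + startConst lam C₀ b r * E₀)
    ≤ c.cT * (8 * rateConst lam C₀ * C₀ * b * c.cγ * c.η₀ ^ 2)
  T_later : 8 + 4 * startConst lam C₀ b r * (2 + 10 * lipConst B D ^ 2) ≤ c.cT

/-- The constants are fixed in the order C₀, cτ, r (hence cγ = r·cτ), b, η₀, cT. Each condition
restricts the latest constant involved in terms of earlier ones. There is no circularity because
γ·C(p)/m = cγ is independent of η₀. -/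
theorem exists_goodConstants {lam B κ Δ E₀ : ℝ} (D : ℕ) (hlam : 0 < lam) (hB : 1 ≤ B) (hκ : 1 ≤ κ)
    (hΔ : 0 ≤ Δ) (hE : 0 ≤ E₀) : ∃ c C₀ b r, GoodConstants lam B κ Δ E₀ D c C₀ b r := by
  have hB0 : 0 < B := by linarith
  have hκ0 : 0 < κ := by linarith
  have hz := zSqLip_nonneg (lam := lam) (B := B)
  have hsm := smoothConst_nonneg (D := D) hlam hB0.le
  have hΛ := lipConst_nonneg (D := D) hB0.le
  have hzl : 0 ≤ zLip B lam := zero_le_one.trans (zLip_ge_one hB0.le hlam)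
  set g := 4 * zLip B lam * lipConst B D * (1 + B / lam) with hg
  have hg0 : 0 ≤ g := by positivity
  -- A sum of nonnegative terms dominates each of them; the absolute value avoids a sign check for
  -- `estConst`.
  obtain ⟨C₀, hC₀⟩ : ∃ C₀ : ℝ, C₀ = 1 + κ + (2 + 2 * B ^ 2) + (1 + 2 * zSqLip lam B)
    + 8 * zSqLip lam B * lipConst B D ^ 2 + 8 / lam + 4 * B ^ 2 / lam ^ 3
    + |estConst lam B κ D| := ⟨_, rfl⟩
  have p1 : 0 ≤ 8 * zSqLip lam B * lipConst B D ^ 2 := by positivity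
  have p2 : 0 ≤ 8 / lam := by positivity
  have p3 : 0 ≤ 4 * B ^ 2 / lam ^ 3 := by positivity
  have p4 := abs_nonneg (estConst lam B κ D)
  have p5 := le_abs_self (estConst lam B κ D)
  have p6 := sq_nonneg B
  have hC1 : 1 ≤ C₀ := by linarith
  have hR : 0 < rateConst lam C₀ := by unfold rateConst; positivity
  -- The summands of the denominator serve `τ_le` and `Lg_le`; the final 1 only adds slack.
  obtain ⟨cτ, hcτ⟩ : ∃ cτ : ℝ, cτ = 1 / (2 * κ * (B ^ 2 / lam + lam) + 3 * B * κ + 1) := ⟨_, rfl⟩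
  have hq : 0 < 2 * κ * (B ^ 2 / lam + lam) + 3 * B * κ + 1 := by positivity
  have hτ0 : 0 < cτ := by rw [hcτ]; positivity
  have hτ1 : cτ * (2 * κ * (B ^ 2 / lam + lam) + 3 * B * κ + 1) = 1 := by rw [hcτ]; field_simp
  have t1 : 0 ≤ cτ * (κ * (B ^ 2 / lam + lam)) := by positivity
  have t2 : 0 ≤ cτ * (B * κ) := by positivity
  -- r = 1/q. The first summand serves `r_le`, the 1 gives r ≤ 1, and the bracket serves `Lp_le`,
  -- `smooth_le` and `grad_le`.
  obtain ⟨q, hqd⟩ : ∃ q : ℝ, q = 64 * C₀ ^ 2 / lam + 1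
    + cτ * κ * (120 * B ^ 2 + 4 * smoothConst lam B D + 2 * g) := ⟨_, rfl⟩
  have q1 : 0 ≤ 64 * C₀ ^ 2 / lam := by positivity
  have q2 : 0 ≤ cτ * κ * (120 * B ^ 2) := by positivity
  have q3 : 0 ≤ cτ * κ * (4 * smoothConst lam B D) := by positivity
  have q4 : 0 ≤ cτ * κ * (2 * g) := by positivity
  have hq0 : 0 < q := by linarith
  obtain ⟨r, hr⟩ : ∃ r : ℝ, r = 1 / q := ⟨_, rfl⟩
  have hr0 : 0 < r := by rw [hr]; positivity
  have hrq : r * q = 1 := by rw [hr]; field_simp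
  have hrx : ∀ x, x ≤ q → r * x ≤ 1 := fun x hx => by
    rw [← hrq]; exact mul_le_mul_of_nonneg_left hx hr0.le
  have hr1 : r ≤ 1 := by have := hrx 1 (by linarith); linarith
  have hrlam : 64 * C₀ ^ 2 * r ^ 2 ≤ lam := by
    have h1 := hrx (64 * C₀ ^ 2 / lam) (by linarith)
    rw [← mul_div_assoc, div_le_iff₀ hlam] at h1
    have : r * (64 * C₀ ^ 2) * r ≤ r * (64 * C₀ ^ 2) * 1 :=
      mul_le_mul_of_nonneg_left hr1 (by positivity)
    linarith
  obtain ⟨cγ, hcγ⟩ : ∃ cγ : ℝ, cγ = r * cτ := ⟨_, rfl⟩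
  have hγ0 : 0 < cγ := by rw [hcγ]; positivity
  obtain ⟨b, hb⟩ : ∃ b : ℝ, b = 96 * rateConst lam C₀ * C₀ * cγ
    + 12 * rateConst lam C₀ * C₀ * cτ / r + 1 := ⟨_, rfl⟩
  have b1 : 0 ≤ 96 * rateConst lam C₀ * C₀ * cγ := by positivity
  have b2 : 0 ≤ 12 * rateConst lam C₀ * C₀ * cτ / r := by positivity
  have hb0 : 0 < b := by linarith
  obtain ⟨η, hη⟩ : ∃ η : ℝ, η = 1 / (1 + b * (cγ * κ) * (1 + 16 * zSqLip lam B)) := ⟨_, rfl⟩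
  have e1 : 0 ≤ b * (cγ * κ) := by positivity
  have e2 : 0 ≤ b * (cγ * κ) * (16 * zSqLip lam B) := by positivity
  have hη0 : 0 < η := by rw [hη]; positivity
  have hηq : η * (1 + b * (cγ * κ) * (1 + 16 * zSqLip lam B)) = 1 := by
    rw [hη]; field_simp
  have hηx : ∀ x, 0 ≤ x → x ≤ 1 + b * (cγ * κ) * (1 + 16 * zSqLip lam B) → x * η ^ 2 ≤ 1 := by
    intro x hx0 hx
    have h1 : η ≤ 1 := by
      rw [← hηq]; exact le_mul_of_one_le_right hη0.le (by linarith)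
    have h2 : x * η ≤ 1 := by
      rw [← hηq, mul_comm]; exact mul_le_mul_of_nonneg_left hx hη0.le
    calc x * η ^ 2 = x * η * η := by ring
      _ ≤ 1 * 1 := mul_le_mul h2 h1 hη0.le zero_le_one
      _ = 1 := one_mul 1
  have hη1 : η ≤ 1 := by
    rw [← hηq]; exact le_mul_of_one_le_right hη0.le (by linarith)
  have hN : 0 < 8 * rateConst lam C₀ * C₀ * b * cγ * η ^ 2 := by positivity
  have hA : 0 ≤ startConst lam C₀ b r := by unfold startConst; positivity
  -- The quotient is for the first stage, the rest for the later ones.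
  obtain ⟨cT, hcT⟩ : ∃ cT : ℝ, cT = 8 + 4 * startConst lam C₀ b r * (2 + 10 * lipConst B D ^ 2)
    + B * (Δ + startConst lam C₀ b r * E₀) / (8 * rateConst lam C₀ * C₀ * b * cγ * η ^ 2) :=
    ⟨_, rfl⟩
  have s1 : 0 ≤ 4 * startConst lam C₀ b r * (2 + 10 * lipConst B D ^ 2) := by positivity
  have s2 : 0 ≤ B * (Δ + startConst lam C₀ b r * E₀)
    / (8 * rateConst lam C₀ * C₀ * b * cγ * η ^ 2) := by positivity
  refine ⟨⟨cγ, cτ, η, 32 * rateConst lam C₀ * C₀ * b, cT, b, b, b, b, b, b⟩, C₀, b, r, ?_⟩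
  exact
    { one_le := hC1
      κ_le := by linarith
      B_le := by linarith
      z_le := by linarith
      zlip_le := by linarith
      lam_le := by linarith
      Blam_le := by linarith
      est_le := by linarith
      γ_pos := hγ0
      τ_pos := hτ0
      η_pos := hη0
      T_pos := by show 0 < cT; linarith
      r_pos := hr0
      b_pos := hb0
      bfx_eq := rfl
      bfy_eq := rfl
      bgxy_eq := rfl
      bgyy_eq := rfl
      bgy_eq := rfl
      bd_eq := rfl
      γ_eq := hcγ
      r_le := hrlam
      bγ_le := by show _ * cγ ≤ b; linarith
      bτ_le := by
        show _ * cτ ≤ b * r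
        rw [← div_le_iff₀ hr0]; linarith
      η_le := hη1
      β_le := hηx _ e1 (by linarith)
      zβ_le := by
        show 16 * zSqLip lam B * (b * (cγ * κ) * η ^ 2) ≤ 1
        have := hηx _ e2 (by linarith)
        linarith
      τ_le := by show cτ * κ * _ ≤ _; linarith
      Lg_le := by show _ * (cτ * κ) ≤ _; linarith
      smooth_le := by
        show 4 * (cγ * κ) * _ ≤ 1
        have := hrx _ (show cτ * κ * (4 * smoothConst lam B D) ≤ q by linarith)
        rw [hcγ]; linarith
      grad_le := by
        show 2 * (cγ * κ) * g ≤ 1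
        have := hrx _ (show cτ * κ * (2 * g) ≤ q by linarith)
        rw [hcγ]; linarith
      Lp_le := by
        show 120 * B ^ 2 * κ * cγ ≤ 1
        have := hrx _ (show cτ * κ * (120 * B ^ 2) ≤ q by linarith)
        rw [hcγ]; linarith
      ε_eq := rfl
      T_first := by
        show _ ≤ cT * _
        rw [← div_le_iff₀ hN]; linarith
      T_later := by show _ ≤ cT; linarith }

variable {m d : ℕ} {e : Fin m → ℕ} {Ξ Z : Type*} [MeasurableSpace Ξ] [MeasurableSpace Z]
  {pb : Problem m d e Ξ Z} {X : Set (Vec d)} {lam B κ Δ E₀ : ℝ} {D : ℕ} {xs : Vec d}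
  {c : Constants} {C₀ b r μ : ℝ}
  (hA : Assumptions pb X) (hU : UniformBounds pb lam B κ D) (hlam : 0 < lam)
  (hc : GoodConstants lam B κ Δ E₀ D c C₀ b r)

theorem GoodConstants.pos (hc : GoodConstants lam B κ Δ E₀ D c C₀ b r) (hlam : 0 < lam) : c.Pos := by
  have := hc.one_le
  have := hc.b_pos
  have hR : 0 < rateConst lam C₀ := by unfold rateConst; positivity
  refine ⟨hc.γ_pos, hc.τ_pos, hc.η_pos, ?_, hc.T_pos, ?_, ?_, ?_, ?_, ?_, ?_⟩
  · rw [hc.ε_eq]; positivity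
  all_goals simp only [hc.bfx_eq, hc.bfy_eq, hc.bgxy_eq, hc.bgyy_eq, hc.bgy_eq, hc.bd_eq, hc.b_pos]

include hA hU in
theorem Cp_pos : 0 < pb.Cp := by
  have hm : (0 : ℝ) < m := by exact_mod_cast hA.m_pos
  rcases (Cp_nonneg hA).lt_or_eq with h | h
  · exact h
  · have := one_le_scale hA hU
    rw [← h] at this
    norm_num at this

include hA hU in
-- From κC(p)/m ≥ 1. Conditions bounding γ or τ alone are thereby reduced to bounds on cγκ and cτκ.
theorem inv_scale_le {a : ℝ} (ha : 0 ≤ a) : a * (m / pb.Cp) ≤ a * κ := by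
  have hm : (0 : ℝ) < m := by exact_mod_cast hA.m_pos
  have hC := Cp_pos hA hU
  have h := one_le_scale hA hU
  refine mul_le_mul_of_nonneg_left ?_ ha
  rw [div_le_iff₀ hC]
  rw [mul_div_assoc', le_div_iff₀ hm, one_mul] at h
  exact h

include hA hU in
theorem scale_mul_cancel (a : ℝ) : a * (m / pb.Cp) * (pb.Cp / m) = a := by
  have hm : (0 : ℝ) < m := by exact_mod_cast hA.m_pos
  have hC := Cp_pos hA hU
  field_simp

include hA hU hc in
theorem GoodConstants.gam_pos : 0 < gam c pb := by
  have hm : (0 : ℝ) < m := by exact_mod_cast hA.m_pos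
  have hC := Cp_pos hA hU
  have := hc.γ_pos
  unfold gam; positivity

include hA hU hlam hc in
-- Valid for every η ≤ η₀ with the same C₀, b and r, so all stages share one analysis.
theorem GoodConstants.tuned {η : ℝ} (hη0 : 0 < η) (hη : η ≤ c.η₀) :
    Tuned pb lam B κ D C₀ η (gam c pb) (tau c pb) b r := by
  have hm : (0 : ℝ) < m := by exact_mod_cast hA.m_pos
  have i₀ : Fin m := ⟨0, hA.m_pos⟩
  have hB := hU.B_nonneg hA i₀
  have hC := Cp_pos hA hU
  have hγ := hc.gam_pos hA hU
  have hγκ : gam c pb ≤ c.cγ * κ := inv_scale_le hA hU hc.γ_pos.le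
  have hγκ0 : 0 ≤ c.cγ * κ := hγ.le.trans hγκ
  have hτκ : tau c pb ≤ c.cτ * κ := inv_scale_le hA hU hc.τ_pos.le
  have hsm := smoothConst_nonneg (D := D) hlam hB
  have hz := zSqLip_nonneg (lam := lam) (B := B)
  have hb := hc.b_pos
  have hη1 := hη.trans hc.η_le
  have hβ : b * gam c pb * η ^ 2 ≤ b * (c.cγ * κ) * c.η₀ ^ 2 := by gcongr
  exact
    { one_le := hc.one_le
      κ_le := hc.κ_le
      B_le := hc.B_le
      z_le := hc.z_le
      zlip_le := hc.zlip_le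
      lam_le := hc.lam_le
      Blam_le := hc.Blam_le
      est_le := hc.est_le
      η_pos := hη0
      η_le := hη1
      τ_pos := by have := hc.τ_pos; unfold tau; positivity
      r_pos := hc.r_pos
      b_pos := hb
      γ_eq := by unfold gam tau; rw [hc.γ_eq]; ring
      r_le := hc.r_le
      bγ_le := by unfold gam; rw [scale_mul_cancel hA hU]; exact hc.bγ_le
      bτ_le := by unfold tau; rw [scale_mul_cancel hA hU]; exact hc.bτ_le
      β_le := hβ.trans hc.β_le
      zβ_le := (mul_le_mul_of_nonneg_left hβ (by positivity)).trans hc.zβ_le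
      τ_le := (mul_le_mul_of_nonneg_right hτκ (by positivity)).trans hc.τ_le
      smooth_le := by
        refine le_trans ?_ hc.smooth_le
        have : η * gam c pb ≤ 1 * (c.cγ * κ) := by gcongr
        rw [one_mul] at this
        gcongr }

include hA hU hlam hc in
theorem GoodConstants.admissible : Admissible c pb X := by
  have hm : (0 : ℝ) < m := by exact_mod_cast hA.m_pos
  have i₀ : Fin m := ⟨0, hA.m_pos⟩
  have hB := hU.B_nonneg hA i₀
  have hC := Cp_pos hA hU
  have hγ := hc.gam_pos hA hU
  have hγκ : gam c pb ≤ c.cγ * κ := inv_scale_le hA hU hc.γ_pos.le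
  have hγκ0 : 0 ≤ c.cγ * κ := hγ.le.trans hγκ
  have hτκ : tau c pb ≤ c.cτ * κ := inv_scale_le hA hU hc.τ_pos.le
  have hT := hc.tuned hA hU hlam hc.η_pos le_rfl
  have hη := hc.η_pos
  refine ⟨?_, ?_, hc.η_le, fun x hx x' hx' => ?_, ?_⟩
  · refine le_trans ?_ hc.Lg_le
    have := hT.τ_pos
    have := hU.Lg_le
    calc 3 * pb.Lg * tau c pb ≤ 3 * B * tau c pb := by gcongr
      _ ≤ 3 * B * (c.cτ * κ) := by gcongr
  · have h1 : pb.Lp ≤ 5 * B ^ 2 * (κ * pb.Cp) := by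
      unfold Problem.Lp
      calc ∑ i, (pb.Lfx i ^ 2 + pb.Lfy i ^ 2 + pb.Lgy i ^ 2 + pb.Lgxy i ^ 2 + pb.Lgyy i ^ 2) / pb.p i
          ≤ ∑ _i : Fin m, 5 * B ^ 2 * (κ * (pb.Cp / m)) := by
            refine Finset.sum_le_sum fun i _ => ?_
            have h := hA.const_nonneg i
            have h' := hU.const_le i
            rw [div_eq_mul_one_div]
            refine mul_le_mul ?_ (inv_p_le hA hU i) (by have := hA.p_pos i; positivity)
              (by positivity)
            have s1 := pow_le_pow_left₀ h.2.2.2.2.2.1 h'.2.2.2.2.2.1 2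
            have s2 := pow_le_pow_left₀ h.2.2.2.2.2.2.1 h'.2.2.2.2.2.2.1 2
            have s3 := pow_le_pow_left₀ h.2.2.2.2.2.2.2.1 h'.2.2.2.2.2.2.2.1 2
            have s4 := pow_le_pow_left₀ h.2.2.2.2.2.2.2.2.1 h'.2.2.2.2.2.2.2.2.1 2
            have s5 := pow_le_pow_left₀ h.2.2.2.2.2.2.2.2.2.1 h'.2.2.2.2.2.2.2.2.2 2
            linarith
        _ = 5 * B ^ 2 * (κ * pb.Cp) := by
            rw [Finset.sum_const, Finset.card_univ, Fintype.card_fin, nsmul_eq_mul]; field_simp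
    calc 24 * pb.Lp * gam c pb ≤ 24 * (5 * B ^ 2 * (κ * pb.Cp)) * gam c pb := by gcongr
      _ = 120 * B ^ 2 * κ * c.cγ * m := by unfold gam; field_simp; ring
      _ ≤ 1 * m := mul_le_mul_of_nonneg_right hc.Lp_le hm.le
      _ = m := one_mul _
  · have h1 := norm_gradient_F_sub_le hA hU hlam hx hx'
    have hz : 0 ≤ zLip B lam := zero_le_one.trans (zLip_ge_one hB hlam)
    have hΛ := lipConst_nonneg (D := D) hB
    calc 2 * c.η₀ * gam c pb * ‖gradient pb.F x - gradient pb.F x'‖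
        ≤ 2 * 1 * (c.cγ * κ) * (4 * zLip B lam * lipConst B D * (1 + B / lam) * ‖x - x'‖) := by
          have := hc.η_le
          gcongr
      _ = 2 * (c.cγ * κ) * (4 * zLip B lam * lipConst B D * (1 + B / lam)) * ‖x - x'‖ := by ring
      _ ≤ 1 * ‖x - x'‖ := mul_le_mul_of_nonneg_right hc.grad_le (norm_nonneg _)
      _ = ‖x - x'‖ := one_mul _
  · have h : b * gam c pb * c.η₀ ^ 2 ≤ 1 := hT.β_le
    simp only [hc.bfx_eq, hc.bfy_eq, hc.bgxy_eq, hc.bgyy_eq, hc.bgy_eq, hc.bd_eq, List.mem_cons,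
      List.not_mem_nil, or_false, or_self]
    rintro _ rfl
    exact h

end ConstantChoice

end Bilevel

namespace Bilevel

/-! ### The schedule of stages and the restart induction. -/

section Schedule

variable {m d : ℕ} {e : Fin m → ℕ} {Ξ Z : Type*} [MeasurableSpace Ξ] [MeasurableSpace Z]
  {pb : Problem m d e Ξ Z} {X : Set (Vec d)} {lam B κ Δ E₀ : ℝ} {D : ℕ} {xs : Vec d}
  {c : Constants} {C₀ b r μ : ℝ}
  (hA : Assumptions pb X) (hU : UniformBounds pb lam B κ D) (hlam : 0 < lam)
  (hc : GoodConstants lam B κ Δ E₀ D c C₀ b r) (hμ : 0 < μ)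

include hA hU in
theorem epsOne_eq : epsOne c pb μ = c.cε * c.cγ * c.η₀ ^ 2 / μ := by
  have hm : (0 : ℝ) < m := by exact_mod_cast hA.m_pos
  have hC := Cp_pos hA hU
  unfold epsOne gam
  field_simp

include hA hU hlam hc hμ

theorem etaStage_eq (k : ℕ) : etaStage c pb μ k = Real.sqrt (c.η₀ ^ 2 / 2 ^ (k - 1)) := by
  have hm : (0 : ℝ) < m := by exact_mod_cast hA.m_pos
  have hC := Cp_pos hA hU
  have hp := hc.pos hlam
  have h1 := hp.1
  have h2 := hp.2.2.2.1
  unfold etaStage epsStage epsOne gam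
  congr 1
  field_simp

theorem etaStage_sq (k : ℕ) : etaStage c pb μ k ^ 2 = c.η₀ ^ 2 / 2 ^ (k - 1) := by
  rw [etaStage_eq hA hU hlam hc hμ, Real.sq_sqrt (by positivity)]

theorem etaStage_pos (k : ℕ) : 0 < etaStage c pb μ k := by
  have := hc.η_pos
  rw [etaStage_eq hA hU hlam hc hμ]
  positivity

theorem etaStage_le (k : ℕ) : etaStage c pb μ k ≤ c.η₀ := by
  refine le_of_sq_le_sq ?_ hc.η_pos.le
  rw [etaStage_sq hA hU hlam hc hμ]
  exact div_le_self (sq_nonneg _) (one_le_pow₀ one_le_two)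

omit hA hU hlam hμ in
theorem paramsStage_eq (k : ℕ) : paramsStage c pb μ k = Params.uniform (etaStage c pb μ k)
    (gam c pb) (tau c pb) (b * gam c pb * etaStage c pb μ k ^ 2) := by
  unfold paramsStage Params.uniform
  rw [hc.bfx_eq, hc.bfy_eq, hc.bgxy_eq, hc.bgyy_eq, hc.bgy_eq, hc.bd_eq]

theorem epsStage_eq (k : ℕ) :
    epsStage c pb μ k = c.cε * c.cγ * etaStage c pb μ k ^ 2 / μ := by
  rw [etaStage_sq hA hU hlam hc hμ]
  unfold epsStage
  rw [epsOne_eq hA hU]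
  field_simp

omit hA hU hlam hc hμ in
/-- Bound for the expected Lyapunov decrease at the output of a stage. -/
noncomputable def stageBound (lam C₀ b : ℝ) (c : Constants) (η : ℝ) : ℝ :=
  2 * (8 * rateConst lam C₀ * C₀ * b * c.cγ) * η ^ 2

omit [MeasurableSpace Ξ] [MeasurableSpace Z] hA hU hμ in
theorem start_coeff_le {η : ℝ} (hη : 0 < η) (hη1 : η ≤ 1) :
    8 * C₀ * r / lam + 4 * rateConst lam C₀ / (b * η) ≤ startConst lam C₀ b r / η := by
  have := hc.one_le
  have := hc.r_pos
  have := hc.b_pos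
  have h1 : 0 ≤ 8 * C₀ * r / lam := by positivity
  have h2 : 8 * C₀ * r / lam ≤ 8 * C₀ * r / lam / η := by
    rw [le_div_iff₀ hη]; exact mul_le_of_le_one_right h1 hη1
  unfold startConst
  rw [add_div, div_div (4 * _)]
  linarith

omit hA hU hlam hμ in
theorem first_length_le : 1 / (μ * etaStage c pb μ 1 ^ 2 * gam c pb) * c.cT
    ≤ lengthStage c pb μ 1 := by
  unfold lengthStage
  simp only [le_refl, if_true]
  refine le_trans ?_ (Nat.le_ceil _)
  rw [mul_comm]
  exact mul_le_mul_of_nonneg_left (le_max_right _ _) hc.T_pos.le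

omit hA hU hlam hμ in
theorem later_length_le {k : ℕ} (hk : 1 < k) :
    c.cT / (μ * etaStage c pb μ k * gam c pb) ≤ lengthStage c pb μ k ∧
    c.cT / (etaStage c pb μ k ^ 2 * gam c pb) ≤ lengthStage c pb μ k := by
  unfold lengthStage
  simp only [not_le.2 hk, if_false]
  constructor <;> refine le_trans ?_ (Nat.le_ceil _) <;> rw [div_eq_mul_one_div]
  · exact mul_le_mul_of_nonneg_left (le_max_left _ _) hc.T_pos.le
  · exact mul_le_mul_of_nonneg_left (le_max_right _ _) hc.T_pos.le

omit hlam hc hμ in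
theorem noiseConst_gam (c : Constants) : noiseConst pb lam C₀ (gam c pb) b
    = 8 * rateConst lam C₀ * C₀ * b * c.cγ := by
  unfold noiseConst gam
  rw [scale_mul_cancel hA hU]

/-- With N the noise constant, N η² of the bound is noise and the remaining N η² must cover the
initial potential, at most (Δ + s·E₀)/η with s = `startConst lam C₀ b r`. As T ≥ cT/(μη²γ), this
needs cT·N·η² ≥ μ(Δ + s·E₀), and μ ≤ B makes the requirement independent of μ. -/
theorem first_stage_arith (hμB : μ ≤ B) (hΔ : 0 ≤ Δ) (hE : 0 ≤ E₀) :
    (Δ + (8 * C₀ * r / lam + 4 * rateConst lam C₀ / (b * etaStage c pb μ 1)) * E₀)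
      / (etaStage c pb μ 1 * gam c pb * ((lengthStage c pb μ 1 : ℝ) + 1))
      + noiseConst pb lam C₀ (gam c pb) b * etaStage c pb μ 1 ^ 2
      ≤ stageBound lam C₀ b c (etaStage c pb μ 1) := by
  have hη := etaStage_pos hA hU hlam hc hμ 1
  have hη1 := (etaStage_le hA hU hlam hc hμ 1).trans hc.η_le
  have hγ := hc.gam_pos hA hU
  have hlen := first_length_le (pb := pb) (μ := μ) hc
  have hsq := etaStage_sq hA hU hlam hc hμ 1
  have hst := start_coeff_le hlam hc hη hη1
  have hTf := hc.T_first
  have hR : 0 < rateConst lam C₀ := by have := hc.one_le; unfold rateConst; positivity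
  have hst0 : 0 ≤ startConst lam C₀ b r := by
    have := hc.one_le
    have := hc.r_pos
    have := hc.b_pos
    unfold startConst; positivity
  rw [noiseConst_gam hA hU c]
  unfold stageBound
  have hN : 0 < 8 * rateConst lam C₀ * C₀ * b * c.cγ := by
    have := hc.one_le
    have := hc.γ_pos
    have := hc.b_pos
    positivity
  generalize hNN : 8 * rateConst lam C₀ * C₀ * b * c.cγ = N at *
  simp only [le_refl, tsub_eq_zero_of_le, pow_zero, div_one] at hsq
  rw [← hsq] at hTf
  generalize etaStage c pb μ 1 = η at *
  generalize (lengthStage c pb μ 1 : ℝ) = T at *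
  generalize gam c pb = γ at *
  have hcT := hc.T_pos
  have hT0 : 0 ≤ T := le_trans (by positivity) hlen
  suffices h : (Δ + (8 * C₀ * r / lam + 4 * rateConst lam C₀ / (b * η)) * E₀)
      / (η * γ * (T + 1)) ≤ N * η ^ 2 by linarith
  rw [div_le_iff₀ (by positivity)]
  have h1 : c.cT ≤ T * (μ * η ^ 2 * γ) := by
    rwa [one_div, inv_mul_le_iff₀ (by positivity), mul_comm] at hlen
  have h2 : Δ + (8 * C₀ * r / lam + 4 * rateConst lam C₀ / (b * η)) * E₀
      ≤ (Δ + startConst lam C₀ b r * E₀) / η := by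
    rw [add_div]
    have : Δ ≤ Δ / η := by rw [le_div_iff₀ hη]; exact mul_le_of_le_one_right hΔ hη1
    have := mul_le_mul_of_nonneg_right hst hE
    rw [div_mul_eq_mul_div] at this
    linarith
  refine h2.trans ?_
  rw [div_le_iff₀ hη]
  have h3 : c.cT * (N * η ^ 2) ≤ T * (μ * η ^ 2 * γ) * (N * η ^ 2) :=
    mul_le_mul_of_nonneg_right h1 (by positivity)
  have h4 : T * (μ * η ^ 2 * γ) * (N * η ^ 2) ≤ T * (B * η ^ 2 * γ) * (N * η ^ 2) := by gcongr
  have hB : 0 < B := hμ.trans_le hμB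
  have h5 : B * (Δ + startConst lam C₀ b r * E₀) ≤ B * (T * (η ^ 2 * γ) * (N * η ^ 2)) := by
    linarith
  have h6 := le_of_mul_le_mul_left h5 hB
  have h7 : 0 ≤ η ^ 2 * γ * (N * η ^ 2) := by positivity
  linarith

/-- Since η_k² = 2η², the previous stage leaves a gap of 8Nη²/μ and an error of 4MNη², weighted by
s/η. Their sum is at most Nη²·ηγT as soon as 8/μ + 4sM/η ≤ ηγT; the two terms in the maximum
defining T cover the two summands. -/
theorem later_stage_arith {k : ℕ} (hk : 1 ≤ k) :
    (2 / μ * stageBound lam C₀ b c (etaStage c pb μ k)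
      + (8 * C₀ * r / lam + 4 * rateConst lam C₀ / (b * etaStage c pb μ (k + 1)))
        * ((2 + 10 * lipConst B D ^ 2) * stageBound lam C₀ b c (etaStage c pb μ k)))
      / (etaStage c pb μ (k + 1) * gam c pb * ((lengthStage c pb μ (k + 1) : ℝ) + 1))
      + noiseConst pb lam C₀ (gam c pb) b * etaStage c pb μ (k + 1) ^ 2
      ≤ stageBound lam C₀ b c (etaStage c pb μ (k + 1)) := by
  have hη := etaStage_pos hA hU hlam hc hμ (k + 1)
  have hη1 := (etaStage_le hA hU hlam hc hμ (k + 1)).trans hc.η_le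
  have hγ := hc.gam_pos hA hU
  obtain ⟨hl1, hl2⟩ := later_length_le (pb := pb) (μ := μ) hc (show 1 < k + 1 by omega)
  have hsq : etaStage c pb μ k ^ 2 = 2 * etaStage c pb μ (k + 1) ^ 2 := by
    rw [etaStage_sq hA hU hlam hc hμ, etaStage_sq hA hU hlam hc hμ]
    obtain ⟨j, rfl⟩ : ∃ j, k = j + 1 := ⟨k - 1, by omega⟩
    simp only [Nat.add_sub_cancel, pow_succ]
    field_simp
  have hst := start_coeff_le hlam hc hη hη1
  have hTl := hc.T_later
  have hst0 : 0 ≤ startConst lam C₀ b r := by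
    have := hc.one_le
    have := hc.r_pos
    have := hc.b_pos
    unfold startConst rateConst; positivity
  have hM : 0 < 2 + 10 * lipConst B D ^ 2 := by positivity
  rw [noiseConst_gam hA hU c]
  unfold stageBound
  have hN : 0 < 8 * rateConst lam C₀ * C₀ * b * c.cγ := by
    have := hc.one_le
    have := hc.γ_pos
    have := hc.b_pos
    unfold rateConst
    positivity
  generalize 8 * rateConst lam C₀ * C₀ * b * c.cγ = N at *
  rw [hsq]
  generalize etaStage c pb μ (k + 1) = η at *
  generalize (lengthStage c pb μ (k + 1) : ℝ) = T at *
  generalize gam c pb = γ at *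
  generalize 2 + 10 * lipConst B D ^ 2 = M at *
  have hcT := hc.T_pos
  have hT0 : 0 ≤ T := le_trans (by positivity) hl1
  suffices h : (2 / μ * (2 * N * (2 * η ^ 2))
      + (8 * C₀ * r / lam + 4 * rateConst lam C₀ / (b * η)) * (M * (2 * N * (2 * η ^ 2))))
      / (η * γ * (T + 1)) ≤ N * η ^ 2 by linarith
  rw [div_le_iff₀ (by positivity)]
  rw [div_le_iff₀ (by positivity)] at hl1 hl2
  have h1 := mul_le_mul_of_nonneg_right hst (show 0 ≤ M * (2 * N * (2 * η ^ 2)) by positivity)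
  generalize startConst lam C₀ b r = s at *
  have h2 : 8 / μ ≤ 8 / c.cT * (T * (η * γ)) := by
    rw [div_mul_eq_mul_div, div_le_div_iff₀ hμ hcT]
    linarith
  have h3 : 4 * s * M / η ≤ 4 * s * M / c.cT * (T * (η * γ)) := by
    rw [div_mul_eq_mul_div, div_le_div_iff₀ hη hcT]
    have := mul_le_mul_of_nonneg_left hl2 (show 0 ≤ 4 * s * M by positivity)
    linarith
  have h4 : 8 / c.cT * (T * (η * γ)) + 4 * s * M / c.cT * (T * (η * γ)) ≤ T * (η * γ) := by
    rw [← add_mul, ← add_div]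
    refine mul_le_of_le_one_left (by positivity) ?_
    rw [div_le_one hcT]
    exact hTl
  have h5 := mul_le_mul_of_nonneg_left ((add_le_add h2 h3).trans h4)
    (show 0 ≤ N * η ^ 2 by positivity)
  have e1 : N * η ^ 2 * (8 / μ + 4 * s * M / η)
      = 2 / μ * (2 * N * (2 * η ^ 2)) + s / η * (M * (2 * N * (2 * η ^ 2))) := by
    field_simp; ring
  have h6 : 0 ≤ N * η ^ 2 * (η * γ) := by positivity
  linarith

theorem controlled_reRsvrbLaw (hmin : ∀ x, pb.F xs ≤ pb.F x) (hμB : μ ≤ B) (hΔ : 0 ≤ Δ)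
    (hE : 0 ≤ E₀) (hPL : ∀ x ∈ X, μ * (pb.F x - pb.F xs) ≤ ‖gradient pb.F x‖ ^ 2)
    {ν : Measure (State m d e)} (hν : Controlled pb xs Δ E₀ ν) (k : ℕ)
    (hx : ∀ j < k + 1, ∀ t ≤ lengthStage c pb μ (j + 1), ∀ᵐ s ∂(iterLaw pb (paramsStage c pb μ (j + 1))
      (reRsvrbLaw pb (paramsStage c pb μ) (lengthStage c pb μ) ν j) t), s.x ∈ X) :
    Controlled pb xs (2 / μ * stageBound lam C₀ b c (etaStage c pb μ (k + 1)))
      ((2 + 10 * lipConst B D ^ 2) * stageBound lam C₀ b c (etaStage c pb μ (k + 1)))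
      (reRsvrbLaw pb (paramsStage c pb μ) (lengthStage c pb μ) ν (k + 1)) := by
  have hsb : ∀ η, 0 ≤ stageBound lam C₀ b c η := fun η => by
    have := hc.one_le
    have := hc.γ_pos
    have := hc.b_pos
    unfold stageBound rateConst; positivity
  have hT := fun j => hc.tuned hA hU hlam (etaStage_pos hA hU hlam hc hμ j)
    (etaStage_le hA hU hlam hc hμ j)
  induction k with
  | zero =>
    have hx0 := hx 0 Nat.one_pos
    unfold reRsvrbLaw at hx0 ⊢
    rw [paramsStage_eq hc] at hx0 ⊢
    exact hν.rsvrbLaw hA hU hlam hmin (hT 1) hμ hPL hΔ hE _ hx0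
      (first_stage_arith hA hU hlam hc hμ hμB hΔ hE)
  | succ k ih =>
    have h := ih fun j hj => hx j (hj.trans (Nat.lt_succ_self _))
    have hx0 := hx (k + 1) (Nat.lt_succ_self _)
    unfold reRsvrbLaw
    rw [paramsStage_eq hc] at hx0 ⊢
    have h0 := hsb (etaStage c pb μ (k + 1))
    exact h.rsvrbLaw hA hU hlam hmin (hT (k + 1 + 1)) hμ hPL (by positivity) (by positivity) _ hx0
      (later_stage_arith hA hU hlam hc hμ (Nat.le_add_left 1 k))

/-- This identity is the reason for the value of cε: the target accuracy of a stage is exactly what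
the recursion delivers. -/
theorem stageBound_eq (k : ℕ) :
    2 / μ * stageBound lam C₀ b c (etaStage c pb μ k) = epsStage c pb μ k := by
  rw [epsStage_eq hA hU hlam hc hμ, hc.ε_eq]
  unfold stageBound
  field_simp
  ring

end Schedule

end Bilevel

namespace Bilevel

/-! ### Total sample complexity and the final statement. -/

section Complexity

/-- The induction closes with constant 4 because 4 + √2 ≤ 4√2, that is √2 ≥ 4/3. -/
theorem sum_sqrt_two_pow_le (n : ℕ) : ∑ j ∈ Finset.range (n + 1), Real.sqrt 2 ^ j ≤ 4 * Real.sqrt 2 ^ n := by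
  induction n with
  | zero => simp
  | succ n ih =>
    rw [Finset.sum_range_succ, pow_succ]
    have h : (4 : ℝ) / 3 ≤ Real.sqrt 2 := Real.le_sqrt_of_sq_le (by norm_num)
    have := mul_le_mul_of_nonneg_left h (show 0 ≤ Real.sqrt 2 ^ n by positivity)
    linarith

theorem sum_two_pow_le (n : ℕ) : ∑ j ∈ Finset.range (n + 1), (2 : ℝ) ^ j ≤ 2 * 2 ^ n := by
  induction n with
  | zero => simp
  | succ n ih => rw [Finset.sum_range_succ, pow_succ]; linarith

/-- Also covers x < 1, where the natural-number ceiling truncates the exponent to 0; this is the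
case of a single stage. -/
theorem le_two_pow_ceil_logb {x : ℝ} (hx : 0 < x) : x ≤ 2 ^ ⌈Real.logb 2 x⌉₊ := by
  calc x = 2 ^ Real.logb 2 x := (Real.rpow_logb two_pos (by norm_num) hx).symm
    _ ≤ 2 ^ ((⌈Real.logb 2 x⌉₊ : ℕ) : ℝ) :=
        Real.rpow_le_rpow_of_exponent_le one_le_two (Nat.le_ceil _)
    _ = _ := Real.rpow_natCast _ _

theorem two_pow_ceil_logb_le {x : ℝ} (hx : 1 ≤ x) : 2 ^ ⌈Real.logb 2 x⌉₊ ≤ 2 * x := by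
  have h0 : 0 ≤ Real.logb 2 x := Real.logb_nonneg one_lt_two hx
  calc (2 : ℝ) ^ ⌈Real.logb 2 x⌉₊ = 2 ^ ((⌈Real.logb 2 x⌉₊ : ℕ) : ℝ) := (Real.rpow_natCast _ _).symm
    _ ≤ 2 ^ (Real.logb 2 x + 1) :=
        Real.rpow_le_rpow_of_exponent_le one_le_two (Nat.ceil_lt_add_one h0).le
    _ = _ := by
        rw [Real.rpow_add_one two_ne_zero, Real.rpow_logb two_pos (by norm_num) (by linarith), mul_comm]

variable {m d : ℕ} {e : Fin m → ℕ} {Ξ Z : Type*} [MeasurableSpace Ξ] [MeasurableSpace Z]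
  {pb : Problem m d e Ξ Z} {X : Set (Vec d)} {lam B κ Δ E₀ : ℝ} {D : ℕ} {xs : Vec d}
  {c : Constants} {C₀ b r μ : ℝ}
  (hA : Assumptions pb X) (hU : UniformBounds pb lam B κ D) (hlam : 0 < lam)
  (hc : GoodConstants lam B κ Δ E₀ D c C₀ b r) (hμ : 0 < μ)

include hA hU hlam hc hμ

/-- η_{j+1} = η₀/√2^j, so the two kinds of terms grow like √2^j and 2^j. The last summand is the
exceptional term of the first stage. -/
theorem lengthStage_succ_le (j : ℕ) : (lengthStage c pb μ (j + 1) : ℝ)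
    ≤ c.cT / (μ * c.η₀ * gam c pb) * Real.sqrt 2 ^ j
      + (c.cT + c.cγ * κ) / (c.η₀ ^ 2 * gam c pb) * 2 ^ j
      + if j = 0 then c.cT / (μ * c.η₀ ^ 2 * gam c pb) else 0 := by
  have hγ := hc.gam_pos hA hU
  have hη := etaStage_pos hA hU hlam hc hμ (j + 1)
  have hη1 := (etaStage_le hA hU hlam hc hμ (j + 1)).trans hc.η_le
  have hη0 := hc.η_pos
  have hcT := hc.T_pos
  have hγκ : gam c pb ≤ c.cγ * κ := inv_scale_le hA hU hc.γ_pos.le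
  have hsq := etaStage_sq hA hU hlam hc hμ (j + 1)
  rw [Nat.add_sub_cancel] at hsq
  have heta : etaStage c pb μ (j + 1) = c.η₀ / Real.sqrt 2 ^ j := by
    rw [← Real.sqrt_sq hη.le, hsq]
    refine Real.sqrt_eq_iff_mul_self_eq_of_pos (by positivity) |>.2 ?_
    have : Real.sqrt 2 ^ j * Real.sqrt 2 ^ j = 2 ^ j := by
      rw [← mul_pow, Real.mul_self_sqrt two_pos.le]
    rw [div_mul_div_comm, this, sq]
  have e1 : 1 / (μ * etaStage c pb μ (j + 1) * gam c pb)
      = 1 / (μ * c.η₀ * gam c pb) * Real.sqrt 2 ^ j := by rw [heta]; field_simp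
  have e2 : 1 / (etaStage c pb μ (j + 1) ^ 2 * gam c pb) = 1 / (c.η₀ ^ 2 * gam c pb) * 2 ^ j := by
    rw [hsq]; field_simp
  -- This pays for the 1 lost in rounding up.
  have h1 : 1 ≤ c.cγ * κ * (1 / (etaStage c pb μ (j + 1) ^ 2 * gam c pb)) := by
    rw [mul_one_div, le_div_iff₀ (by positivity), one_mul]
    calc etaStage c pb μ (j + 1) ^ 2 * gam c pb ≤ 1 * (c.cγ * κ) := by
          gcongr
          exact pow_le_one₀ hη.le hη1
      _ = _ := one_mul _
  have split : ∀ x y : ℝ, 0 ≤ x → 0 ≤ y → (⌈c.cT * max x y⌉₊ : ℝ) ≤ c.cT * x + c.cT * y + 1 := by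
    intro x y hx hy
    refine (Nat.ceil_lt_add_one (by positivity)).le.trans ?_
    have := mul_le_mul_of_nonneg_left (max_le_add_of_nonneg hx hy) hcT.le
    linarith
  have hT2 : 0 ≤ c.cT * (1 / (etaStage c pb μ (j + 1) ^ 2 * gam c pb)) := by positivity
  have goal_eq : c.cT / (μ * c.η₀ * gam c pb) * Real.sqrt 2 ^ j
      + (c.cT + c.cγ * κ) / (c.η₀ ^ 2 * gam c pb) * 2 ^ j
      = c.cT * (1 / (μ * etaStage c pb μ (j + 1) * gam c pb))
        + c.cT * (1 / (etaStage c pb μ (j + 1) ^ 2 * gam c pb))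
        + c.cγ * κ * (1 / (etaStage c pb μ (j + 1) ^ 2 * gam c pb)) := by
    rw [e1, e2]; ring
  rw [goal_eq]
  unfold lengthStage
  rcases Nat.eq_zero_or_pos j with rfl | hj
  · have hs := split (1 / (μ * etaStage c pb μ (0 + 1) * gam c pb))
      (1 / (μ * etaStage c pb μ (0 + 1) ^ 2 * gam c pb)) (by positivity) (by positivity)
    simp only [zero_add, le_refl, if_true] at hs hsq h1 hT2 ⊢
    rw [pow_zero, div_one] at hsq
    have : c.cT * (1 / (μ * etaStage c pb μ 1 ^ 2 * gam c pb)) = c.cT / (μ * c.η₀ ^ 2 * gam c pb) := by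
      rw [hsq, mul_one_div]
    linarith
  · have hs := split (1 / (μ * etaStage c pb μ (j + 1) * gam c pb))
      (1 / (etaStage c pb μ (j + 1) ^ 2 * gam c pb)) (by positivity) (by positivity)
    simp only [show ¬ (j + 1 ≤ 1) by omega, if_false, hj.ne']
    linarith

/-- Constant in the sample complexity bound. -/
noncomputable def complexityConst (c : Constants) (κ : ℝ) : ℝ :=
  4 * c.cT * Real.sqrt (2 * (c.cε * c.cγ)) / c.cγ + c.cT * Real.sqrt (c.cε * c.cγ) / (c.η₀ * c.cγ)
    + 4 * (c.cε * c.cγ) * (c.cT + c.cγ * κ) / c.cγ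

theorem sum_lengthStage_le (hκ : 0 ≤ κ) {ε : ℝ} (hε : 0 < ε) (hε1 : ε ≤ epsOne c pb μ) :
    ∑ k ∈ Finset.Icc 1 (1 + ⌈Real.logb 2 (epsOne c pb μ / ε)⌉₊), (lengthStage c pb μ k : ℝ)
      ≤ complexityConst c κ
        * (pb.Cp / (μ ^ (3 / 2 : ℝ) * m * ε ^ (1 / 2 : ℝ)) + pb.Cp / (μ * m * ε)) := by
  have hm : (0 : ℝ) < m := by exact_mod_cast hA.m_pos
  have hC := Cp_pos hA hU
  have hγ := hc.gam_pos hA hU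
  have hp := hc.pos hlam
  have hcγ := hc.γ_pos
  have hcε := hp.2.2.2.1
  have hcT := hc.T_pos
  have hη0 := hc.η_pos
  have hpow := two_pow_ceil_logb_le ((one_le_div hε).2 hε1)
  set n := ⌈Real.logb 2 (epsOne c pb μ / ε)⌉₊
  have hsum : ∑ k ∈ Finset.Icc 1 (1 + n), (lengthStage c pb μ k : ℝ)
      = ∑ j ∈ Finset.range (n + 1), (lengthStage c pb μ (j + 1) : ℝ) := by
    rw [add_comm 1 n, Finset.range_eq_Ico,
      Finset.sum_Ico_add' (fun k => (lengthStage c pb μ k : ℝ)) 0 (n + 1) 1]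
    rfl
  rw [hsum]
  refine (Finset.sum_le_sum fun j _ => lengthStage_succ_le hA hU hlam hc hμ j).trans ?_
  rw [Finset.sum_add_distrib, Finset.sum_add_distrib, ← Finset.mul_sum, ← Finset.mul_sum,
    Finset.sum_ite_eq' (Finset.range (n + 1)) 0 (fun _ => c.cT / (μ * c.η₀ ^ 2 * gam c pb)),
    if_pos (by simp)]
  have hε1' := hε1
  rw [epsOne_eq hA hU] at hpow hε1'
  set G := c.cε * c.cγ with hG
  have hG0 : 0 < G := by positivity
  have r1 : μ ^ (3 / 2 : ℝ) = μ * Real.sqrt μ := by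
    rw [Real.sqrt_eq_rpow, ← Real.rpow_one_add' hμ.le (by norm_num)]; norm_num
  have r2 : ε ^ (1 / 2 : ℝ) = Real.sqrt ε := (Real.sqrt_eq_rpow ε).symm
  rw [r1, r2]
  have hsμ := Real.sqrt_pos.2 hμ
  have hsε := Real.sqrt_pos.2 hε
  have k1 : Real.sqrt 2 ^ n ≤ Real.sqrt (2 * G) * c.η₀ / (Real.sqrt μ * Real.sqrt ε) := by
    have e1 : Real.sqrt 2 ^ n = Real.sqrt (2 ^ n) := by
      rw [eq_comm, Real.sqrt_eq_iff_mul_self_eq_of_pos (by positivity), ← mul_pow,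
        Real.mul_self_sqrt two_pos.le]
    have e2 : Real.sqrt (2 * G) * c.η₀ / (Real.sqrt μ * Real.sqrt ε)
        = Real.sqrt (2 * (G * c.η₀ ^ 2 / μ / ε)) := by
      rw [← Real.sqrt_sq hη0.le, ← Real.sqrt_mul (by positivity), ← Real.sqrt_mul hμ.le,
        ← Real.sqrt_div (by positivity), Real.sqrt_sq hη0.le]
      congr 1
      field_simp
    rw [e1, e2]
    exact Real.sqrt_le_sqrt hpow
  -- Equivalent to ε ≤ ε₁; it allows the first-stage term 1/(μη₀²γ) to be charged to the term of
  -- order μ^(−3/2) ε^(−1/2).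
  have k3 : 1 ≤ Real.sqrt G * c.η₀ / (Real.sqrt μ * Real.sqrt ε) := by
    rw [one_le_div (by positivity), ← Real.sqrt_sq hη0.le, ← Real.sqrt_mul hG0.le,
      ← Real.sqrt_mul hμ.le]
    refine Real.sqrt_le_sqrt ?_
    rwa [le_div_iff₀ hμ, mul_comm] at hε1'
  have b1 : c.cT / (μ * c.η₀ * gam c pb) * ∑ j ∈ Finset.range (n + 1), Real.sqrt 2 ^ j
      ≤ 4 * c.cT * Real.sqrt (2 * G) / c.cγ * (pb.Cp / (μ * Real.sqrt μ * m * Real.sqrt ε)) := by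
    calc _ ≤ c.cT / (μ * c.η₀ * gam c pb)
          * (4 * (Real.sqrt (2 * G) * c.η₀ / (Real.sqrt μ * Real.sqrt ε))) := by
          refine mul_le_mul_of_nonneg_left ((sum_sqrt_two_pow_le n).trans ?_) (by positivity)
          linarith
      _ = _ := by unfold gam; field_simp
  have b2 : (c.cT + c.cγ * κ) / (c.η₀ ^ 2 * gam c pb) * ∑ j ∈ Finset.range (n + 1), (2 : ℝ) ^ j
      ≤ 4 * G * (c.cT + c.cγ * κ) / c.cγ * (pb.Cp / (μ * m * ε)) := by
    calc _ ≤ (c.cT + c.cγ * κ) / (c.η₀ ^ 2 * gam c pb) * (4 * (G * c.η₀ ^ 2 / μ / ε)) := by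
          refine mul_le_mul_of_nonneg_left ((sum_two_pow_le n).trans ?_) (by positivity)
          linarith
      _ = _ := by unfold gam; field_simp
  have b3 : c.cT / (μ * c.η₀ ^ 2 * gam c pb)
      ≤ c.cT * Real.sqrt G / (c.η₀ * c.cγ) * (pb.Cp / (μ * Real.sqrt μ * m * Real.sqrt ε)) := by
    calc _ = c.cT / (μ * c.η₀ ^ 2 * gam c pb) * 1 := (mul_one _).symm
      _ ≤ c.cT / (μ * c.η₀ ^ 2 * gam c pb)
          * (Real.sqrt G * c.η₀ / (Real.sqrt μ * Real.sqrt ε)) :=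
          mul_le_mul_of_nonneg_left k3 (by positivity)
      _ = _ := by unfold gam; field_simp
  have u0 : 0 ≤ pb.Cp / (μ * m * ε) := by positivity
  have w0 : 0 ≤ pb.Cp / (μ * Real.sqrt μ * m * Real.sqrt ε) := by positivity
  unfold complexityConst
  rw [← hG]
  have a1 : 0 ≤ 4 * c.cT * Real.sqrt (2 * G) / c.cγ * (pb.Cp / (μ * m * ε)) := by positivity
  have a2 : 0 ≤ c.cT * Real.sqrt G / (c.η₀ * c.cγ) * (pb.Cp / (μ * m * ε)) := by positivity
  have a3 : 0 ≤ 4 * G * (c.cT + c.cγ * κ) / c.cγ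
    * (pb.Cp / (μ * Real.sqrt μ * m * Real.sqrt ε)) := by positivity
  linarith

omit hlam hc hμ in
theorem UniformBounds.mono {B' κ' : ℝ} (hB : B ≤ B') (hκ : κ ≤ κ') :
    UniformBounds pb lam B' κ' D where
  lam_le := hU.lam_le
  Lg_le := hU.Lg_le.trans hB
  const_le i := by
    have h := hU.const_le i
    refine ⟨?_, ?_, ?_, ?_, ?_, ?_, ?_, ?_, ?_, ?_⟩ <;> refine le_trans ?_ hB <;> tauto
  dim_le := hU.dim_le
  balanced i := (hU.balanced i).trans (mul_le_mul_of_nonneg_right hκ (Cp_nonneg hA))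

omit hA hU hlam hc hμ in
theorem controlled_initial (hmin : ∀ x, pb.F xs ≤ pb.F x) {ν : Measure (State m d e)}
    [hν : IsProbabilityMeasure ν] (hf : ∀ᵐ s ∂ν, Feasible pb s)
    (hΦ : Integrable (fun s => pb.F s.x - pb.F xs) ν) (hΔ : ∫ s, (pb.F s.x - pb.F xs) ∂ν ≤ Δ)
    (hS : Integrable (stateError pb) ν) (hE : ∫ s, stateError pb s ∂ν ≤ E₀) :
    Controlled pb xs Δ E₀ ν := by
  refine ⟨hν, hf, ?_, ?_⟩
  · rw [← ofReal_integral_eq_lintegral_ofReal hΦ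
      (Filter.Eventually.of_forall fun s => sub_nonneg.2 (hmin _))]
    exact ENNReal.ofReal_le_ofReal hΔ
  · rw [← ofReal_integral_eq_lintegral_ofReal hS
      (Filter.Eventually.of_forall fun s => stateError_nonneg pb s)]
    exact ENNReal.ofReal_le_ofReal hE

omit hc hμ in
theorem Controlled.integrable_gap (hmin : ∀ x, pb.F xs ≤ pb.F x) {ν : Measure (State m d e)}
    {φ σ : ℝ} (hφ : 0 ≤ φ) (h : Controlled pb xs φ σ ν) :
    Integrable (fun s => pb.F s.x - pb.F xs) ν ∧ ∫ s, (pb.F s.x - pb.F xs) ∂ν ≤ φ := by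
  have hmeas : Measurable fun s : State m d e => pb.F s.x - pb.F xs :=
    (measurable_F_x hA hU hlam).sub_const _
  have h0 : 0 ≤ᵐ[ν] fun s => pb.F s.x - pb.F xs :=
    Filter.Eventually.of_forall fun s => sub_nonneg.2 (hmin _)
  refine ⟨(lintegral_ofReal_ne_top_iff_integrable hmeas.aestronglyMeasurable h0).1
    (h.gap.trans_lt ENNReal.ofReal_lt_top).ne, ?_⟩
  rw [integral_eq_lintegral_of_nonneg_ae h0 hmeas.aestronglyMeasurable]
  exact ENNReal.toReal_le_of_le_ofReal hφ h.gap

end Complexity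

end Bilevel

theorem theorem3 (lam B κ Δ₀ E₀ : ℝ) (D : ℕ) (hlam : 0 < lam) :
    ∃ (c : Bilevel.Constants) (A : ℝ), c.Pos ∧ 0 < A ∧
      ∀ (Ξ : Type*) (Z : Type*) [MeasurableSpace Ξ] [MeasurableSpace Z]
        (m d : ℕ) (e : Fin m → ℕ) (pb : Bilevel.Problem m d e Ξ Z) (X : Set (Bilevel.Vec d)),
        Bilevel.Assumptions pb X → Bilevel.UniformBounds pb lam B κ D →
        Bilevel.Admissible c pb X ∧
        ∀ (xs : Bilevel.Vec d), (∀ x, pb.F xs ≤ pb.F x) →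
        ∀ μ : ℝ, 0 < μ → μ ≤ B →
        (∀ x ∈ X, μ * (pb.F x - pb.F xs) ≤ ‖gradient pb.F x‖ ^ 2) →
        ∀ (ν : MeasureTheory.Measure (Bilevel.State m d e)), MeasureTheory.IsProbabilityMeasure ν →
        (∀ᵐ s ∂ν, Bilevel.Feasible pb s) →
        MeasureTheory.Integrable (fun s => pb.F s.x - pb.F xs) ν →
        ∫ s, (pb.F s.x - pb.F xs) ∂ν ≤ Δ₀ →
        MeasureTheory.Integrable (Bilevel.stateError pb) ν →
        ∫ s, Bilevel.stateError pb s ∂ν ≤ E₀ →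
        ∀ ε : ℝ, 0 < ε →
        let θ := Bilevel.paramsStage c pb μ
        let T := Bilevel.lengthStage c pb μ
        let ε₁ := Bilevel.epsOne c pb μ
        let K := 1 + ⌈Real.logb 2 (ε₁ / ε)⌉₊
        let law := Bilevel.reRsvrbLaw pb θ T ν
        (∀ k < K, ∀ t ≤ T (k + 1), ∀ᵐ s ∂(Bilevel.iterLaw pb (θ (k + 1)) (law k) t), s.x ∈ X) →
        MeasureTheory.IsProbabilityMeasure (law K) ∧
        MeasureTheory.Integrable (fun s => pb.F s.x - pb.F xs) (law K) ∧
        ∫ s, (pb.F s.x - pb.F xs) ∂(law K) ≤ ε ∧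
        (ε ≤ ε₁ → (∑ k ∈ Finset.Icc 1 K, (T k : ℝ)) ≤
          A * (pb.Cp / (μ ^ (3 / 2 : ℝ) * m * ε ^ (1 / 2 : ℝ)) + pb.Cp / (μ * m * ε))) := by
  have hκ1 : (1 : ℝ) ≤ max κ 1 := le_max_right _ _
  -- The given bounds may be too small or negative; enlarging them keeps every hypothesis and makes
  -- the constants positive.
  obtain ⟨c, C₀, b, r, hc⟩ := Bilevel.exists_goodConstants (lam := lam) (B := max B 1)
    (κ := max κ 1) (Δ := max Δ₀ 0) (E₀ := max E₀ 0) D hlam (le_max_right _ _) hκ1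
    (le_max_right _ _) (le_max_right _ _)
  have hpos := hc.pos hlam
  refine ⟨c, Bilevel.complexityConst c (max κ 1), hpos, ?_, ?_⟩
  · have := hpos.1
    have := hpos.2.2.1
    have := hpos.2.2.2.1
    have := hpos.2.2.2.2.1
    unfold Bilevel.complexityConst
    positivity
  intro Ξ Z _ _ m d e pb X hA hU₀
  have hU := hU₀.mono hA (le_max_left B 1) (le_max_left κ 1)
  refine ⟨hc.admissible hA hU hlam, ?_⟩
  intro xs hmin μ hμ hμB hPL ν hν hf hΦ hΔ hS hE ε hε θ T ε₁ K law hx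
  have hcε := hpos.2.2.2.1
  have hε₁ : 0 < ε₁ := by
    have := hpos.1
    have := hpos.2.2.1
    show 0 < Bilevel.epsOne c pb μ
    rw [Bilevel.epsOne_eq hA hU]
    positivity
  have hK : K = ⌈Real.logb 2 (ε₁ / ε)⌉₊ + 1 := add_comm _ _
  have hctl := Bilevel.controlled_reRsvrbLaw hA hU hlam hc hμ hmin (hμB.trans (le_max_left _ _))
    (le_max_right _ _) (le_max_right _ _) hPL
    (Bilevel.controlled_initial hmin hf hΦ (hΔ.trans (le_max_left _ _)) hS
      (hE.trans (le_max_left _ _))) ⌈Real.logb 2 (ε₁ / ε)⌉₊ (by rw [← hK]; exact hx)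
  rw [← hK, Bilevel.stageBound_eq hA hU hlam hc hμ] at hctl
  -- The exponent in stage K is K − 1, the rounded logarithm of ε₁/ε.
  have heps : Bilevel.epsStage c pb μ K ≤ ε := by
    rw [hK]
    show ε₁ / 2 ^ ⌈Real.logb 2 (ε₁ / ε)⌉₊ ≤ ε
    have := Bilevel.le_two_pow_ceil_logb (div_pos hε₁ hε)
    rwa [div_le_iff₀ hε, mul_comm, ← div_le_iff₀ (by positivity)] at this
  have heps0 : 0 ≤ Bilevel.epsStage c pb μ K := div_nonneg hε₁.le (by positivity)
  obtain ⟨hint, hle⟩ := hctl.integrable_gap hA hU hlam hmin heps0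
  exact ⟨hctl.prob, hint, hle.trans heps,
    Bilevel.sum_lengthStage_le hA hU hlam hc hμ (zero_le_one.trans hκ1) hε⟩
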